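/- Conventions. Manifolds are compact and smooth, with possibly empty boundary; a manifold $M$ with non-empty boundary is equipped with a collar, i.e. a diffeomorphism $c$ of $\partial M\times[0,1)$ onto an open neighbourhood of $\partial M$ with $c(\partial M\times\{0\})=\partial M$. Let $\mathcal R(M)$ be the space of smooth Riemannian metrics $g$ on $M$ such that $c^*g=g|_{\partial M}+dt^2$ on $\partial M\times[0,\varepsilon)$ for some $\varepsilon>0$ (depending on $g$), with the $C^\infty$-topology, and let $\mathrm{res}(g)=g|_{\partial M}$. Let $p,k\ge 0$ be integers. A metric $g$ on a manifold of dimension $d\ge p+2$ has positive $p$-curvature if for every point $x$, every $p$-dimensional subspace $P\subseteq T_xM$ and every orthonormal basis $E_1,\dots,E_{d-p}$ of $P^\perp$ one has $\sum_{i,j=1}^{d-p}\sec(E_i,E_j)>0$, where $\sec(E_i,E_i):=0$. A metric $g$ on a manifold of dimension $d\ge\max\{2,k+1\}$ has $(d-k)$-positive Ricci curvature if $\sum_{i=1}^{d-k}\mathrm{Ric}(E_i,E_i)>0$ for all orthonormal $E_1,\dots,E_{d-k}$ in each tangent space (equivalently, the sum of the $d-k$ smallest eigenvalues of the Ricci curvature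 is positive everywhere). In lower dimensions no metric satisfies these conditions, by convention. Let $\mathcal R_{p\text{-curv}>0}(M)$ and $\mathcal R_{(d-k)\text{-Ric}>0}(M)$, where $d=\dim M$, be the subspaces of $\mathcal R(M)$ of metrics with positive $p$-curvature and with $(d-k)$-positive Ricci curvature, respectively. An assignment $M\mapsto\mathcal F(M)\subseteq\mathcal R(M)$ is called fibrant if for every $M$ with $\partial M\ne\emptyset$ one has $\mathrm{res}(\mathcal F(M))\subseteq\mathcal F(\partial M)$ and the restriction map $\mathrm{res}\colon\mathcal F(M)\to\mathcal F(\partial M)$ is a Serre fibration. Proposition. For all integers $p,k\ge0$, both $\mathcal R_{p\text{-curv}>0}$ and $\mathcal R_{(d-k)\text{-Ric}>0}$ are fibrant. Moreover, for every non-empty closed manifold $N$ of dimension $d$ and every $g\in\mathcal R(N)$, the metric $g$ has positive $p$-curvature (respectively $(d-k)$-positive Ricci curvature) if and only if the metric $g+dt^2$ on $N\times[0,1]$ has positive $p$-curvature (respectively $(d+1-k)$-positive Ricci curvature). -/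

import Mathlib

universe u

open Set Module
open scoped Manifold ContDiff

noncomputable section

/-! ### Curvature of a metric given in coordinates

`G : E → E →L[ℝ] E →L[ℝ] ℝ` is the coordinate expression of a Riemannian metric on a subset `S`
of a finite-dimensional vector space `E`. -/

section Coordinates

variable {E : Type*} [NormedAddCommGroup E] [NormedSpace ℝ E]

set_option synthInstance.maxHeartbeats 200000 in
set_option maxSynthPendingDepth 3 in
/-- The Christoffel symbols of the first kind:
`Γ₁(u, v, w) = (D_u G(v, w) + D_v G(u, w) - D_w G(u, v)) / 2`. -/
def christoffelLower (G : E → E →L[ℝ] E →L[ℝ] ℝ) (S : Set E) (y : E) :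
    E →L[ℝ] E →L[ℝ] E →L[ℝ] ℝ :=
  let D : E →L[ℝ] E →L[ℝ] E →L[ℝ] ℝ := fderivWithin ℝ G S y
  let D' : E →L[ℝ] E →L[ℝ] E →L[ℝ] ℝ := D.flip
  let τ : (E →L[ℝ] E →L[ℝ] ℝ) →L[ℝ] E →L[ℝ] E →L[ℝ] ℝ :=
    (ContinuousLinearMap.flipₗᵢ ℝ E E ℝ).toContinuousLinearEquiv.toContinuousLinearMap
  (2⁻¹ : ℝ) • (D + D' - τ.comp D')

theorem christoffelLower_apply (G : E → E →L[ℝ] E →L[ℝ] ℝ) (S : Set E) (y u v w : E) :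
    christoffelLower G S y u v w =
      (fderivWithin ℝ G S y u v w + fderivWithin ℝ G S y v u w
        - fderivWithin ℝ G S y w u v) / 2 := by
  change (2⁻¹ : ℝ) * (fderivWithin ℝ G S y u v w + fderivWithin ℝ G S y v u w
    - fderivWithin ℝ G S y w u v) = _
  ring

/-- The Christoffel symbols `Γ(u, v)` of the Levi-Civita connection, characterized by
`G(Γ(u, v), w) = Γ₁(u, v, w)`. -/
def christoffel (G : E → E →L[ℝ] E →L[ℝ] ℝ) (S : Set E) (y : E) : E →L[ℝ] E →L[ℝ] E :=
  (ContinuousLinearMap.compL ℝ E (E →L[ℝ] ℝ) E (ContinuousLinearMap.inverse (G y))).comp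
    (christoffelLower G S y)

theorem christoffel_apply (G : E → E →L[ℝ] E →L[ℝ] ℝ) (S : Set E) (y u v : E) :
    christoffel G S y u v = ContinuousLinearMap.inverse (G y) (christoffelLower G S y u v) :=
  rfl

/-- The curvature tensor `R(u, v) w = ∇_u ∇_v w - ∇_v ∇_u w - ∇_[u, v] w` in coordinates. -/
def coordRiemann (G : E → E →L[ℝ] E →L[ℝ] ℝ) (S : Set E) (y u v w : E) : E :=
  fderivWithin ℝ (christoffel G S) S y u v w - fderivWithin ℝ (christoffel G S) S y v u w
    + christoffel G S y u (christoffel G S y v w) - christoffel G S y v (christoffel G S y u w)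

/-- The linear map `z ↦ R(z, v) w`, whose trace is the Ricci curvature `Ric(v, w)`. -/
def coordRiemannLinear (G : E → E →L[ℝ] E →L[ℝ] ℝ) (S : Set E) (y v w : E) : E →ₗ[ℝ] E where
  toFun z := coordRiemann G S y z v w
  map_add' a b := by
    simp only [coordRiemann, map_add, add_apply]
    abel
  map_smul' c a := by
    simp only [coordRiemann, map_smul, smul_apply, RingHom.id_apply,
      smul_add, smul_sub]

end Coordinates

/-! ### Tensor fields of type `(0,2)` on a manifold, their curvature and their topology -/

section TensorFields

variable {E : Type*} [NormedAddCommGroup E] [NormedSpace ℝ E]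
  {H : Type*} [TopologicalSpace H] (I : ModelWithCorners ℝ E H)
  (M : Type*) [TopologicalSpace M] [ChartedSpace H M]

/-- (Not necessarily smooth) fields of bilinear forms on the tangent spaces of `M`. -/
def BilinField : Type _ :=
  ∀ x : M, TangentSpace I x →L[ℝ] TangentSpace I x →L[ℝ] ℝ

variable {I M}

/-- `g` is a smooth Riemannian metric. -/
def IsSmoothMetric (g : BilinField I M) [IsManifold I ∞ M] : Prop :=
  ∃ G : Bundle.ContMDiffRiemannianMetric I ∞ E (fun x : M ↦ TangentSpace I x), ∀ x, G.inner x = g x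

/-- The coordinate expression of `g` in the preferred chart at `x₀`. -/
def coordForm (g : BilinField I M) (x₀ : M) (y : E) : E →L[ℝ] E →L[ℝ] ℝ :=
  let L : E →L[ℝ] E := mfderivWithin 𝓘(ℝ, E) I (extChartAt I x₀).symm (range I) y
  let b : E →L[ℝ] E →L[ℝ] ℝ := g ((extChartAt I x₀).symm y)
  b.bilinearComp L L

/-- The `C^∞`-topology: uniform convergence of all derivatives of the coordinate expressions on
all compact subsets of (the ranges of) the charts. -/
instance BilinField.topologicalSpace : TopologicalSpace (BilinField I M) :=
  ⨅ (x₀ : M) (k : ℕ), TopologicalSpace.induced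
    (fun g : BilinField I M ↦ UniformOnFun.ofFun {K : Set E | IsCompact K ∧ K ⊆ (extChartAt I x₀).target}
      (iteratedFDerivWithin ℝ k (coordForm g x₀) (range I)))
    inferInstance

/-- The curvature tensor `R(u, v) w` of `g` at `x`; the tangent space `TangentSpace I x` is
`E`, via the preferred chart at `x`. -/
def curvatureTensor (g : BilinField I M) (x : M) (u v w : TangentSpace I x) : TangentSpace I x :=
  coordRiemann (E := E) (coordForm g x) (range I) (extChartAt I x x) u v w

/-- The sectional curvature `⟨R(u, v) v, u⟩` of an orthonormal pair `u, v`. -/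
def sectional (g : BilinField I M) (x : M) (u v : TangentSpace I x) : ℝ :=
  g x (curvatureTensor g x u v v) u

/-- The Ricci curvature `Ric(v, w) = tr (z ↦ R(z, v) w)`. -/
def ricci (g : BilinField I M) (x : M) (v w : TangentSpace I x) : ℝ :=
  LinearMap.trace ℝ E (coordRiemannLinear (coordForm g x) (range I) (extChartAt I x x) v w)

/-- `e` is an orthonormal family in the tangent space at `x` with respect to `g`. -/
def IsOrthonormalAt (g : BilinField I M) (x : M) {m : ℕ} (e : Fin m → TangentSpace I x) : Prop :=
  ∀ i j, g x (e i) (e j) = if i = j then 1 else 0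

/-- Positive `p`-curvature on a manifold of dimension `d ≥ p + 2`: for every `p`-plane `P` in a
tangent space and every orthonormal basis `(e i)` of its `g`-orthogonal complement, the number
`s_p(P) = ∑_{i, j} sec(e i, e j)`, where `sec(e i, e i) := 0`, is positive. In dimensions below
`p + 2` the condition is never satisfied, by convention. -/
def PosPCurv (p : ℕ) (g : BilinField I M) : Prop :=
  p + 2 ≤ finrank ℝ E ∧
  ∀ (x : M) (P : Submodule ℝ (TangentSpace I x)), finrank ℝ P = p →
    ∀ e : Fin (finrank ℝ E - p) → TangentSpace I x,
      IsOrthonormalAt g x e → (∀ v ∈ P, ∀ i, g x v (e i) = 0) →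
      0 < ∑ i, ∑ j, if i = j then 0 else sectional g x (e i) (e j)

/-- `m`-positive Ricci curvature: `∑_{i = 1}^m Ric(e i, e i) > 0` for all orthonormal
`e 1, …, e m`, i.e. the sum of the `m` smallest eigenvalues of the Ricci curvature is positive. -/
def PosRic (m : ℕ) (g : BilinField I M) : Prop :=
  ∀ (x : M) (e : Fin m → TangentSpace I x), IsOrthonormalAt g x e → 0 < ∑ i, ricci g x (e i) (e i)

/-- `(d - k)`-positive Ricci curvature on a manifold of dimension `d ≥ max {2, k + 1}`. In lower
dimensions the condition is never satisfied, by convention. -/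
def PosCoRic (k : ℕ) (g : BilinField I M) : Prop :=
  max 2 (k + 1) ≤ finrank ℝ E ∧ PosRic (finrank ℝ E - k) g

/-- The cylindrical metric `g + dt²` on `M × [0, 1]`. -/
def stab (g : BilinField I M) : BilinField (I.prod (𝓡∂ 1)) (M × Icc (0 : ℝ) 1) := fun q ↦
  let L : E × EuclideanSpace ℝ (Fin 1) →L[ℝ] E := mfderiv (I.prod (𝓡∂ 1)) I Prod.fst q
  let dt : E × EuclideanSpace ℝ (Fin 1) →L[ℝ] ℝ :=
    mfderiv (I.prod (𝓡∂ 1)) 𝓘(ℝ, ℝ) (fun r : M × Icc (0 : ℝ) 1 ↦ (r.2 : ℝ)) q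
  let b : E →L[ℝ] E →L[ℝ] ℝ := g q.1
  (b.bilinearComp L L + dt.smulRight dt : E × EuclideanSpace ℝ (Fin 1) →L[ℝ]
    E × EuclideanSpace ℝ (Fin 1) →L[ℝ] ℝ)

end TensorFields

/-! ### Compact manifolds with collared boundary and their spaces of metrics -/

/-- The half-open cylinder `N × [0, 1)`, as a subset of `N × ℝ`. -/
def cyl (N : Type*) : Set (N × ℝ) := univ ×ˢ Ico (0 : ℝ) 1

/-- A compact smooth manifold `carrier` with (possibly empty) boundary. The boundary is
presented as a closed manifold `bd`, together with a collar, i.e. a diffeomorphism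
`collar` of `bd × [0, 1)` onto an open subset of `carrier` that carries `bd × {0}` onto the
boundary. (The values of `collar` outside `bd × [0, 1)` play no role. The collar excludes
corners.) -/
structure Mfd : Type (u + 1) where
  E : Type
  [normedAddCommGroupE : NormedAddCommGroup E]
  [normedSpaceE : NormedSpace ℝ E]
  [finiteDimensionalE : FiniteDimensional ℝ E]
  H : Type
  [topologicalSpaceH : TopologicalSpace H]
  I : ModelWithCorners ℝ E H
  carrier : Type u
  [topologicalSpace : TopologicalSpace carrier]
  [chartedSpace : ChartedSpace H carrier]
  [isManifold : IsManifold I ∞ carrier]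
  [compactSpace : CompactSpace carrier]
  [t2Space : T2Space carrier]
  EB : Type
  [normedAddCommGroupEB : NormedAddCommGroup EB]
  [normedSpaceEB : NormedSpace ℝ EB]
  [finiteDimensionalEB : FiniteDimensional ℝ EB]
  HB : Type
  [topologicalSpaceHB : TopologicalSpace HB]
  IB : ModelWithCorners ℝ EB HB
  bd : Type u
  [topologicalSpaceB : TopologicalSpace bd]
  [chartedSpaceB : ChartedSpace HB bd]
  [isManifoldB : IsManifold IB ∞ bd]
  [compactSpaceB : CompactSpace bd]
  [t2SpaceB : T2Space bd]
  [boundarylessB : BoundarylessManifold IB bd]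
  collar : bd × ℝ → carrier
  contMDiffOn_collar : ContMDiffOn (IB.prod 𝓘(ℝ, ℝ)) I ∞ collar (cyl bd)
  isOpen_collar : IsOpen (collar '' cyl bd)
  exists_smooth_inverse : Nonempty bd → ∃ r : carrier → bd × ℝ,
    ContMDiffOn I (IB.prod 𝓘(ℝ, ℝ)) ∞ r (collar '' cyl bd) ∧ ∀ q ∈ cyl bd, r (collar q) = q
  range_collar_zero : range (fun x ↦ collar (x, 0)) = I.boundary carrier

namespace Mfd

attribute [instance] normedAddCommGroupE normedSpaceE finiteDimensionalE topologicalSpaceH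
  topologicalSpace chartedSpace isManifold compactSpace t2Space
  normedAddCommGroupEB normedSpaceEB finiteDimensionalEB topologicalSpaceHB
  topologicalSpaceB chartedSpaceB isManifoldB compactSpaceB t2SpaceB boundarylessB

/-- A closed manifold, as a manifold with empty boundary. -/
def ofClosed {E : Type} [NormedAddCommGroup E] [NormedSpace ℝ E] [FiniteDimensional ℝ E]
    {H : Type} [TopologicalSpace H] (I : ModelWithCorners ℝ E H)
    (N : Type u) [TopologicalSpace N] [ChartedSpace H N] [IsManifold I ∞ N]
    [CompactSpace N] [T2Space N] [BoundarylessManifold I N] : Mfd.{u} :=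
  letI : ChartedSpace ℝ PEmpty.{u + 1} := ChartedSpace.empty ℝ PEmpty
  { E := E, H := H, I := I, carrier := N
    EB := ℝ, HB := ℝ, IB := 𝓘(ℝ, ℝ), bd := PEmpty.{u + 1}
    isManifoldB := inferInstance
    boundarylessB := inferInstance
    collar := fun q ↦ q.1.elim
    contMDiffOn_collar := fun q ↦ q.1.elim
    isOpen_collar := by
      have h : cyl PEmpty.{u + 1} = ∅ := by
        ext q
        exact q.1.elim
      simp [h]
    exists_smooth_inverse := fun h ↦ h.elim PEmpty.elim
    range_collar_zero := by
      rw [ModelWithCorners.Boundaryless.boundary_eq_empty]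
      exact range_eq_empty _ }

/-- The boundary `∂M`, a closed manifold. -/
def boundary (M : Mfd.{u}) : Mfd.{u} := ofClosed M.IB M.bd

/-- The fields of bilinear forms on `M`, with the `C^∞`-topology. -/
abbrev Form (M : Mfd.{u}) : Type u := BilinField M.I M.carrier

/-- The restriction of a field of bilinear forms on `M` to the boundary, i.e. its pullback along
the inclusion `x ↦ collar (x, 0)`. -/
def res (M : Mfd.{u}) (g : M.Form) : M.boundary.Form := fun x : M.bd ↦
  let L : M.EB →L[ℝ] M.E := mfderiv M.IB M.I (fun z : M.bd ↦ M.collar (z, 0)) x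
  let b : M.E →L[ℝ] M.E →L[ℝ] ℝ := g (M.collar (x, 0))
  (b.bilinearComp L L : M.EB →L[ℝ] M.EB →L[ℝ] ℝ)

/-- The pullback of `g` along the collar, at a point `q` of `bd × [0, 1)`. -/
def collarPullback (M : Mfd.{u}) (g : M.Form) (q : M.bd × ℝ) :
    M.EB × ℝ →L[ℝ] M.EB × ℝ →L[ℝ] ℝ :=
  let L : M.EB × ℝ →L[ℝ] M.E := mfderivWithin (M.IB.prod 𝓘(ℝ, ℝ)) M.I M.collar (cyl M.bd) q
  let b : M.E →L[ℝ] M.E →L[ℝ] ℝ := g (M.collar q)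
  b.bilinearComp L L

/-- The restriction of `g` to the boundary, with values considered as forms on the model space. -/
def resForm (M : Mfd.{u}) (g : M.Form) (x : M.bd) : M.EB →L[ℝ] M.EB →L[ℝ] ℝ := M.res g x

/-- The space `𝓡(M)` of smooth Riemannian metrics on `M` that are of the product form
`g|_{∂M} + dt²` on `∂M × [0, ε)`, for some `ε > 0`. -/
def metrics (M : Mfd.{u}) : Set M.Form :=
  {g | IsSmoothMetric g ∧ ∃ ε : ℝ, 0 < ε ∧ ε ≤ 1 ∧
    ∀ (x : M.bd) (t : ℝ), 0 ≤ t → t < ε → ∀ (u v : M.EB) (a b : ℝ),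
      M.collarPullback g (x, t) (u, a) (v, b) = M.resForm g x u v + a * b}

/-- The metrics of positive `p`-curvature. -/
def posPCurv (p : ℕ) (M : Mfd.{u}) : Set M.Form := {g | g ∈ M.metrics ∧ PosPCurv p g}

/-- The metrics of `(d - k)`-positive Ricci curvature, where `d` is the dimension of `M`. -/
def posCoRic (k : ℕ) (M : Mfd.{u}) : Set M.Form := {g | g ∈ M.metrics ∧ PosCoRic k g}

end Mfd

/-! ### Fibrancy -/

/-- Serre fibrations: continuous maps with the homotopy lifting property for all cubes. -/
def IsSerreFibration {X Y : Type*} [TopologicalSpace X] [TopologicalSpace Y] (f : X → Y) : Prop :=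
  Continuous f ∧
  ∀ (m : ℕ) (h : C(Fin m → unitInterval, X)) (G : C((Fin m → unitInterval) × unitInterval, Y)), (∀ a, G (a, 0) = f (h a)) →
    ∃ L : C((Fin m → unitInterval) × unitInterval, X), (∀ a, L (a, 0) = h a) ∧ ∀ q, f (L q) = G q

/-- An assignment `M ↦ F M` of a space of metrics `F M ⊆ 𝓡(M)` to each compact manifold is fibrant
if, for all `M` with `∂M ≠ ∅`, restriction to the boundary maps `F M` to `F (∂M)`, and is a Serre
fibration `F M → F (∂M)`. -/
def IsFibrant (F : ∀ M : Mfd.{u}, Set M.Form) : Prop :=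
  ∀ M : Mfd.{u}, Nonempty M.bd →
    ∃ h : MapsTo M.res (F M) (F M.boundary), IsSerreFibration h.restrict

end

noncomputable section

open scoped Topology
open Filter

universe v w

set_option maxSynthPendingDepth 3
set_option synthInstance.maxHeartbeats 200000
set_option linter.unusedSectionVars false

/-! ### Curvature conditions -/

/-! Both curvature conditions are instances of one notion, `CurvCond`: a condition on a scalar
product together with a curvature tensor that is invariant under linear isomorphisms, open in the
2-jet of the metric, and unaffected by an orthogonal product with a line. Fibrancy and the
comparison with `g + dt²` are proved for an arbitrary `CurvCond`.

Insensitivity to lines is linear algebra (`PosSec.prod_iff`, `PosRicci.prod_iff`). Curvature sums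
are invariant under rotations of the frame, so a frame of `E × F`, with `F` a line, may be assumed
to be tangent to `E` except for its last vector `(s u, α)`. Its curvature sum is then the
combination with weights `1 - s²` and `s²` of the sums over an `n`-frame and an `(n+1)`-frame of
`E`. The former is positive by hypothesis, the latter by averaging over the `n`-frames that it
contains. Conversely, a frame of `E` is extended by a unit vector of the line.

For fibrancy, let `b (q, t)` be a homotopy of boundary metrics and let `h q` lift its initial
values, with `q` in a compact space. The widths of the product collars of the `h q` need not have a
common positive lower bound, even though `q` ranges over a compact space, and this is resolved by
two deformations.

The first (`Mfd.exists_short_family`, `Mfd.exists_short_lift`) follows `b` for a short time. It adds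
the change of boundary metric, and moves the deviation of `h q` from the product metric inwards by
the distance `t`. This gives a product collar of width at least `min t (1/2)` at time `t`, for all
`q`; the curvature condition survives for small `t` because it is open.

The second (`Mfd.exists_stretch_factor`, `Mfd.exists_stretch_lift`) starts with collars of uniform
width `δ` and inserts there the linear segment from `b (q, 0)` to `b (q, t)`, as a function of the
height. If all metrics on the segment satisfy the condition, then so does the resulting metric as
soon as the transition zone is stretched by a large factor `K`, for it is then locally close to a
product with a line. As `K` may be kept at `1` at time `0`, the deformation starts at the given
metric.

By compactness, metrics `b (q, t)`, `b (q, t')` at nearby times are joined by admissible segments;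
`Mfd.exists_lift` concatenates the two deformations over a subdivision of the unit interval.
Continuity in the `C^∞`-topology is handled by `SmoothFam`, i.e. by joint continuity of all
derivatives in the parameter and the point. -/

/-- Bilinear forms. -/
abbrev Bil (E : Type*) [NormedAddCommGroup E] [NormedSpace ℝ E] := E →L[ℝ] E →L[ℝ] ℝ

/-- Trilinear maps, the algebraic type of a curvature tensor at a point. -/
abbrev Tri (E : Type*) [AddCommGroup E] [Module ℝ E] := E →ₗ[ℝ] E →ₗ[ℝ] E →ₗ[ℝ] E

/-- The 2-jet of a field of bilinear forms at a point. -/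
abbrev Jet (E : Type*) [NormedAddCommGroup E] [NormedSpace ℝ E] :=
  Bil E × (E →L[ℝ] Bil E) × (E →L[ℝ] E →L[ℝ] Bil E)

def Bil.PosDef {E : Type*} [NormedAddCommGroup E] [NormedSpace ℝ E] (B : Bil E) : Prop :=
  ∀ v, v ≠ 0 → 0 < B v v

def Bil.Symm {E : Type*} [NormedAddCommGroup E] [NormedSpace ℝ E] (B : Bil E) : Prop :=
  ∀ u v, B u v = B v u

def Orthon {E : Type*} [NormedAddCommGroup E] [NormedSpace ℝ E] (B : Bil E) {n : ℕ}
    (e : Fin n → E) : Prop :=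
  ∀ i j, B (e i) (e j) = if i = j then 1 else 0

/-! ### Curvature as a function of the 2-jet of the metric, and openness of positivity on frames. -/

section Jets

variable {E : Type*} [NormedAddCommGroup E] [NormedSpace ℝ E]

/-- The Christoffel symbols of the first kind of a metric with first derivative `D`. -/
def lowerSymbol (D : E →L[ℝ] Bil E) : E →L[ℝ] E →L[ℝ] E →L[ℝ] ℝ :=
  let D' : E →L[ℝ] E →L[ℝ] E →L[ℝ] ℝ := D.flip
  let τ : (E →L[ℝ] E →L[ℝ] ℝ) →L[ℝ] E →L[ℝ] E →L[ℝ] ℝ :=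
    (ContinuousLinearMap.flipₗᵢ ℝ E E ℝ).toContinuousLinearEquiv.toContinuousLinearMap
  (2⁻¹ : ℝ) • (D + D' - τ.comp D')

theorem christoffelLower_eq (G : E → Bil E) (S : Set E) (y : E) :
    christoffelLower G S y = lowerSymbol (fderivWithin ℝ G S y) := rfl

theorem lowerSymbol_apply (D : E →L[ℝ] Bil E) (u v w : E) :
    lowerSymbol D u v w = (D u v w + D v u w - D w u v) / 2 := by
  change (2⁻¹ : ℝ) * (D u v w + D v u w - D w u v) = _
  ring

theorem lowerSymbol_add (D D' : E →L[ℝ] Bil E) :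
    lowerSymbol (D + D') = lowerSymbol D + lowerSymbol D' := by
  ext u v w
  simp only [lowerSymbol_apply, add_apply]
  ring

theorem lowerSymbol_smul (c : ℝ) (D : E →L[ℝ] Bil E) :
    lowerSymbol (c • D) = c • lowerSymbol D := by
  ext u v w
  simp only [lowerSymbol_apply, smul_apply, smul_eq_mul]
  ring

def lowerSymbolLinear : (E →L[ℝ] Bil E) →ₗ[ℝ] (E →L[ℝ] Bil E) where
  toFun := lowerSymbol
  map_add' := lowerSymbol_add
  map_smul' := lowerSymbol_smul

theorem continuous_lowerSymbol [FiniteDimensional ℝ E] :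
    Continuous (lowerSymbol : (E →L[ℝ] Bil E) → _) :=
  (lowerSymbolLinear (E := E)).continuous_of_finiteDimensional

namespace Jet

def gamma (J : Jet E) (u v : E) : E := ContinuousLinearMap.inverse J.1 (lowerSymbol J.2.1 u v)

/-- The derivative of the Christoffel symbols in the direction `z`. -/
def dgamma (J : Jet E) (z u v : E) : E :=
  ContinuousLinearMap.inverse J.1 (lowerSymbol (J.2.2 z) u v - J.2.1 z (J.gamma u v))

/-- The curvature tensor as a function of the 2-jet of the metric. -/
def riem (J : Jet E) : Tri E :=
  LinearMap.mk₂ ℝ (fun u v ↦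
    { toFun := fun w ↦ J.dgamma u v w - J.dgamma v u w
        + J.gamma u (J.gamma v w) - J.gamma v (J.gamma u w)
      map_add' := fun a b ↦ by simp only [dgamma, gamma, map_add, map_sub]; abel
      map_smul' := fun c a ↦ by
        simp only [dgamma, gamma, map_smul, map_sub, RingHom.id_apply, smul_add, smul_sub] })
    (fun a b c ↦ by
      ext w
      simp only [dgamma, gamma, map_add, map_sub, add_apply, lowerSymbol_add, LinearMap.add_apply,
        LinearMap.coe_mk, AddHom.coe_mk]
      abel)
    (fun c a b ↦ by
      ext w
      simp only [dgamma, gamma, map_smul, map_sub, smul_apply, lowerSymbol_smul,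
        LinearMap.smul_apply, LinearMap.coe_mk, AddHom.coe_mk, smul_add, smul_sub])
    (fun a b c ↦ by
      ext w
      simp only [dgamma, gamma, map_add, map_sub, add_apply, lowerSymbol_add, LinearMap.add_apply,
        LinearMap.coe_mk, AddHom.coe_mk]
      abel)
    (fun c a b ↦ by
      ext w
      simp only [dgamma, gamma, map_smul, map_sub, smul_apply, lowerSymbol_smul,
        LinearMap.smul_apply, LinearMap.coe_mk, AddHom.coe_mk, smul_add, smul_sub])

theorem riem_apply (J : Jet E) (u v w : E) :
    J.riem u v w = J.dgamma u v w - J.dgamma v u w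
      + J.gamma u (J.gamma v w) - J.gamma v (J.gamma u w) := rfl

theorem riem_antisymm (J : Jet E) (u v w : E) : J.riem u v w = - J.riem v u w := by
  simp only [riem_apply]
  abel

end Jet

theorem Bil.PosDef.isInvertible [FiniteDimensional ℝ E] {B : Bil E} (hB : B.PosDef) :
    B.IsInvertible := by
  have hinj : Function.Injective (B : E →ₗ[ℝ] E →L[ℝ] ℝ) := by
    rw [← LinearMap.ker_eq_bot, LinearMap.ker_eq_bot']
    intro v hv
    by_contra h
    have := hB v h
    have h2 : B v = 0 := hv
    simp [h2] at this
  have hd : finrank ℝ E = finrank ℝ (E →L[ℝ] ℝ) := by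
    rw [← LinearEquiv.finrank_eq (LinearMap.toContinuousLinearMap : (E →ₗ[ℝ] ℝ) ≃ₗ[ℝ] (E →L[ℝ] ℝ))]
    exact (Subspace.dual_finrank_eq).symm
  let e := LinearEquiv.ofInjectiveOfFinrankEq (B : E →ₗ[ℝ] E →L[ℝ] ℝ) hinj hd
  exact ⟨e.toContinuousLinearEquiv, by ext; rfl⟩

theorem Bil.continuousAt_inverse [FiniteDimensional ℝ E] {B : Bil E} (hB : B.PosDef) :
    ContinuousAt (ContinuousLinearMap.inverse : Bil E → (E →L[ℝ] ℝ) →L[ℝ] E) B := by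
  have : CompleteSpace E := FiniteDimensional.complete ℝ E
  obtain ⟨e, rfl⟩ := hB.isInvertible
  exact (contDiffAt_map_inverse (n := 0) e).continuousAt

section Continuity

variable {X : Type*} [TopologicalSpace X] {J : X → Jet E} {u v w : X → E} {x : X}

theorem ContinuousAt.jet_gamma [FiniteDimensional ℝ E] (hJ : ContinuousAt J x)
    (hpos : (J x).1.PosDef) (hu : ContinuousAt u x) (hv : ContinuousAt v x) :
    ContinuousAt (fun x ↦ (J x).gamma (u x) (v x)) x := by
  have h1 : ContinuousAt (fun x ↦ ContinuousLinearMap.inverse (J x).1) x :=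
    ContinuousAt.comp (g := ContinuousLinearMap.inverse) (Bil.continuousAt_inverse hpos) hJ.fst
  have h2 : ContinuousAt (fun x ↦ lowerSymbol (J x).2.1) x :=
    continuous_lowerSymbol.continuousAt.comp hJ.snd.fst
  exact h1.clm_apply ((h2.clm_apply hu).clm_apply hv)

theorem ContinuousAt.jet_dgamma [FiniteDimensional ℝ E] (hJ : ContinuousAt J x)
    (hpos : (J x).1.PosDef) (hu : ContinuousAt u x) (hv : ContinuousAt v x)
    (hw : ContinuousAt w x) : ContinuousAt (fun x ↦ (J x).dgamma (u x) (v x) (w x)) x := by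
  have h1 : ContinuousAt (fun x ↦ ContinuousLinearMap.inverse (J x).1) x :=
    ContinuousAt.comp (g := ContinuousLinearMap.inverse) (Bil.continuousAt_inverse hpos) hJ.fst
  have h2 : ContinuousAt (fun x ↦ lowerSymbol ((J x).2.2 (u x))) x :=
    continuous_lowerSymbol.continuousAt.comp (hJ.snd.snd.clm_apply hu)
  exact h1.clm_apply (((h2.clm_apply hv).clm_apply hw).sub
    ((hJ.snd.fst.clm_apply hu).clm_apply (hJ.jet_gamma hpos hv hw)))

theorem ContinuousAt.jet_riem [FiniteDimensional ℝ E] (hJ : ContinuousAt J x)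
    (hpos : (J x).1.PosDef) (hu : ContinuousAt u x) (hv : ContinuousAt v x)
    (hw : ContinuousAt w x) : ContinuousAt (fun x ↦ (J x).riem (u x) (v x) (w x)) x :=
  (((hJ.jet_dgamma hpos hu hv hw).sub (hJ.jet_dgamma hpos hv hu hw)).add
    (hJ.jet_gamma hpos hu (hJ.jet_gamma hpos hv hw))).sub
    (hJ.jet_gamma hpos hv (hJ.jet_gamma hpos hu hw))

end Continuity

/-- By compactness of the unit sphere the form is at least `2c` on unit vectors, and a perturbation
of norm less than `c` loses at most half of this. Uniformity in `B'` confines the orthonormal frames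
of all nearby metrics to one ball. -/
theorem Bil.PosDef.exists_bound [FiniteDimensional ℝ E] {B : Bil E} (hB : B.PosDef) :
    ∃ c > 0, ∀ᶠ B' in 𝓝 B, ∀ v, c * ‖v‖ ^ 2 ≤ B' v v := by
  have : ProperSpace E := FiniteDimensional.proper ℝ E
  have hK : IsCompact (Metric.sphere (0 : E) 1) := isCompact_sphere 0 1
  have key : ∃ c > 0, ∀ v ∈ Metric.sphere (0 : E) 1, 2 * c ≤ B v v := by
    rcases (Metric.sphere (0 : E) 1).eq_empty_or_nonempty with h | h
    · exact ⟨1, one_pos, by simp [h]⟩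
    · obtain ⟨v, hv, hmin⟩ := hK.exists_isMinOn h
        (f := fun v ↦ B v v) (by fun_prop)
      have hv0 : v ≠ 0 := by
        rintro rfl
        simp at hv
      exact ⟨B v v / 2, by have := hB v hv0; positivity, fun w hw ↦ by
        have := hmin hw
        simp only [mem_ofPred_eq] at this
        linarith⟩
  obtain ⟨c, hc, hcB⟩ := key
  refine ⟨c, hc, ?_⟩
  filter_upwards [Metric.ball_mem_nhds B hc] with B' hB' v
  rcases eq_or_ne v 0 with rfl | hv
  · simp
  have hn : 0 < ‖v‖ := norm_pos_iff.2 hv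
  have h1 : 2 * c ≤ B (‖v‖⁻¹ • v) (‖v‖⁻¹ • v) := hcB _ (by simp [norm_smul, hn.ne'])
  have h2 : 2 * c * ‖v‖ ^ 2 ≤ B v v := by
    simp only [map_smul, smul_apply, smul_eq_mul] at h1
    calc 2 * c * ‖v‖ ^ 2 ≤ (‖v‖⁻¹ * (‖v‖⁻¹ * B v v)) * ‖v‖ ^ 2 := by gcongr
      _ = B v v := by field_simp
  have h3 : ‖(B' - B) v v‖ ≤ c * ‖v‖ * ‖v‖ := by
    refine ((B' - B).le_opNorm₂ v v).trans ?_
    have hB' : ‖B' - B‖ < c := by simpa [dist_eq_norm] using hB'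
    gcongr
  rw [sub_apply, sub_apply, Real.norm_eq_abs] at h3
  nlinarith [abs_le.1 h3]

theorem Bil.PosDef.eventually [FiniteDimensional ℝ E] {B : Bil E} (hB : B.PosDef) :
    ∀ᶠ B' in 𝓝 B, Bil.PosDef B' := by
  obtain ⟨c, hc, h⟩ := hB.exists_bound
  filter_upwards [h] with B' hB' v hv
  have : 0 < ‖v‖ := norm_pos_iff.2 hv
  exact lt_of_lt_of_le (by positivity) (hB' v)

/-- Openness of the positivity of a continuous function on orthonormal frames. -/
theorem eventually_pos_on_frames [FiniteDimensional ℝ E] {n : ℕ} {J₀ : Jet E}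
    (hpos : J₀.1.PosDef) (f : Jet E → (Fin n → E) → ℝ)
    (hf : ∀ e, ContinuousAt (fun q : Jet E × (Fin n → E) ↦ f q.1 q.2) (J₀, e))
    (h : ∀ e, Orthon J₀.1 e → 0 < f J₀ e) :
    ∀ᶠ J in 𝓝 J₀, ∀ e, Orthon J.1 e → 0 < f J e := by
  have : ProperSpace E := FiniteDimensional.proper ℝ E
  obtain ⟨c, hc, hbd⟩ := hpos.exists_bound
  -- A unit vector `v` of a nearby metric satisfies `c‖v‖² ≤ 1`.
  set r := Real.sqrt c⁻¹
  have hK : IsCompact (Metric.closedBall (0 : Fin n → E) r) := isCompact_closedBall 0 r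
  have key : ∀ᶠ J in 𝓝 J₀, ∀ e ∈ Metric.closedBall (0 : Fin n → E) r,
      (Orthon J.1 e → 0 < f J e) := by
    refine hK.eventually_forall_of_forall_eventually fun e _ ↦ ?_
    by_cases he : Orthon J₀.1 e
    · filter_upwards [(hf e).eventually (lt_mem_nhds (h e he))] with z hz _ using hz
    -- Orthonormality is a closed condition on jet and frame together, so near a frame that is not
    -- orthonormal the implication is vacuous.
    · have hclosed : IsClosed {q : Jet E × (Fin n → E) | Orthon q.1.1 q.2} := by
        simp only [Orthon, ofPred_forall]
        refine isClosed_iInter fun i ↦ isClosed_iInter fun j ↦ isClosed_eq ?_ continuous_const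
        exact (continuous_fst.fst.clm_apply ((continuous_apply i).comp continuous_snd)).clm_apply
          ((continuous_apply j).comp continuous_snd)
      filter_upwards [hclosed.isOpen_compl.mem_nhds (x := (J₀, e)) he] with z hz hz'
      exact absurd hz' hz
  filter_upwards [key, (continuous_fst.tendsto J₀).eventually hbd] with J hJ hJb e he
  refine hJ e ?_ he
  rw [mem_closedBall_zero_iff, pi_norm_le_iff_of_nonneg (Real.sqrt_nonneg _)]
  intro i
  refine Real.le_sqrt_of_sq_le ?_
  have h1 := hJb (e i)
  rw [he i i, if_pos rfl] at h1
  rwa [← one_div, le_div_iff₀ hc, mul_comm]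

end Jets

/-! ### Averaging over omitted vectors, and rotations of frames. -/

section Frames

/-- Each index survives `n` of the `n + 1` omissions, so the partial sums add up to `n` times the
total. -/
theorem sum_pos_of_omit {n : ℕ} (hn : 1 ≤ n) (f : Fin (n + 1) → ℝ)
    (h : ∀ j : Fin (n + 1), 0 < ∑ i, f (j.succAbove i)) : 0 < ∑ i, f i := by
  have h1 : 0 < ∑ j : Fin (n + 1), ∑ i, f (j.succAbove i) :=
    Finset.sum_pos (fun j _ ↦ h j) ⟨0, Finset.mem_univ 0⟩
  have h2 : ∀ j : Fin (n + 1), ∑ i, f (j.succAbove i) = ∑ i, f i - f j := fun j ↦ by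
    rw [Fin.sum_univ_succAbove f j]
    ring
  simp only [h2, Finset.sum_sub_distrib, Finset.sum_const, Finset.card_univ, Fintype.card_fin,
    nsmul_eq_mul] at h1
  push_cast at h1
  have hn' : (1 : ℝ) ≤ n := by exact_mod_cast hn
  nlinarith

/-- A pair of distinct indices survives `n - 1` of the `n + 1` omissions and the diagonal vanishes,
so the partial sums add up to `n - 1` times the total. This factor is positive only for `n ≥ 2`,
which is where the bound `p + 2 ≤ d` enters. -/
theorem sum_sum_pos_of_omit {n : ℕ} (hn : 2 ≤ n) (k : Fin (n + 1) → Fin (n + 1) → ℝ)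
    (hk : ∀ i, k i i = 0)
    (h : ∀ j : Fin (n + 1), 0 < ∑ a, ∑ b, k (j.succAbove a) (j.succAbove b)) :
    0 < ∑ a, ∑ b, k a b := by
  have h1 : 0 < ∑ j : Fin (n + 1), ∑ a, ∑ b, k (j.succAbove a) (j.succAbove b) :=
    Finset.sum_pos (fun j _ ↦ h j) ⟨0, Finset.mem_univ 0⟩
  have h2 : ∀ j : Fin (n + 1), ∑ a, ∑ b, k (j.succAbove a) (j.succAbove b) =
      ∑ a, ∑ b, k a b - ∑ b, k j b - ∑ a, k a j := fun j ↦ by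
    rw [Fin.sum_univ_succAbove (fun a ↦ ∑ b, k a b) j, Fin.sum_univ_succAbove (fun a ↦ k a j) j, hk]
    simp_rw [fun a ↦ Fin.sum_univ_succAbove (fun b ↦ k (j.succAbove a) b) j]
    rw [Finset.sum_add_distrib]
    ring
  simp only [h2, Finset.sum_sub_distrib, Finset.sum_const, Finset.card_univ, Fintype.card_fin,
    nsmul_eq_mul] at h1
  rw [Finset.sum_comm (f := fun j a ↦ k a j)] at h1
  push_cast at h1
  have hn' : (2 : ℝ) ≤ n := by exact_mod_cast hn
  nlinarith

/-- The normalised vector `a` is completed to an orthonormal basis in which it has the last index.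
With `a` the components of a frame along a line, the rotation concentrates the line component in the
last vector. -/
theorem exists_rotation {n : ℕ} (a : Fin (n + 1) → ℝ) :
    ∃ O : Matrix (Fin (n + 1)) (Fin (n + 1)) ℝ,
      (∀ j k, ∑ i, O i j * O i k = if j = k then 1 else 0) ∧
      (∀ i k, ∑ j, O i j * O k j = if i = k then 1 else 0) ∧
      ∀ i, i ≠ Fin.last n → ∑ j, O i j * a j = 0 := by
  obtain ⟨b, hb⟩ : ∃ b : OrthonormalBasis (Fin (n + 1)) ℝ (EuclideanSpace ℝ (Fin (n + 1))),
      ∀ i, i ≠ Fin.last n → inner ℝ (b i) (WithLp.toLp 2 a) = 0 := by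
    set α : EuclideanSpace ℝ (Fin (n + 1)) := WithLp.toLp 2 a
    rcases eq_or_ne α 0 with h | h
    · exact ⟨EuclideanSpace.basisFun _ ℝ, by simp [h]⟩
    have hα : ‖α‖ ≠ 0 := norm_ne_zero_iff.2 h
    have horth : Orthonormal ℝ (({Fin.last n} : Set (Fin (n + 1))).domRestrict
        fun _ ↦ (‖α‖⁻¹ : ℝ) • α) := by
      constructor
      · intro i
        change ‖(‖α‖⁻¹ : ℝ) • α‖ = 1
        rw [norm_smul, norm_inv, norm_norm, inv_mul_cancel₀ hα]
      · intro i j hij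
        exact absurd (Subtype.ext (i.2.trans j.2.symm)) hij
    obtain ⟨b, hb⟩ := horth.exists_orthonormalBasis_extension_of_card_eq (by simp)
    refine ⟨b, fun i hi ↦ ?_⟩
    have h1 : inner ℝ (b i) (b (Fin.last n)) = 0 := b.orthonormal.2 hi
    rw [hb _ rfl, inner_smul_right] at h1
    exact (mul_eq_zero.1 h1).resolve_left (inv_ne_zero hα)
  have hrow : ∀ i k, ∑ j, b i j * b k j = if i = k then 1 else 0 := fun i k ↦ by
    have := orthonormal_iff_ite.1 b.orthonormal i k
    rw [PiLp.inner_apply] at this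
    rw [← this]
    exact Finset.sum_congr rfl fun j _ ↦ by simp [mul_comm]
  refine ⟨Matrix.of fun i j ↦ b i j, ?_, hrow, fun i hi ↦ ?_⟩
  · have h1 : (Matrix.of fun i j ↦ b i j) * (Matrix.of fun i j ↦ b i j).transpose
        = (1 : Matrix (Fin (n + 1)) (Fin (n + 1)) ℝ) := by
      ext i k
      simp only [Matrix.mul_apply, Matrix.transpose_apply, Matrix.of_apply, Matrix.one_apply]
      exact hrow i k
    rw [mul_eq_one_comm] at h1
    intro j k
    have := congr_fun (congr_fun h1 j) k
    simpa only [Matrix.mul_apply, Matrix.transpose_apply, Matrix.of_apply, Matrix.one_apply]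
      using this
  · have := hb i hi
    rw [PiLp.inner_apply] at this
    rw [← this]
    exact Finset.sum_congr rfl fun j _ ↦ by simp [mul_comm]

theorem sum_rotate {V : Type*} [AddCommGroup V] [Module ℝ V] {n : ℕ}
    {O : Matrix (Fin n) (Fin n) ℝ} (hO : ∀ j k, ∑ i, O i j * O i k = if j = k then 1 else 0)
    (b : V →ₗ[ℝ] V →ₗ[ℝ] ℝ) (e : Fin n → V) :
    ∑ i, b (∑ j, O i j • e j) (∑ j, O i j • e j) = ∑ j, b (e j) (e j) := by
  simp only [map_sum, map_smul, LinearMap.sum_apply, LinearMap.smul_apply, smul_eq_mul]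
  calc ∑ i, ∑ k, O i k * ∑ j, O i j * b (e j) (e k)
      = ∑ k, ∑ j, (∑ i, O i j * O i k) * b (e j) (e k) := by
        simp_rw [Finset.mul_sum, Finset.sum_mul]
        rw [Finset.sum_comm]
        refine Finset.sum_congr rfl fun k _ ↦ ?_
        rw [Finset.sum_comm]
        exact Finset.sum_congr rfl fun j _ ↦ Finset.sum_congr rfl fun i _ ↦ by ring
    _ = _ := by simp [hO]

end Frames

/-! ### Curvature sums over frames of a product with a line. -/

section Sums

variable {E F : Type*} [NormedAddCommGroup E] [NormedSpace ℝ E]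
  [NormedAddCommGroup F] [NormedSpace ℝ F]

theorem Orthon.comp {B : Bil E} {n m : ℕ} {e : Fin n → E} (he : Orthon B e) {f : Fin m → Fin n}
    (hf : Function.Injective f) : Orthon B (e ∘ f) := fun i j ↦ by
  simp [he (f i) (f j), hf.eq_iff]

/-- The sum of the sectional curvatures over a frame. -/
def secSum (B : Bil E) (R : Tri E) {n : ℕ} (e : Fin n → E) : ℝ :=
  ∑ i, ∑ j, B (R (e i) (e j) (e j)) (e i)

def ricciForm (R : Tri E) (v w : E) : ℝ := LinearMap.trace ℝ E ((R.flip v).flip w)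

/-- The sum of the Ricci curvatures over a frame. -/
def ricSum (R : Tri E) {n : ℕ} (e : Fin n → E) : ℝ := ∑ i, ricciForm R (e i) (e i)

/-- The summand is a quadratic form in the `j`-th vector for a fixed `i`-th vector, and vice versa,
so `sum_rotate` is applied once for each of the two indices. -/
theorem secSum_rotate {B : Bil E} {R : Tri E} {n : ℕ} {O : Matrix (Fin n) (Fin n) ℝ}
    (hO : ∀ j k, ∑ i, O i j * O i k = if j = k then 1 else 0) (e : Fin n → E) :
    secSum B R (fun i ↦ ∑ j, O i j • e j) = secSum B R e := by
  let b (x : E) : E →ₗ[ℝ] E →ₗ[ℝ] ℝ := LinearMap.mk₂ ℝ (fun v w ↦ B (R x v w) x)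
    (by simp) (by simp) (by simp) (by simp)
  let c (x : E) : E →ₗ[ℝ] E →ₗ[ℝ] ℝ := LinearMap.mk₂ ℝ (fun v w ↦ B (R v x x) w)
    (by simp) (by simp) (by simp) (by simp)
  unfold secSum
  calc _ = ∑ i, ∑ j, B (R (∑ j, O i j • e j) (e j) (e j)) (∑ j, O i j • e j) :=
        Finset.sum_congr rfl fun i _ ↦ sum_rotate hO (b _) e
    _ = ∑ j, ∑ i, B (R (∑ j, O i j • e j) (e j) (e j)) (∑ j, O i j • e j) := Finset.sum_comm
    _ = ∑ j, ∑ i, B (R (e i) (e j) (e j)) (e i) :=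
        Finset.sum_congr rfl fun j _ ↦ sum_rotate hO (c (e j)) e
    _ = _ := Finset.sum_comm

/-- The Ricci curvature as a bilinear form. -/
def ricciBilin (R : Tri E) : E →ₗ[ℝ] E →ₗ[ℝ] ℝ :=
  LinearMap.mk₂ ℝ (ricciForm R)
    (fun a b c ↦ by
      rw [ricciForm, ricciForm, ricciForm, ← map_add]
      congr 1
      ext z
      simp)
    (fun c a b ↦ by
      rw [ricciForm, ricciForm, ← map_smul]
      congr 1
      ext z
      simp)
    (fun a b c ↦ by
      rw [ricciForm, ricciForm, ricciForm, ← map_add]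
      congr 1
      ext z
      simp)
    (fun c a b ↦ by
      rw [ricciForm, ricciForm, ← map_smul]
      congr 1
      ext z
      simp)

theorem ricSum_rotate {R : Tri E} {n : ℕ} {O : Matrix (Fin n) (Fin n) ℝ}
    (hO : ∀ j k, ∑ i, O i j * O i k = if j = k then 1 else 0) (e : Fin n → E) :
    ricSum R (fun i ↦ ∑ j, O i j • e j) = ricSum R e :=
  sum_rotate hO (ricciBilin R) e

theorem ricciForm_smul (R : Tri E) (c : ℝ) (v : E) :
    ricciForm R (c • v) (c • v) = c ^ 2 * ricciForm R v v := by
  change ricciBilin R (c • v) (c • v) = c ^ 2 * ricciBilin R v v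
  simp only [map_smul, LinearMap.smul_apply, smul_eq_mul]
  ring

theorem Bil.PosDef.exists_unit [FiniteDimensional ℝ E] {B : Bil E} (hB : B.PosDef) (h : 0 < finrank ℝ E) :
    ∃ v, B v v = 1 := by
  obtain ⟨v, hv⟩ := finrank_pos_iff_exists_ne_zero.1 h
  have := hB v hv
  refine ⟨(Real.sqrt (B v v))⁻¹ • v, ?_⟩
  simp only [map_smul, smul_apply, smul_eq_mul]
  rw [← mul_assoc, ← mul_inv, Real.mul_self_sqrt this.le, inv_mul_cancel₀ this.ne']

/-- An orthonormal frame of a product with a line can be rotated so that all vectors but the last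
are tangent to the first factor. -/
theorem exists_rotated_frame [FiniteDimensional ℝ F] {B : Bil E} {β : Bil F} {Bp : Bil (E × F)} (hB : B.PosDef)
    (hF : finrank ℝ F = 1) (hβ : β.PosDef)
    (hBp : ∀ p q, Bp p q = B p.1 q.1 + β p.2 q.2) {n : ℕ} {e : Fin (n + 1) → E × F}
    (he : Orthon Bp e) :
    ∃ O : Matrix (Fin (n + 1)) (Fin (n + 1)) ℝ,
      (∀ j k, ∑ i, O i j * O i k = if j = k then 1 else 0) ∧
      ∃ (v : Fin n → E) (u : E) (α : F) (s : ℝ),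
        (∀ i : Fin n, ∑ j, O i.castSucc j • e j = (v i, 0)) ∧
        ∑ j, O (Fin.last n) j • e j = (s • u, α) ∧ 0 ≤ s ∧ s ≤ 1 ∧
        Orthon B v ∧ (s ≠ 0 → Orthon B (Fin.snoc v u : Fin (n + 1) → E)) := by
  obtain ⟨ν, hν⟩ := hβ.exists_unit (by omega)
  have hν0 : ν ≠ 0 := by
    rintro rfl
    simp at hν
  have hspan : ∀ w : F, ∃ a : ℝ, a • ν = w := (finrank_eq_one_iff_of_nonzero' ν hν0).1 hF
  choose a ha using fun i ↦ hspan (e i).2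
  obtain ⟨O, hO, hO', hOa⟩ := exists_rotation a
  set f : Fin (n + 1) → E × F := fun i ↦ ∑ j, O i j • e j with hf
  have hfo : Orthon Bp f := fun i k ↦ by
    rw [← hO' i k]
    simp only [hf, map_sum, map_smul, sum_apply, smul_apply, smul_eq_mul]
    refine Finset.sum_congr rfl fun j _ ↦ ?_
    have : ∀ m, Bp (e m) (e j) = if m = j then 1 else 0 := fun m ↦ he m j
    simp [this, mul_comm]
  have hf2 : ∀ i : Fin n, (f i.castSucc).2 = 0 := fun i ↦ by
    simp only [hf, Prod.snd_sum, Prod.smul_snd, ← ha, smul_smul, ← Finset.sum_smul]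
    rw [hOa _ (Fin.castSucc_lt_last i).ne, zero_smul]
  have hv : ∀ i : Fin n, f i.castSucc = ((f i.castSucc).1, 0) := fun i ↦ by rw [← hf2 i]
  have hvo : Orthon B (fun i : Fin n ↦ (f i.castSucc).1) := fun i j ↦ by
    have := hfo i.castSucc j.castSucc
    rw [hBp, hf2] at this
    simpa using this
  set u₀ := (f (Fin.last n)).1
  have hlast : B u₀ u₀ + β (f (Fin.last n)).2 (f (Fin.last n)).2 = 1 := by
    have := hfo (Fin.last n) (Fin.last n)
    rwa [hBp, if_pos rfl] at this
  have hcross : ∀ i : Fin n, B (f i.castSucc).1 u₀ = 0 ∧ B u₀ (f i.castSucc).1 = 0 := fun i ↦ by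
    have h1 := hfo i.castSucc (Fin.last n)
    have h2 := hfo (Fin.last n) i.castSucc
    rw [hBp, hf2, if_neg (Fin.castSucc_lt_last i).ne] at h1
    rw [hBp, hf2, if_neg (Fin.castSucc_lt_last i).ne'] at h2
    simp only [map_zero, zero_apply, add_zero] at h1 h2
    exact ⟨h1, h2⟩
  have hβ0 : 0 ≤ β (f (Fin.last n)).2 (f (Fin.last n)).2 := by
    rcases eq_or_ne (f (Fin.last n)).2 0 with h | h
    · simp [h]
    · exact (hβ _ h).le
  -- If the last vector is vertical, `u` and `s` are set to zero; hence the extended frame is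
  -- claimed to be orthonormal only for `s ≠ 0`.
  rcases eq_or_ne u₀ 0 with h0 | h0
  · refine ⟨O, hO, fun i ↦ (f i.castSucc).1, 0, (f (Fin.last n)).2, 0, hv, ?_, le_rfl,
      zero_le_one, hvo, fun h ↦ absurd rfl h⟩
    change f (Fin.last n) = _
    rw [zero_smul, ← h0]
  have hpos := hB u₀ h0
  -- The length of the horizontal part of a unit vector, hence at most `1`.
  set s := Real.sqrt (B u₀ u₀)
  have hs : 0 < s := Real.sqrt_pos.2 hpos
  have hss : s * s = B u₀ u₀ := Real.mul_self_sqrt hpos.le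
  refine ⟨O, hO, fun i ↦ (f i.castSucc).1, s⁻¹ • u₀, (f (Fin.last n)).2, s, hv, ?_, hs.le,
    Real.sqrt_le_one.2 (by linarith), hvo, fun _ i j ↦ ?_⟩
  · rw [smul_inv_smul₀ hs.ne']
  · refine Fin.lastCases ?_ (fun i ↦ ?_) i <;> refine Fin.lastCases ?_ (fun j ↦ ?_) j
    · simp only [Fin.snoc_last, map_smul, smul_apply, smul_eq_mul, ← hss, if_true]
      field_simp
    · simp [(hcross j).2, (Fin.castSucc_lt_last j).ne']
    · simp [(hcross i).1, (Fin.castSucc_lt_last i).ne]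
    · simpa using hvo i j

/-- Extension of an orthonormal frame of the first factor of a product with a line by a unit vector
of the line. -/
theorem Orthon.snoc_prod {B : Bil E} {β : Bil F} {Bp : Bil (E × F)}
    (hBp : ∀ p q, Bp p q = B p.1 q.1 + β p.2 q.2) {n : ℕ} {e : Fin n → E} (he : Orthon B e)
    {ν : F} (hν : β ν ν = 1) :
    Orthon Bp (Fin.snoc (fun i ↦ (e i, 0)) (0, ν) : Fin (n + 1) → E × F) := fun i j ↦ by
  refine Fin.lastCases ?_ (fun i ↦ ?_) i <;> refine Fin.lastCases ?_ (fun j ↦ ?_) j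
  · simp [hBp, hν]
  · simp [hBp, (Fin.castSucc_lt_last j).ne']
  · simp [hBp, (Fin.castSucc_lt_last i).ne]
  · simpa [hBp] using he i j

theorem ricciForm_prod [FiniteDimensional ℝ E] [FiniteDimensional ℝ F]
    {R : Tri E} {Rp : Tri (E × F)} (hR : ∀ p q r, Rp p q r = (R p.1 q.1 r.1, 0)) (v w : E × F) :
    ricciForm Rp v w = ricciForm R v.1 w.1 := by
  have : (Rp.flip v).flip w = LinearMap.prodMap ((R.flip v.1).flip w.1) (0 : F →ₗ[ℝ] F) := by
    ext z <;> simp [hR]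
  rw [ricciForm, this, LinearMap.trace_prodMap']
  simp [ricciForm]

/-- The curvature does not see `α`, and the cross terms `X` between `s u` and the `v i` are
quadratic in `s`. With `S` the sum over `v`, the total is `S + s² X = (1 - s²) S + s² (S + X)`. -/
theorem secSum_rotated {B : Bil E} {β : Bil F} {Bp : Bil (E × F)}
    (hBp : ∀ p q, Bp p q = B p.1 q.1 + β p.2 q.2)
    {R : Tri E} {Rp : Tri (E × F)} (hR : ∀ p q r, Rp p q r = (R p.1 q.1 r.1, 0))
    (hanti : ∀ u v w, R u v w = - R v u w) {n : ℕ} (v : Fin n → E) (u : E) (α : F) (s : ℝ) :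
    secSum Bp Rp (Fin.snoc (fun i ↦ (v i, 0)) (s • u, α) : Fin (n + 1) → E × F) =
      (1 - s ^ 2) * secSum B R v + s ^ 2 * secSum B R (Fin.snoc v u : Fin (n + 1) → E) := by
  have h0 : ∀ x w, R x x w = 0 := fun x w ↦ by
    have := hanti x x w
    have h2 : (2 : ℝ) • R x x w = 0 := by
      rw [two_smul]
      nth_rewrite 1 [this]
      exact neg_add_cancel _
    exact (smul_eq_zero.1 h2).resolve_left two_ne_zero
  simp only [secSum, Fin.sum_univ_castSucc, Fin.snoc_castSucc, Fin.snoc_last, hBp, hR, map_smul,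
    LinearMap.smul_apply, smul_apply, smul_eq_mul, h0, map_zero, zero_apply, add_zero,
    Finset.sum_add_distrib, mul_zero, ← Finset.mul_sum]
  ring

end Sums

/-! ### Abstract curvature conditions and their two instances. -/

/-- An open, linearly invariant condition on pairs of a scalar product and a curvature tensor that
is insensitive to products with a line. -/
structure CurvCond where
  Holds : ∀ (E : Type) [NormedAddCommGroup E] [NormedSpace ℝ E], Bil E → Tri E → Prop
  congr : ∀ {E E' : Type} [NormedAddCommGroup E] [NormedSpace ℝ E] [NormedAddCommGroup E']
    [NormedSpace ℝ E'] (A : E ≃ₗ[ℝ] E') {B : Bil E} {B' : Bil E'} {R : Tri E} {R' : Tri E'},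
    (∀ u v, B u v = B' (A u) (A v)) → (∀ u v w, A (R u v w) = R' (A u) (A v) (A w)) →
    Holds E B R → Holds E' B' R'
  prod : ∀ {E F : Type} [NormedAddCommGroup E] [NormedSpace ℝ E] [FiniteDimensional ℝ E]
    [NormedAddCommGroup F] [NormedSpace ℝ F] [FiniteDimensional ℝ F] {B : Bil E} {β : Bil F}
    {Bp : Bil (E × F)} {R : Tri E} {Rp : Tri (E × F)}, B.PosDef → β.PosDef → finrank ℝ F = 1 →
    (∀ p q, Bp p q = B p.1 q.1 + β p.2 q.2) → (∀ p q r, Rp p q r = (R p.1 q.1 r.1, 0)) →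
    (∀ u v w, R u v w = - R v u w) → (Holds E B R ↔ Holds (E × F) Bp Rp)
  eventually : ∀ {E : Type} [NormedAddCommGroup E] [NormedSpace ℝ E] [FiniteDimensional ℝ E]
    {J₀ : Jet E}, J₀.1.PosDef → Holds E J₀.1 J₀.riem → ∀ᶠ J in 𝓝 J₀, Holds E J.1 J.riem

section Instances

variable {E F : Type} [NormedAddCommGroup E] [NormedSpace ℝ E]
  [NormedAddCommGroup F] [NormedSpace ℝ F]

theorem Orthon.congr {B : Bil E} {B' : Bil F} (A : E ≃ₗ[ℝ] F)
    (hB : ∀ u v, B u v = B' (A u) (A v)) {n : ℕ} {e : Fin n → F} (he : Orthon B' e) :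
    Orthon B (A.symm ∘ e) := fun i j ↦ by
  simp [hB, he i j]

/-- Positivity of the sum of the sectional curvatures over all frames of codimension `p`. -/
def PosSec (p : ℕ) (B : Bil E) (R : Tri E) : Prop :=
  p + 2 ≤ finrank ℝ E ∧ ∀ n, n + p = finrank ℝ E → ∀ e : Fin n → E, Orthon B e → 0 < secSum B R e

/-- Positivity of the sum of the Ricci curvatures over all frames of codimension `k`. -/
def PosRicci (k : ℕ) (B : Bil E) (R : Tri E) : Prop :=
  max 2 (k + 1) ≤ finrank ℝ E ∧
    ∀ n, n + k = finrank ℝ E → ∀ e : Fin n → E, Orthon B e → 0 < ricSum R e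

theorem apply_self_eq_zero {R : Tri E} (hanti : ∀ u v w, R u v w = - R v u w) (u w : E) :
    R u u w = 0 := by
  have := hanti u u w
  have h2 : (2 : ℝ) • R u u w = 0 := by
    rw [two_smul]
    nth_rewrite 1 [this]
    exact neg_add_cancel _
  exact (smul_eq_zero.1 h2).resolve_left two_ne_zero

theorem exists_frame_one [FiniteDimensional ℝ E] {B : Bil E} (hB : B.PosDef)
    (h : 0 < finrank ℝ E) : ∃ e : Fin 1 → E, Orthon B e := by
  obtain ⟨v, hv⟩ := hB.exists_unit h
  exact ⟨fun _ ↦ v, fun i j ↦ by rw [if_pos (Subsingleton.elim i j), hv]⟩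

theorem PosSec.prod_iff [FiniteDimensional ℝ E] [FiniteDimensional ℝ F] {p : ℕ} {B : Bil E}
    {β : Bil F} {Bp : Bil (E × F)} {R : Tri E} {Rp : Tri (E × F)} (hB : B.PosDef) (hβ : β.PosDef)
    (hF : finrank ℝ F = 1) (hBp : ∀ p q, Bp p q = B p.1 q.1 + β p.2 q.2)
    (hR : ∀ p q r, Rp p q r = (R p.1 q.1 r.1, 0)) (hanti : ∀ u v w, R u v w = - R v u w) :
    PosSec p B R ↔ PosSec p Bp Rp := by
  have hfr : finrank ℝ (E × F) = finrank ℝ E + 1 := by rw [finrank_prod, hF]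
  have h0 := apply_self_eq_zero hanti
  constructor
  · rintro ⟨hd, h⟩
    refine ⟨by omega, fun m hm e he ↦ ?_⟩
    obtain ⟨n, rfl⟩ : ∃ n, m = n + 1 := ⟨finrank ℝ E - p, by omega⟩
    have hn : n + p = finrank ℝ E := by omega
    obtain ⟨O, hO, v, u, α, s, hv, hu, hs0, hs1, hvo, huo⟩ := exists_rotated_frame hB hF hβ hBp he
    have hf : (fun i ↦ ∑ j, O i j • e j) = Fin.snoc (fun i ↦ (v i, 0)) (s • u, α) := by
      funext i
      refine Fin.lastCases ?_ (fun i ↦ ?_) i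
      · rw [hu, Fin.snoc_last]
      · rw [hv, Fin.snoc_castSucc]
    rw [← secSum_rotate hO, hf, secSum_rotated hBp hR hanti]
    have h1 := h n hn v hvo
    rcases eq_or_ne s 0 with rfl | hs
    · simpa using h1
    have h2 : 0 < secSum B R (Fin.snoc v u : Fin (n + 1) → E) :=
      sum_sum_pos_of_omit (by omega) _ (fun i ↦ by simp [h0]) fun j ↦
        h n hn _ ((huo hs).comp (Fin.succAbove_right_injective (p := j)))
    have hs' : 0 < s ^ 2 := by positivity
    have hs1' : s ^ 2 ≤ 1 := by nlinarith
    nlinarith [mul_pos hs' h2, mul_nonneg (sub_nonneg.2 hs1') h1.le]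
  · rintro ⟨hd, h⟩
    obtain ⟨ν, hν⟩ := hβ.exists_unit (by omega)
    have key : ∀ n, n + p = finrank ℝ E → ∀ e : Fin n → E, Orthon B e → 0 < secSum B R e := by
      intro n hn e he
      have h1 := h (n + 1) (by omega) _ (he.snoc_prod hBp hν)
      have h2 := secSum_rotated hBp hR hanti e 0 ν 0
      rw [zero_smul] at h2
      rw [h2] at h1
      simpa using h1
    refine ⟨?_, key⟩
    -- The dimension of `E` would be `p + 1`; frames then have one vector, and their sum is zero
    -- because `R u u = 0`.
    by_contra hlt
    obtain ⟨e, he⟩ := exists_frame_one hB (by omega)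
    have := key 1 (by omega) e he
    simp [secSum, h0] at this

theorem PosRicci.prod_iff [FiniteDimensional ℝ E] [FiniteDimensional ℝ F] {k : ℕ} {B : Bil E}
    {β : Bil F} {Bp : Bil (E × F)} {R : Tri E} {Rp : Tri (E × F)} (hB : B.PosDef) (hβ : β.PosDef)
    (hF : finrank ℝ F = 1) (hBp : ∀ p q, Bp p q = B p.1 q.1 + β p.2 q.2)
    (hR : ∀ p q r, Rp p q r = (R p.1 q.1 r.1, 0)) (hanti : ∀ u v w, R u v w = - R v u w) :
    PosRicci k B R ↔ PosRicci k Bp Rp := by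
  have hfr : finrank ℝ (E × F) = finrank ℝ E + 1 := by rw [finrank_prod, hF]
  have h0 := apply_self_eq_zero hanti
  have hsum : ∀ {n : ℕ} (v : Fin n → E) (u : E) (α : F),
      ricSum Rp (Fin.snoc (fun i ↦ (v i, 0)) (u, α) : Fin (n + 1) → E × F)
        = ricSum R v + ricciForm R u u := fun v u α ↦ by
    simp [ricSum, Fin.sum_univ_castSucc, ricciForm_prod hR]
  constructor
  · rintro ⟨hd, h⟩
    refine ⟨by omega, fun m hm e he ↦ ?_⟩
    obtain ⟨n, rfl⟩ : ∃ n, m = n + 1 := ⟨finrank ℝ E - k, by omega⟩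
    have hn : n + k = finrank ℝ E := by omega
    obtain ⟨O, hO, v, u, α, s, hv, hu, hs0, hs1, hvo, huo⟩ := exists_rotated_frame hB hF hβ hBp he
    have hf : (fun i ↦ ∑ j, O i j • e j) = Fin.snoc (fun i ↦ (v i, 0)) (s • u, α) := by
      funext i
      refine Fin.lastCases ?_ (fun i ↦ ?_) i
      · rw [hu, Fin.snoc_last]
      · rw [hv, Fin.snoc_castSucc]
    rw [← ricSum_rotate hO, hf, hsum, ricciForm_smul]
    have h1 := h n hn v hvo
    rcases eq_or_ne s 0 with rfl | hs
    · simpa using h1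
    have h2 : 0 < ricSum R (Fin.snoc v u : Fin (n + 1) → E) :=
      sum_pos_of_omit (by omega) _ fun j ↦
        h n hn _ ((huo hs).comp (Fin.succAbove_right_injective (p := j)))
    have h3 : ricSum R (Fin.snoc v u : Fin (n + 1) → E) = ricSum R v + ricciForm R u u := by
      simp [ricSum, Fin.sum_univ_castSucc]
    have hs' : 0 < s ^ 2 := by positivity
    have hs1' : s ^ 2 ≤ 1 := by nlinarith
    nlinarith [mul_pos hs' h2, mul_nonneg (sub_nonneg.2 hs1') h1.le]
  · rintro ⟨hd, h⟩
    obtain ⟨ν, hν⟩ := hβ.exists_unit (by omega)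
    have key : ∀ n, n + k = finrank ℝ E → ∀ e : Fin n → E, Orthon B e → 0 < ricSum R e := by
      intro n hn e he
      have h1 := h (n + 1) (by omega) _ (he.snoc_prod hBp hν)
      have hz : ricciForm R 0 0 = 0 := by simpa using ricciForm_smul R 0 0
      rwa [hsum, hz, add_zero] at h1
    have hk : k + 1 ≤ finrank ℝ E := by
      -- The dimension of `E` would be `k`, and the empty frame has sum zero.
      by_contra hlt
      have := key 0 (by omega) Fin.elim0 (fun i ↦ i.elim0)
      simp [ricSum] at this
    refine ⟨max_le ?_ hk, key⟩
    -- The remaining case is dimension one and `k = 0`; the Ricci form of a line vanishes.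
    by_contra hlt
    have hE : finrank ℝ E = 1 := by omega
    obtain ⟨e, he⟩ := exists_frame_one hB (by omega)
    have := key 1 (by omega) e he
    have he0 : e 0 ≠ 0 := fun h ↦ by
      have := he 0 0
      simp [h] at this
    have hz : (R.flip (e 0)).flip (e 0) = 0 := by
      ext z
      obtain ⟨c, rfl⟩ := (finrank_eq_one_iff_of_nonzero' (e 0) he0).1 hE z
      simp [h0]
    simp [ricSum, ricciForm, hz] at this

theorem trace_eq_sum_repr [FiniteDimensional ℝ E] (A : E →ₗ[ℝ] E) :
    LinearMap.trace ℝ E A = ∑ i, (finBasis ℝ E).repr (A (finBasis ℝ E i)) i := by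
  rw [LinearMap.trace_eq_matrix_trace ℝ (finBasis ℝ E)]
  simp [Matrix.trace, LinearMap.toMatrix_apply]

theorem continuous_frame_apply {n : ℕ} (i : Fin n) :
    Continuous fun q : Jet E × (Fin n → E) ↦ q.2 i :=
  (continuous_apply i).comp continuous_snd

end Instances

/-- Positive `p`-curvature as a condition on curvature tensors. -/
def CurvCond.posSec (p : ℕ) : CurvCond where
  Holds E _ _ B R := PosSec p B R
  congr A B B' R R' hB hR h := by
    refine ⟨A.finrank_eq ▸ h.1, fun n hn e he ↦ ?_⟩
    have := h.2 n (A.finrank_eq ▸ hn) _ (he.congr A hB)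
    simpa [secSum, hB, hR] using this
  prod hB hβ hF hBp hR hanti := PosSec.prod_iff hB hβ hF hBp hR hanti
  eventually {E} _ _ _ J₀ hpos h := by
    have := eventually_pos_on_frames (n := finrank ℝ E - p) hpos (fun J e ↦ secSum J.1 J.riem e)
      (fun e ↦ by
        refine tendsto_finsetSum _ fun i _ ↦ tendsto_finsetSum _ fun j _ ↦ ?_
        have hc (i) := (continuous_frame_apply (E := E) (n := finrank ℝ E - p) i).continuousAt
          (x := (J₀, e))
        exact (continuousAt_fst.fst.clm_apply
          (ContinuousAt.jet_riem continuousAt_fst hpos (hc i) (hc j) (hc j))).clm_apply (hc i))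
      (fun e he ↦ h.2 _ (by have := h.1; omega) e he)
    filter_upwards [this] with J hJ
    refine ⟨h.1, fun n hn e he ↦ ?_⟩
    obtain rfl : n = finrank ℝ E - p := by omega
    exact hJ e he

/-- Positivity of the Ricci curvature on frames of codimension `k`, as a condition on curvature
tensors. -/
def CurvCond.posRicci (k : ℕ) : CurvCond where
  Holds E _ _ B R := PosRicci k B R
  congr {E E'} _ _ _ _ A B B' R R' hB hR h := by
    refine ⟨A.finrank_eq ▸ h.1, fun n hn e he ↦ ?_⟩
    have := h.2 n (A.finrank_eq ▸ hn) _ (he.congr A hB)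
    refine this.trans_eq (Finset.sum_congr rfl fun i _ ↦ ?_)
    rw [ricciForm, ricciForm, ← LinearMap.trace_conj' _ A]
    congr 1
    ext z
    simp [LinearEquiv.conj_apply, hR]
  prod hB hβ hF hBp hR hanti := PosRicci.prod_iff hB hβ hF hBp hR hanti
  eventually {E} _ _ _ J₀ hpos h := by
    have := eventually_pos_on_frames (n := finrank ℝ E - k) hpos (fun J e ↦ ricSum J.riem e)
      (fun e ↦ by
        have hc (i) := (continuous_frame_apply (E := E) (n := finrank ℝ E - k) i).continuousAt
          (x := (J₀, e))
        simp only [ricSum, ricciForm, trace_eq_sum_repr]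
        refine tendsto_finsetSum _ fun i _ ↦ tendsto_finsetSum _ fun j _ ↦ ?_
        have hlin : Continuous ((finBasis ℝ E).coord j) :=
          LinearMap.continuous_of_finiteDimensional _
        exact hlin.continuousAt.comp (f := fun q : Jet E × (Fin (finrank ℝ E - k) → E) ↦
          q.1.riem (finBasis ℝ E j) (q.2 i) (q.2 i))
          (ContinuousAt.jet_riem continuousAt_fst hpos continuousAt_const (hc i) (hc i)))
      (fun e he ↦ h.2 _ (by have := h.1; omega) e he)
    filter_upwards [this] with J hJ
    refine ⟨h.1, fun n hn e he ↦ ?_⟩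
    obtain rfl : n = finrank ℝ E - k := by omega
    exact hJ e he

/-! ### Curvature in coordinates and its behaviour under changes of coordinates. -/

section Coord

variable {E E' : Type*} [NormedAddCommGroup E] [NormedSpace ℝ E]
  [NormedAddCommGroup E'] [NormedSpace ℝ E']

def jetAt (G : E → Bil E) (S : Set E) (y : E) : Jet E :=
  (G y, fderivWithin ℝ G S y, fderivWithin ℝ (fderivWithin ℝ G S) S y)

theorem fderivWithin_apply₂ {V W X : Type*} [NormedAddCommGroup V] [NormedSpace ℝ V]
    [NormedAddCommGroup W] [NormedSpace ℝ W] [NormedAddCommGroup X] [NormedSpace ℝ X]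
    {F : E → V →L[ℝ] W →L[ℝ] X} {S : Set E} {y : E} (hS : UniqueDiffWithinAt ℝ S y)
    (hF : DifferentiableWithinAt ℝ F S y) (a : E) (u : V) (v : W) :
    fderivWithin ℝ F S y a u v = fderivWithin ℝ (fun y ↦ F y u v) S y a := by
  have h := ((hF.hasFDerivWithinAt.clm_apply (hasFDerivWithinAt_const u y S)).clm_apply
    (hasFDerivWithinAt_const v y S)).fderivWithin hS
  rw [h]
  simp

theorem two_le_infty : minSmoothness ℝ 2 ≤ (∞ : WithTop ℕ∞) := by
  rw [minSmoothness_of_isRCLikeNormedField]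
  change ((2 : ℕ∞) : WithTop ℕ∞) ≤ ((⊤ : ℕ∞) : WithTop ℕ∞)
  exact WithTop.coe_le_coe.2 le_top

theorem ContDiffOn.contDiffOn_fderivWithin {F : E → E'} {S : Set E} (hF : ContDiffOn ℝ ∞ F S)
    (hS : UniqueDiffOn ℝ S) : ContDiffOn ℝ ∞ (fderivWithin ℝ F S) S :=
  hF.fderivWithin hS (by simp)

theorem ContDiffOn.differentiableOn_infty {F : E → E'} {S : Set E} (hF : ContDiffOn ℝ ∞ F S) :
    DifferentiableOn ℝ F S :=
  hF.differentiableOn (by simp)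

variable [FiniteDimensional ℝ E]

theorem Bil.apply_inverse {B : Bil E} (hB : B.PosDef) (α : E →L[ℝ] ℝ) :
    B (ContinuousLinearMap.inverse B α) = α := by
  obtain ⟨e, rfl⟩ := hB.isInvertible
  simp

omit [FiniteDimensional ℝ E] in
theorem Bil.PosDef.ext {B : Bil E} (hB : B.PosDef) {u v : E} (h : ∀ w, B u w = B v w) : u = v := by
  by_contra hne
  have h1 := hB (u - v) (sub_ne_zero.2 hne)
  have h2 : B (u - v) (u - v) = 0 := by rw [map_sub B, sub_apply, h, sub_self]
  rw [h2] at h1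
  exact lt_irrefl _ h1

theorem apply_christoffel {G : E → Bil E} {S : Set E} {y : E} (hB : (G y).PosDef) (u v w : E) :
    G y (christoffel G S y u v) w = lowerSymbol (fderivWithin ℝ G S y) u v w := by
  rw [christoffel_apply, Bil.apply_inverse hB]
  rfl

theorem contDiffOn_christoffel {G : E → Bil E} {S : Set E} (hS : UniqueDiffOn ℝ S)
    (hG : ContDiffOn ℝ ∞ G S) (hB : ∀ y ∈ S, (G y).PosDef) :
    ContDiffOn ℝ ∞ (christoffel G S) S := by
  have : CompleteSpace E := FiniteDimensional.complete ℝ E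
  have h1 : ContDiffOn ℝ ∞ (fun y ↦ ContinuousLinearMap.inverse (G y)) S := fun y hy ↦ by
    obtain ⟨e, he⟩ := (hB y hy).isInvertible
    exact ContDiffAt.comp_contDiffWithinAt (g := ContinuousLinearMap.inverse) y
      (he ▸ contDiffAt_map_inverse e) (hG y hy)
  have h2 : ContDiffOn ℝ ∞ (fun y ↦ lowerSymbol (fderivWithin ℝ G S y)) S :=
    (LinearMap.toContinuousLinearMap (lowerSymbolLinear (E := E))).contDiff.comp_contDiffOn
      (hG.contDiffOn_fderivWithin hS)
  exact ((ContinuousLinearMap.compL ℝ E (E →L[ℝ] ℝ) E).contDiff.comp_contDiffOn h1).clm_comp h2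

/-- Differentiating `G (Γ (b, c), d) = Γ₁ (b, c, d)` in the direction `a` gives an equation for the
derivative of `Γ` whose solution is `Jet.dgamma`. Thus curvature depends on the metric only through
its 2-jet, continuously where that is positive definite. -/
theorem coordRiemann_eq_riem {G : E → Bil E} {S : Set E} (hS : UniqueDiffOn ℝ S)
    (hG : ContDiffOn ℝ ∞ G S) (hB : ∀ y ∈ S, (G y).PosDef) {y : E} (hy : y ∈ S) (u v w : E) :
    coordRiemann G S y u v w = (jetAt G S y).riem u v w := by
  have hΓ := (contDiffOn_christoffel hS hG hB).differentiableOn_infty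
  have key : ∀ a b c, fderivWithin ℝ (christoffel G S) S y a b c = (jetAt G S y).dgamma a b c := by
    intro a b c
    refine (hB y hy).ext fun d ↦ ?_
    have h1 : ∀ z ∈ S, G z (christoffel G S z b c) d =
        lowerSymbol (fderivWithin ℝ G S z) b c d := fun z hz ↦ apply_christoffel (hB z hz) b c d
    have hγ : HasFDerivWithinAt (fun z ↦ christoffel G S z b c)
        (((fderivWithin ℝ (christoffel G S) S y).flip b).flip c) S y := by
      have := ((hΓ y hy).hasFDerivWithinAt.clm_apply (hasFDerivWithinAt_const b y S)).clm_apply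
        (hasFDerivWithinAt_const c y S)
      convert this using 1
      ext z
      simp
    have hleft := ((hG.differentiableOn_infty y hy).hasFDerivWithinAt.clm_apply hγ).clm_apply
        (hasFDerivWithinAt_const d y S)
    have hD := ((hG.contDiffOn_fderivWithin hS).differentiableOn_infty y hy).hasFDerivWithinAt
    have hl := (LinearMap.toContinuousLinearMap (lowerSymbolLinear (E := E))).hasFDerivAt
      (x := fderivWithin ℝ G S y)
    have hright := (((hl.comp_hasFDerivWithinAt y hD).clm_apply
      (hasFDerivWithinAt_const b y S)).clm_apply (hasFDerivWithinAt_const c y S)).clm_apply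
      (hasFDerivWithinAt_const d y S)
    have h2 := (hS y hy).eq hleft (hright.congr (fun z hz ↦ h1 z hz) (h1 y hy))
    have h3 := congr($h2 a)
    simp only [add_apply, ContinuousLinearMap.comp_apply, ContinuousLinearMap.flip_apply,
      map_zero, zero_add, zero_apply] at h3
    change _ = lowerSymbol (fderivWithin ℝ (fderivWithin ℝ G S) S y a) b c d at h3
    have h4 : G y ((jetAt G S y).dgamma a b c) d =
        (lowerSymbol (fderivWithin ℝ (fderivWithin ℝ G S) S y a) b c
          - fderivWithin ℝ G S y a (christoffel G S y b c)) d :=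
      congr($(Bil.apply_inverse (hB y hy) _) d)
    rw [h4, sub_apply]
    exact eq_sub_of_add_eq h3
  rw [Jet.riem_apply, ← key, ← key]
  rfl

/-- The expression is antisymmetric in `u, v`, and these are proportional. -/
theorem coordRiemann_eq_zero_of_finrank {G : E → Bil E} {S : Set E} (hd : finrank ℝ E = 1)
    (y u v w : E) : coordRiemann G S y u v w = 0 := by
  obtain ⟨e, he⟩ := finrank_eq_one_iff'.1 hd
  obtain ⟨a, rfl⟩ := he.2 u
  obtain ⟨b, rfl⟩ := he.2 v
  simp only [coordRiemann, map_smul, smul_apply, smul_comm a b]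
  abel

omit [FiniteDimensional ℝ E] in
theorem christoffel_congr_set {G : E → Bil E} {S T : Set E} {y : E} (h : S =ᶠ[𝓝 y] T) :
    christoffel G S y = christoffel G T y := by
  rw [christoffel, christoffel, christoffelLower_eq, christoffelLower_eq, fderivWithin_congr_set h]

omit [FiniteDimensional ℝ E] in
theorem coordRiemann_congr_set {G : E → Bil E} {S T : Set E} {y : E} (h : S =ᶠ[𝓝 y] T) : coordRiemann G S y = coordRiemann G T y := by
  have h1 : christoffel G S =ᶠ[𝓝 y] christoffel G T :=
    h.eventuallyEq_nhds.mono fun z hz ↦ christoffel_congr_set hz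
  have h2 : fderivWithin ℝ (christoffel G S) S y = fderivWithin ℝ (christoffel G T) T y := by
    rw [(h1.filter_mono nhdsWithin_le_nhds).fderivWithin_eq h1.eq_of_nhds, fderivWithin_congr_set h]
  ext u v w
  simp only [coordRiemann, h2, h1.eq_of_nhds]

omit [FiniteDimensional ℝ E] in
theorem jetAt_congr_set {G : E → Bil E} {S T : Set E} {y : E} (h : S =ᶠ[𝓝 y] T) :
    jetAt G S y = jetAt G T y := by
  have h1 : fderivWithin ℝ G S =ᶠ[𝓝 y] fderivWithin ℝ G T :=
    h.eventuallyEq_nhds.mono fun z hz ↦ fderivWithin_congr_set hz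
  rw [jetAt, jetAt, h1.eq_of_nhds, (h1.filter_mono nhdsWithin_le_nhds).fderivWithin_eq
    h1.eq_of_nhds, fderivWithin_congr_set h]

/-- The data of a change of coordinates `φ` between fields of scalar products. -/
structure IsCoordPullback (φ : E → E') (G : E → Bil E) (S : Set E) (G' : E' → Bil E')
    (S' : Set E') : Prop where
  uniqueDiffOn : UniqueDiffOn ℝ S
  subset_closure : S ⊆ closure (interior S)
  uniqueDiffOn' : UniqueDiffOn ℝ S'
  contDiffOn : ContDiffOn ℝ ∞ φ S
  mapsTo : MapsTo φ S S'
  contDiffOn_form : ContDiffOn ℝ ∞ G S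
  contDiffOn_form' : ContDiffOn ℝ ∞ G' S'
  symm' : ∀ y ∈ S', (G' y).Symm
  posDef : ∀ y ∈ S, (G y).PosDef
  posDef' : ∀ y ∈ S', (G' y).PosDef
  surjective : ∀ y ∈ S, Function.Surjective (fderivWithin ℝ φ S y)
  eq_pullback : ∀ y ∈ S, ∀ u v,
    G y u v = G' (φ y) (fderivWithin ℝ φ S y u) (fderivWithin ℝ φ S y v)

namespace IsCoordPullback

variable [FiniteDimensional ℝ E'] {φ : E → E'} {G : E → Bil E} {S : Set E} {G' : E' → Bil E'}
  {S' : Set E'} (h : IsCoordPullback φ G S G' S')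

include h

omit [FiniteDimensional ℝ E] [FiniteDimensional ℝ E'] in
theorem hasFDerivWithinAt_fderivWithin {y : E} (hy : y ∈ S) (u : E) :
    HasFDerivWithinAt (fun z ↦ fderivWithin ℝ φ S z u)
      ((fderivWithin ℝ (fderivWithin ℝ φ S) S y).flip u) S y := by
  have := ((h.contDiffOn.contDiffOn_fderivWithin h.uniqueDiffOn).differentiableOn_infty y
    hy).hasFDerivWithinAt.clm_apply (hasFDerivWithinAt_const u y S)
  convert this using 1
  ext z
  simp

-- At boundary points the symmetry is a limit of the symmetry at interior points, hence the
-- condition `subset_closure`.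
omit [FiniteDimensional ℝ E] [FiniteDimensional ℝ E'] in
theorem fderivWithin_symm {F : E → E'} (hF : ContDiffOn ℝ ∞ F S) {y : E} (hy : y ∈ S) (u v : E) :
    fderivWithin ℝ (fderivWithin ℝ F S) S y u v = fderivWithin ℝ (fderivWithin ℝ F S) S y v u :=
  (hF y hy).isSymmSndFDerivWithinAt two_le_infty h.uniqueDiffOn (h.subset_closure hy) hy u v

omit [FiniteDimensional ℝ E] [FiniteDimensional ℝ E'] in
theorem fderivWithin_form {y : E} (hy : y ∈ S) (a u v : E) :
    fderivWithin ℝ G S y a u v =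
      fderivWithin ℝ G' S' (φ y) (fderivWithin ℝ φ S y a) (fderivWithin ℝ φ S y u)
          (fderivWithin ℝ φ S y v)
        + G' (φ y) (fderivWithin ℝ (fderivWithin ℝ φ S) S y a u) (fderivWithin ℝ φ S y v)
        + G' (φ y) (fderivWithin ℝ φ S y u) (fderivWithin ℝ (fderivWithin ℝ φ S) S y a v) := by
  rw [fderivWithin_apply₂ (h.uniqueDiffOn y hy) (h.contDiffOn_form.differentiableOn_infty y hy)]
  have h1 := (h.contDiffOn_form'.differentiableOn_infty _ (h.mapsTo hy)).hasFDerivWithinAt.comp y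
    (h.contDiffOn.differentiableOn_infty y hy).hasFDerivWithinAt h.mapsTo
  have h2 := (h1.clm_apply (h.hasFDerivWithinAt_fderivWithin hy u)).clm_apply
    (h.hasFDerivWithinAt_fderivWithin hy v)
  rw [(h2.congr (fun z hz ↦ h.eq_pullback z hz u v) (h.eq_pullback y hy u v)).fderivWithin
    (h.uniqueDiffOn y hy)]
  simp only [add_apply, ContinuousLinearMap.comp_apply, ContinuousLinearMap.flip_apply,
    Function.comp_apply]
  ring

/-- In the Koszul formula for the pulled back form, the second derivatives of `φ` cancel by symmetry
except for those in the directions `u, v`. Testing against vectors `Dφ w` suffices because `Dφ` is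
onto. -/
theorem fderivWithin_christoffel {y : E} (hy : y ∈ S) (u v : E) :
    fderivWithin ℝ φ S y (christoffel G S y u v) =
      fderivWithin ℝ (fderivWithin ℝ φ S) S y u v
        + christoffel G' S' (φ y) (fderivWithin ℝ φ S y u) (fderivWithin ℝ φ S y v) := by
  have hsymm := h.fderivWithin_symm h.contDiffOn hy
  have hG' := h.symm' _ (h.mapsTo hy)
  refine (h.posDef' _ (h.mapsTo hy)).ext fun w' ↦ ?_
  obtain ⟨w, rfl⟩ := h.surjective y hy w'
  rw [← h.eq_pullback y hy, apply_christoffel (h.posDef y hy), map_add, add_apply,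
    apply_christoffel (h.posDef' _ (h.mapsTo hy)), lowerSymbol_apply, lowerSymbol_apply,
    h.fderivWithin_form hy, h.fderivWithin_form hy, h.fderivWithin_form hy, hsymm v u,
    hsymm w u, hsymm w v, hG' (fderivWithin ℝ φ S y v), hG' (fderivWithin ℝ φ S y u)
      (fderivWithin ℝ (fderivWithin ℝ φ S) S y v w)]
  ring

/-- The transformation law of the Christoffel symbols is differentiated once more and
antisymmetrised. Third derivatives of `φ` cancel by symmetry, second derivatives cancel after
inserting the law itself. -/
theorem fderivWithin_coordRiemann {x : E} (hx : x ∈ S) (u v w : E) :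
    fderivWithin ℝ φ S x (coordRiemann G S x u v w) =
      coordRiemann G' S' (φ x) (fderivWithin ℝ φ S x u) (fderivWithin ℝ φ S x v)
        (fderivWithin ℝ φ S x w) := by
  have hΓ := (contDiffOn_christoffel h.uniqueDiffOn h.contDiffOn_form
    h.posDef).differentiableOn_infty
  have hΓ' := (contDiffOn_christoffel h.uniqueDiffOn' h.contDiffOn_form'
    h.posDef').differentiableOn_infty
  have hφ1 := h.contDiffOn.contDiffOn_fderivWithin h.uniqueDiffOn
  have hφ2 := hφ1.contDiffOn_fderivWithin h.uniqueDiffOn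
  set D := fderivWithin ℝ φ S x with hD
  set D2 := fderivWithin ℝ (fderivWithin ℝ φ S) S x with hD2
  set D3 := fderivWithin ℝ (fderivWithin ℝ (fderivWithin ℝ φ S) S) S x with hD3
  have key : ∀ a b c : E, D2 a (christoffel G S x b c)
      + D (fderivWithin ℝ (christoffel G S) S x a b c) =
      D3 a b c + (fderivWithin ℝ (christoffel G' S') S' (φ x) (D a) (D b) (D c)
        + christoffel G' S' (φ x) (D2 a b) (D c) + christoffel G' S' (φ x) (D b) (D2 a c)) := by
    intro a b c
    have hγ := ((hΓ x hx).hasFDerivWithinAt.clm_apply (hasFDerivWithinAt_const b x S)).clm_apply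
      (hasFDerivWithinAt_const c x S)
    have hleft := (hφ1.differentiableOn_infty x hx).hasFDerivWithinAt.clm_apply hγ
    have hr1 := ((hφ2.differentiableOn_infty x hx).hasFDerivWithinAt.clm_apply
      (hasFDerivWithinAt_const b x S)).clm_apply (hasFDerivWithinAt_const c x S)
    have hr2 := (((hΓ' _ (h.mapsTo hx)).hasFDerivWithinAt.comp x
      (h.contDiffOn.differentiableOn_infty x hx).hasFDerivWithinAt h.mapsTo).clm_apply
      (h.hasFDerivWithinAt_fderivWithin hx b)).clm_apply (h.hasFDerivWithinAt_fderivWithin hx c)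
    have h2 := (h.uniqueDiffOn x hx).eq hleft ((hr1.add hr2).congr
      (fun z hz ↦ h.fderivWithin_christoffel hz b c) (h.fderivWithin_christoffel hx b c))
    have h3 := congr($h2 a)
    simp only [add_apply, ContinuousLinearMap.comp_apply, ContinuousLinearMap.flip_apply,
      map_zero, zero_add, zero_apply, Function.comp_apply] at h3
    simp only [hD, hD2, hD3]
    rw [add_comm, h3]
    abel
  have hchr : ∀ b c, D (christoffel G S x b c) =
      D2 b c + christoffel G' S' (φ x) (D b) (D c) := h.fderivWithin_christoffel hx
  have hs2 : ∀ a b, D2 a b = D2 b a := h.fderivWithin_symm h.contDiffOn hx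
  have hs3 : ∀ a b c, D3 a b c = D3 b a c := fun a b c ↦ by
    have := (hφ1 x hx).isSymmSndFDerivWithinAt two_le_infty h.uniqueDiffOn (h.subset_closure hx) hx a b
    exact congr($this c)
  have k1 := eq_sub_of_add_eq' (key u v w)
  have k2 := eq_sub_of_add_eq' (key v u w)
  simp only [coordRiemann, map_add, map_sub, k1, k2, hchr]
  rw [hs3 u v, hs2 v u]
  abel

end IsCoordPullback

end Coord

/-! ### Curvature of orthogonal products. -/

section ProductForms

variable {E F : Type*} [NormedAddCommGroup E] [NormedSpace ℝ E]
  [NormedAddCommGroup F] [NormedSpace ℝ F]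

/-- The orthogonal sum of two bilinear forms. -/
def Bil.prod (B : Bil E) (β : Bil F) : Bil (E × F) :=
  B.bilinearComp (ContinuousLinearMap.fst ℝ E F) (ContinuousLinearMap.fst ℝ E F)
    + β.bilinearComp (ContinuousLinearMap.snd ℝ E F) (ContinuousLinearMap.snd ℝ E F)

@[simp]
theorem Bil.prod_apply (B : Bil E) (β : Bil F) (p q : E × F) :
    B.prod β p q = B p.1 q.1 + β p.2 q.2 := rfl

theorem Bil.PosDef.prod {B : Bil E} {β : Bil F} (hB : B.PosDef) (hβ : β.PosDef) :
    (B.prod β).PosDef := by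
  intro v hv
  rw [Bil.prod_apply]
  have h1 : 0 ≤ B v.1 v.1 := by
    rcases eq_or_ne v.1 0 with h | h
    · simp [h]
    · exact (hB _ h).le
  have h2 : 0 ≤ β v.2 v.2 := by
    rcases eq_or_ne v.2 0 with h | h
    · simp [h]
    · exact (hβ _ h).le
  rcases eq_or_ne v.1 0 with h | h
  · have : v.2 ≠ 0 := fun h' ↦ hv (Prod.ext h h')
    linarith [hβ _ this]
  · linarith [hB _ h]

theorem Bil.PosDef.of_prod_left {B : Bil E} {β : Bil F} (h : (B.prod β).PosDef) : B.PosDef :=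
  fun v hv ↦ by simpa using h (v, 0) (by simpa using hv)

theorem contDiff_bilinearComp {V W : Type*} [NormedAddCommGroup V] [NormedSpace ℝ V]
    [NormedAddCommGroup W] [NormedSpace ℝ W] [FiniteDimensional ℝ V] [FiniteDimensional ℝ W]
    (L : V →L[ℝ] W) : ContDiff ℝ ∞ fun B : Bil W ↦ (B.bilinearComp L L : Bil V) := by
  let T : Bil W →ₗ[ℝ] Bil V :=
    { toFun := fun B ↦ B.bilinearComp L L
      map_add' := fun _ _ ↦ rfl
      map_smul' := fun _ _ ↦ rfl }
  exact (LinearMap.toContinuousLinearMap T).contDiff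

variable [FiniteDimensional ℝ E] [FiniteDimensional ℝ F]

/-- Each summand depends on its own variable only, so the derivative of the form splits, and with it
the Christoffel symbols and their derivatives. -/
theorem coordRiemann_prod {G₁ : E → Bil E} {G₂ : F → Bil F} {S₁ : Set E} {S₂ : Set F}
    (hS₁ : UniqueDiffOn ℝ S₁) (hS₂ : UniqueDiffOn ℝ S₂) (hG₁ : ContDiffOn ℝ ∞ G₁ S₁)
    (hG₂ : ContDiffOn ℝ ∞ G₂ S₂) (hB₁ : ∀ y ∈ S₁, (G₁ y).PosDef) (hB₂ : ∀ y ∈ S₂, (G₂ y).PosDef)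
    {y : E × F} (hy : y ∈ S₁ ×ˢ S₂) (u v w : E × F) :
    coordRiemann (fun z ↦ (G₁ z.1).prod (G₂ z.2)) (S₁ ×ˢ S₂) y u v w =
      (coordRiemann G₁ S₁ y.1 u.1 v.1 w.1, coordRiemann G₂ S₂ y.2 u.2 v.2 w.2) := by
  set G : E × F → Bil (E × F) := fun z ↦ (G₁ z.1).prod (G₂ z.2) with hGdef
  have hS : UniqueDiffOn ℝ (S₁ ×ˢ S₂) := hS₁.prod hS₂
  have hG : ContDiffOn ℝ ∞ G (S₁ ×ˢ S₂) :=
    ((contDiff_bilinearComp _).comp_contDiffOn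
      (hG₁.comp contDiff_fst.contDiffOn fun z hz ↦ hz.1)).add
    ((contDiff_bilinearComp _).comp_contDiffOn
      (hG₂.comp contDiff_snd.contDiffOn fun z hz ↦ hz.2))
  have hB : ∀ y ∈ S₁ ×ˢ S₂, (G y).PosDef := fun y hy ↦ (hB₁ _ hy.1).prod (hB₂ _ hy.2)
  have hΓ₁ := contDiffOn_christoffel hS₁ hG₁ hB₁
  have hΓ₂ := contDiffOn_christoffel hS₂ hG₂ hB₂
  have hΓ := contDiffOn_christoffel hS hG hB
  have m1 : ∀ {z : E × F}, z ∈ S₁ ×ˢ S₂ → HasFDerivWithinAt Prod.fst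
    (ContinuousLinearMap.fst ℝ E F) (S₁ ×ˢ S₂) z := fun _ ↦ hasFDerivWithinAt_fst
  have m2 : ∀ {z : E × F}, z ∈ S₁ ×ˢ S₂ → HasFDerivWithinAt Prod.snd
    (ContinuousLinearMap.snd ℝ E F) (S₁ ×ˢ S₂) z := fun _ ↦ hasFDerivWithinAt_snd
  have maps1 : MapsTo Prod.fst (S₁ ×ˢ S₂) S₁ := fun z hz ↦ hz.1
  have maps2 : MapsTo Prod.snd (S₁ ×ˢ S₂) S₂ := fun z hz ↦ hz.2
  have dG : ∀ z ∈ S₁ ×ˢ S₂, ∀ a p q, fderivWithin ℝ G (S₁ ×ˢ S₂) z a p q =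
      fderivWithin ℝ G₁ S₁ z.1 a.1 p.1 q.1 + fderivWithin ℝ G₂ S₂ z.2 a.2 p.2 q.2 := by
    intro z hz a p q
    rw [fderivWithin_apply₂ (hS z hz) (hG.differentiableOn_infty z hz)]
    have h1 := (((hG₁.differentiableOn_infty _ hz.1).hasFDerivWithinAt.comp z (m1 hz)
      maps1).clm_apply (hasFDerivWithinAt_const p.1 z _)).clm_apply
        (hasFDerivWithinAt_const q.1 z _)
    have h2 := (((hG₂.differentiableOn_infty _ hz.2).hasFDerivWithinAt.comp z (m2 hz)
      maps2).clm_apply (hasFDerivWithinAt_const p.2 z _)).clm_apply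
        (hasFDerivWithinAt_const q.2 z _)
    have h3 := ((h1.add h2).congr (f₁ := fun y ↦ G y p q) (fun z hz ↦ rfl) rfl).fderivWithin (hS z hz)
    rw [h3]
    simp
  have hchr : ∀ z ∈ S₁ ×ˢ S₂, ∀ p q, christoffel G (S₁ ×ˢ S₂) z p q =
      (christoffel G₁ S₁ z.1 p.1 q.1, christoffel G₂ S₂ z.2 p.2 q.2) := by
    intro z hz p q
    refine (hB z hz).ext fun w ↦ ?_
    rw [apply_christoffel (hB z hz), lowerSymbol_apply, dG z hz, dG z hz, dG z hz]
    change _ = G₁ z.1 (christoffel G₁ S₁ z.1 p.1 q.1) w.1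
      + G₂ z.2 (christoffel G₂ S₂ z.2 p.2 q.2) w.2
    rw [apply_christoffel (hB₁ _ hz.1), apply_christoffel (hB₂ _ hz.2), lowerSymbol_apply,
      lowerSymbol_apply]
    ring
  have dΓ : ∀ a p q, fderivWithin ℝ (christoffel G (S₁ ×ˢ S₂)) (S₁ ×ˢ S₂) y a p q =
      (fderivWithin ℝ (christoffel G₁ S₁) S₁ y.1 a.1 p.1 q.1,
        fderivWithin ℝ (christoffel G₂ S₂) S₂ y.2 a.2 p.2 q.2) := by
    intro a p q
    rw [fderivWithin_apply₂ (hS y hy) (hΓ.differentiableOn_infty y hy)]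
    have h1 := (((hΓ₁.differentiableOn_infty _ hy.1).hasFDerivWithinAt.comp y (m1 hy)
      maps1).clm_apply (hasFDerivWithinAt_const p.1 y _)).clm_apply
        (hasFDerivWithinAt_const q.1 y _)
    have h2 := (((hΓ₂.differentiableOn_infty _ hy.2).hasFDerivWithinAt.comp y (m2 hy)
      maps2).clm_apply (hasFDerivWithinAt_const p.2 y _)).clm_apply
        (hasFDerivWithinAt_const q.2 y _)
    rw [((h1.prodMk h2).congr (fun z hz ↦ hchr z hz p q) (hchr y hy p q)).fderivWithin (hS y hy)]
    simp
  simp only [coordRiemann, dΓ, hchr y hy]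
  rfl

end ProductForms

/-! ### Curvature conditions in coordinates: locality, naturality, products with a line. -/

section At

variable {E E' F : Type} [NormedAddCommGroup E] [NormedSpace ℝ E]
  [NormedAddCommGroup E'] [NormedSpace ℝ E'] [NormedAddCommGroup F] [NormedSpace ℝ F]

/-- The form `G` is positive definite at `y` and its curvature satisfies `C`. -/
def CurvCond.At (C : CurvCond) (G : E → Bil E) (S : Set E) (y : E) : Prop :=
  (G y).PosDef ∧ C.Holds E (G y) (jetAt G S y).riem

theorem CurvCond.at_congr_set (C : CurvCond) {G : E → Bil E} {S T : Set E} {y : E}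
    (h : S =ᶠ[𝓝 y] T) : C.At G S y ↔ C.At G T y := by
  rw [CurvCond.At, CurvCond.At, jetAt_congr_set h]

theorem CurvCond.at_congr (C : CurvCond) {G G' : E → Bil E} {S : Set E} {y : E}
    (hy : y ∈ S) (h : EqOn G G' S) : C.At G S y ↔ C.At G' S y := by
  have h1 : EqOn (fderivWithin ℝ G S) (fderivWithin ℝ G' S) S := fun z hz ↦
    fderivWithin_congr h (h hz)
  rw [CurvCond.At, CurvCond.At, jetAt, jetAt, h hy, h1 hy, fderivWithin_congr h1 (h1 hy)]

variable [FiniteDimensional ℝ E] [FiniteDimensional ℝ E'] [FiniteDimensional ℝ F]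

/-- The differential of `φ` is injective because the pulled back form is positive definite. It is
therefore a linear isometry that intertwines the curvature tensors, and `CurvCond.congr` applies in
both directions. -/
theorem CurvCond.at_pullback (C : CurvCond) {φ : E → E'} {G : E → Bil E} {S : Set E}
    {G' : E' → Bil E'} {S' : Set E'} (h : IsCoordPullback φ G S G' S') {y : E} (hy : y ∈ S) :
    C.At G S y ↔ C.At G' S' (φ y) := by
  have hinj : Function.Injective (fderivWithin ℝ φ S y : E →ₗ[ℝ] E') := by
    rw [← LinearMap.ker_eq_bot, LinearMap.ker_eq_bot']
    intro u hu
    by_contra hne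
    have h1 := h.posDef y hy u hne
    have h2 : fderivWithin ℝ φ S y u = 0 := hu
    rw [h.eq_pullback y hy, h2, map_zero] at h1
    exact lt_irrefl _ h1
  let A := LinearEquiv.ofBijective (fderivWithin ℝ φ S y : E →ₗ[ℝ] E') ⟨hinj, h.surjective y hy⟩
  have hA : ∀ u, A u = fderivWithin ℝ φ S y u := fun _ ↦ rfl
  have e1 : ∀ u v, G y u v = G' (φ y) (A u) (A v) := h.eq_pullback y hy
  have e2 : ∀ u v w, A ((jetAt G S y).riem u v w) =
      (jetAt G' S' (φ y)).riem (A u) (A v) (A w) := fun u v w ↦ by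
    rw [← coordRiemann_eq_riem h.uniqueDiffOn h.contDiffOn_form h.posDef hy,
      ← coordRiemann_eq_riem h.uniqueDiffOn' h.contDiffOn_form' h.posDef' (h.mapsTo hy), hA,
      h.fderivWithin_coordRiemann hy]
    rfl
  refine and_congr (iff_of_true (h.posDef y hy) (h.posDef' _ (h.mapsTo hy))) ⟨C.congr A e1 e2,
    C.congr A.symm (fun u v ↦ ?_) fun u v w ↦ ?_⟩
  · simp [e1]
  · apply A.injective
    simp [e2]

theorem CurvCond.at_prod (C : CurvCond) {G₁ : E → Bil E} {G₂ : F → Bil F} {S₁ : Set E}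
    {S₂ : Set F} (hF : finrank ℝ F = 1)
    (hS₁ : UniqueDiffOn ℝ S₁) (hS₂ : UniqueDiffOn ℝ S₂) (hG₁ : ContDiffOn ℝ ∞ G₁ S₁)
    (hG₂ : ContDiffOn ℝ ∞ G₂ S₂) (hB₁ : ∀ y ∈ S₁, (G₁ y).PosDef) (hB₂ : ∀ y ∈ S₂, (G₂ y).PosDef)
    {y : E × F} (hy : y ∈ S₁ ×ˢ S₂) :
    C.At (fun z ↦ (G₁ z.1).prod (G₂ z.2)) (S₁ ×ˢ S₂) y ↔ C.At G₁ S₁ y.1 := by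
  have hG : ContDiffOn ℝ ∞ (fun z ↦ (G₁ z.1).prod (G₂ z.2)) (S₁ ×ˢ S₂) :=
    ((contDiff_bilinearComp _).comp_contDiffOn
      (hG₁.comp contDiff_fst.contDiffOn fun z hz ↦ hz.1)).add
    ((contDiff_bilinearComp _).comp_contDiffOn
      (hG₂.comp contDiff_snd.contDiffOn fun z hz ↦ hz.2))
  have hB : ∀ y ∈ S₁ ×ˢ S₂, ((G₁ y.1).prod (G₂ y.2)).PosDef :=
    fun y hy ↦ (hB₁ _ hy.1).prod (hB₂ _ hy.2)
  refine and_congr (iff_of_true (hB y hy) (hB₁ _ hy.1)) (C.prod (hB₁ _ hy.1) (hB₂ _ hy.2) hF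
    (fun _ _ ↦ rfl) (fun p q r ↦ ?_) (Jet.riem_antisymm _)).symm
  rw [← coordRiemann_eq_riem (hS₁.prod hS₂) hG hB hy, ← coordRiemann_eq_riem hS₁ hG₁ hB₁ hy.1,
    coordRiemann_prod hS₁ hS₂ hG₁ hG₂ hB₁ hB₂ hy, coordRiemann_eq_zero_of_finrank hF]

end At

/-! ### Families of smooth functions -/

/-- A family of functions on `T` indexed by `Q` that is `n` times differentiable, with all
derivatives of order at most `n` jointly continuous. -/
def FamOn {Q E : Type*} [TopologicalSpace Q] [NormedAddCommGroup E] [NormedSpace ℝ E] :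
    ∀ (_ : ℕ) {V : Type _} [NormedAddCommGroup V] [NormedSpace ℝ V], (Q → E → V) → Set E → Prop
  | 0, _, _, _, F, T => ContinuousOn (fun p : Q × E ↦ F p.1 p.2) (univ ×ˢ T)
  | n + 1, _, _, _, F, T => ContinuousOn (fun p : Q × E ↦ F p.1 p.2) (univ ×ˢ T) ∧
      (∀ q, DifferentiableOn ℝ (F q) T) ∧ FamOn n (fun q ↦ fderivWithin ℝ (F q) T) T

namespace FamOn

variable {Q : Type w} [TopologicalSpace Q] {E V W X : Type v} [NormedAddCommGroup E]
  [NormedSpace ℝ E] [NormedAddCommGroup V] [NormedSpace ℝ V] [NormedAddCommGroup W]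
  [NormedSpace ℝ W] [NormedAddCommGroup X] [NormedSpace ℝ X] {n : ℕ} {F : Q → E → V} {T : Set E}

theorem continuousOn (h : FamOn n F T) :
    ContinuousOn (fun p : Q × E ↦ F p.1 p.2) (univ ×ˢ T) := by
  cases n with
  | zero => exact h
  | succ n => exact h.1

theorem of_succ (h : FamOn (n + 1) F T) : FamOn n F T := by
  induction n generalizing V with
  | zero => exact h.continuousOn
  | succ n ih => exact ⟨h.1, h.2.1, ih h.2.2⟩

theorem congr {F' : Q → E → V} (h : FamOn n F T) (hF : ∀ q, ∀ y ∈ T, F' q y = F q y) :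
    FamOn n F' T := by
  induction n generalizing V with
  | zero => exact ContinuousOn.congr h fun p hp ↦ hF p.1 p.2 hp.2
  | succ n ih =>
    exact ⟨h.1.congr fun p hp ↦ hF p.1 p.2 hp.2, fun q ↦ (h.2.1 q).congr (hF q),
      ih h.2.2 fun q y hy ↦ fderivWithin_congr (hF q) (hF q y hy)⟩

theorem of_hasFDerivWithinAt (hT : UniqueDiffOn ℝ T) {F' : Q → E → E →L[ℝ] V}
    (hc : ContinuousOn (fun p : Q × E ↦ F p.1 p.2) (univ ×ˢ T))
    (hF : ∀ q, ∀ y ∈ T, HasFDerivWithinAt (F q) (F' q y) T y) (h : FamOn n F' T) :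
    FamOn (n + 1) F T :=
  ⟨hc, fun q y hy ↦ (hF q y hy).differentiableWithinAt,
    h.congr fun q y hy ↦ (hF q y hy).fderivWithin (hT y hy)⟩

theorem hasFDerivWithinAt (h : FamOn (n + 1) F T) (q : Q) {y : E} (hy : y ∈ T) :
    HasFDerivWithinAt (F q) (fderivWithin ℝ (F q) T y) T y :=
  (h.2.1 q y hy).hasFDerivWithinAt

theorem clm (hT : UniqueDiffOn ℝ T) (L : V →L[ℝ] W) (h : FamOn n F T) :
    FamOn n (fun q y ↦ L (F q y)) T := by
  induction n generalizing V W with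
  | zero => exact L.continuous.comp_continuousOn h
  | succ n ih =>
    exact of_hasFDerivWithinAt hT (L.continuous.comp_continuousOn h.1)
      (fun q y hy ↦ L.hasFDerivAt.comp_hasFDerivWithinAt y (h.hasFDerivWithinAt q hy))
      (ih (ContinuousLinearMap.compL ℝ E V W L) h.2.2)

theorem zero (hT : UniqueDiffOn ℝ T) : FamOn n (fun (_ : Q) (_ : E) ↦ (0 : V)) T := by
  induction n generalizing V with
  | zero => exact continuousOn_const
  | succ n ih =>
    exact of_hasFDerivWithinAt hT continuousOn_const
      (fun q y _ ↦ hasFDerivWithinAt_const 0 y T) ih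

/-- A family of constant functions. -/
theorem param (hT : UniqueDiffOn ℝ T) {c : Q → V} (hc : Continuous c) :
    FamOn n (fun q _ ↦ c q) T := by
  have : ContinuousOn (fun p : Q × E ↦ c p.1) (univ ×ˢ T) :=
    (hc.comp continuous_fst).continuousOn
  cases n with
  | zero => exact this
  | succ n =>
    exact of_hasFDerivWithinAt hT this (fun q y _ ↦ hasFDerivWithinAt_const (c q) y T) (zero hT)

/-- A constant family. -/
theorem const (hT : UniqueDiffOn ℝ T) {f : E → V} (hf : ContDiffOn ℝ ∞ f T) :
    FamOn n (fun (_ : Q) ↦ f) T := by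
  have : ContinuousOn (fun p : Q × E ↦ f p.2) (univ ×ˢ T) :=
    hf.continuousOn.comp continuousOn_snd fun p hp ↦ hp.2
  induction n generalizing V with
  | zero => exact this
  | succ n ih =>
    have h1 := hf.contDiffOn_fderivWithin hT
    exact ⟨this, fun _ ↦ hf.differentiableOn_infty, ih h1
      (h1.continuousOn.comp continuousOn_snd fun p hp ↦ hp.2)⟩

theorem add (hT : UniqueDiffOn ℝ T) {F' : Q → E → V} (h : FamOn n F T) (h' : FamOn n F' T) :
    FamOn n (fun q y ↦ F q y + F' q y) T := by
  induction n generalizing V with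
  | zero => exact ContinuousOn.add h h'
  | succ n ih =>
    exact of_hasFDerivWithinAt hT (h.1.add h'.1)
      (fun q y hy ↦ (h.hasFDerivWithinAt q hy).add (h'.hasFDerivWithinAt q hy)) (ih h.2.2 h'.2.2)

theorem bilinear_continuousOn (B : V →L[ℝ] W →L[ℝ] X) {A : Q → E → W}
    (h : FamOn n F T) (hA : FamOn n A T) :
    ContinuousOn (fun p : Q × E ↦ B (F p.1 p.2) (A p.1 p.2)) (univ ×ˢ T) :=
  (B.continuous.comp_continuousOn h.continuousOn).clm_apply hA.continuousOn

/-- The derivative is a sum of two products of the same type, for the bilinear maps `compL` applied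
to `B` composed with one factor and the derivative of the other; hence the induction over all spaces
at once. -/
theorem bilinear (hT : UniqueDiffOn ℝ T) (B : V →L[ℝ] W →L[ℝ] X) {A : Q → E → W}
    (h : FamOn n F T) (hA : FamOn n A T) : FamOn n (fun q y ↦ B (F q y) (A q y)) T := by
  induction n generalizing V W X with
  | zero => exact bilinear_continuousOn B h hA
  | succ n ih =>
    have hc := bilinear_continuousOn B h hA
    obtain ⟨-, hAd, hA'⟩ := id hA
    obtain ⟨-, hFd, hF'⟩ := id h
    have h1 := ih (ContinuousLinearMap.compL ℝ E W X) (h.of_succ.clm hT B) hA'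
    have h2 := ih (ContinuousLinearMap.compL ℝ E V X) (hA.of_succ.clm hT B.flip) hF'
    have hd : ∀ q, ∀ y ∈ T, HasFDerivWithinAt (fun y ↦ B (F q y) (A q y))
        (ContinuousLinearMap.compL ℝ E W X (B (F q y)) (fderivWithin ℝ (A q) T y)
          + ContinuousLinearMap.compL ℝ E V X (B.flip (A q y)) (fderivWithin ℝ (F q) T y)) T y :=
      fun q y hy ↦ by
        have h3 := (B.hasFDerivAt.comp_hasFDerivWithinAt y (h.hasFDerivWithinAt q hy)).clm_apply
          (hA.hasFDerivWithinAt q hy)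
        refine h3.congr_fderiv ?_
        ext z
        simp
    exact of_hasFDerivWithinAt hT hc hd (add hT h1 h2)

theorem comp {F : Q → W → V} {T' : Set W} {φ : Q → E → W} (hT : UniqueDiffOn ℝ T)
    (h : FamOn n F T') (hφ : FamOn n φ T) (hm : ∀ q, MapsTo (φ q) T T') :
    FamOn n (fun q y ↦ F q (φ q y)) T := by
  have hc : ContinuousOn (fun p : Q × E ↦ F p.1 (φ p.1 p.2)) (univ ×ˢ T) :=
    h.continuousOn.comp (f := fun p : Q × E ↦ (p.1, φ p.1 p.2))
      (continuousOn_fst.prodMk hφ.continuousOn) fun p hp ↦ ⟨mem_univ _, hm p.1 hp.2⟩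
  induction n generalizing V with
  | zero => exact hc
  | succ n ih =>
    have hd : ∀ q, ∀ y ∈ T, HasFDerivWithinAt (fun y ↦ F q (φ q y))
        (ContinuousLinearMap.compL ℝ E W V (fderivWithin ℝ (F q) T' (φ q y))
          (fderivWithin ℝ (φ q) T y)) T y := fun q y hy ↦
      (h.hasFDerivWithinAt q (hm q hy)).comp y (hφ.hasFDerivWithinAt q hy) (hm q)
    have h1 := ih h.2.2 hφ.of_succ (h.2.2.continuousOn.comp
      (f := fun p : Q × E ↦ (p.1, φ p.1 p.2)) (continuousOn_fst.prodMk hφ.continuousOn)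
      fun p hp ↦ ⟨mem_univ _, hm p.1 hp.2⟩)
    exact of_hasFDerivWithinAt hT hc hd (bilinear hT (ContinuousLinearMap.compL ℝ E W V) h1 hφ.2.2)

theorem reparam {Q' : Type*} [TopologicalSpace Q'] {α : Q' → Q} (hα : Continuous α)
    (h : FamOn n F T) : FamOn n (fun q ↦ F (α q)) T := by
  have hc : ContinuousOn (fun p : Q' × E ↦ F (α p.1) p.2) (univ ×ˢ T) :=
    h.continuousOn.comp (f := fun p : Q' × E ↦ (α p.1, p.2)) (by fun_prop)
      fun p hp ↦ ⟨mem_univ _, hp.2⟩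
  induction n generalizing V with
  | zero => exact hc
  | succ n ih =>
    exact ⟨hc, fun q ↦ h.2.1 _, ih h.2.2 (h.2.2.continuousOn.comp
      (f := fun p : Q' × E ↦ (α p.1, p.2)) (by fun_prop) fun p hp ↦ ⟨mem_univ _, hp.2⟩)⟩

theorem of_locally (h : ∀ y ∈ T, ∃ O, IsOpen O ∧ y ∈ O ∧ FamOn n F (T ∩ O)) : FamOn n F T := by
  have hc : ContinuousOn (fun p : Q × E ↦ F p.1 p.2) (univ ×ˢ T) := fun p hp ↦ by
    obtain ⟨O, hO, hpO, hF⟩ := h p.2 hp.2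
    refine (hF.continuousOn p ⟨hp.1, hp.2, hpO⟩).mono_of_mem_nhdsWithin ?_
    filter_upwards [self_mem_nhdsWithin,
      mem_nhdsWithin_of_mem_nhds ((hO.preimage continuous_snd).mem_nhds hpO)] with z hz hz'
    exact ⟨hz.1, hz.2, hz'⟩
  induction n generalizing V with
  | zero => exact hc
  | succ n ih =>
    have hloc : ∀ y ∈ T, ∃ O, IsOpen O ∧ y ∈ O ∧
        FamOn n (fun q ↦ fderivWithin ℝ (F q) T) (T ∩ O) := fun y hy ↦ by
      obtain ⟨O, hO, hyO, hF⟩ := h y hy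
      refine ⟨O, hO, hyO, hF.2.2.congr fun q z hz ↦ ?_⟩
      rw [fderivWithin_inter (hO.mem_nhds hz.2)]
    refine ⟨hc, fun q y hy ↦ ?_, ih hloc fun p hp ↦ ?_⟩
    · obtain ⟨O, hO, hyO, hF⟩ := h y hy
      exact (differentiableWithinAt_inter (hO.mem_nhds hyO)).1 (hF.2.1 q y ⟨hy, hyO⟩)
    · obtain ⟨O, hO, hpO, hF⟩ := hloc p.2 hp.2
      refine (hF.continuousOn p ⟨hp.1, hp.2, hpO⟩).mono_of_mem_nhdsWithin ?_
      filter_upwards [self_mem_nhdsWithin,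
        mem_nhdsWithin_of_mem_nhds ((hO.preimage continuous_snd).mem_nhds hpO)] with z hz hz'
      exact ⟨hz.1, hz.2, hz'⟩

/-- Together with its converse below, this connects `FamOn` with the iterated derivatives in the
definition of the `C^∞`-topology. Currying on the right matches the recursion, which differentiates
the family first. -/
theorem continuousOn_iteratedFDerivWithin (hT : UniqueDiffOn ℝ T) {k : ℕ} (h : FamOn k F T) :
    ContinuousOn (fun p : Q × E ↦ iteratedFDerivWithin ℝ k (F p.1) T p.2) (univ ×ˢ T) := by
  induction k generalizing V with
  | zero =>
    simp only [iteratedFDerivWithin_zero_eq_comp]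
    exact (continuousMultilinearCurryFin0 ℝ E V).symm.continuous.comp_continuousOn h
  | succ k ih =>
    have := (continuousMultilinearCurryRightEquiv' ℝ k E V).symm.continuous.comp_continuousOn
      (ih h.2.2)
    refine this.congr fun p hp ↦ ?_
    rw [iteratedFDerivWithin_succ_eq_comp_right hT hp.2]
    rfl

theorem of_continuousOn_iteratedFDerivWithin (hT : UniqueDiffOn ℝ T)
    (hF : ∀ q, ContDiffOn ℝ ∞ (F q) T) (h : ∀ k ≤ n,
      ContinuousOn (fun p : Q × E ↦ iteratedFDerivWithin ℝ k (F p.1) T p.2) (univ ×ˢ T)) :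
    FamOn n F T := by
  have hc : ContinuousOn (fun p : Q × E ↦ F p.1 p.2) (univ ×ˢ T) := by
    have := (continuousMultilinearCurryFin0 ℝ E V).continuous.comp_continuousOn (h 0 n.zero_le)
    exact this.congr fun p hp ↦ by simp
  induction n generalizing V with
  | zero => exact hc
  | succ n ih =>
    have hk : ∀ k ≤ n, ContinuousOn (fun p : Q × E ↦
        iteratedFDerivWithin ℝ k (fderivWithin ℝ (F p.1) T) T p.2) (univ ×ˢ T) := fun k hk ↦ by
      have := (continuousMultilinearCurryRightEquiv' ℝ k E V).continuous.comp_continuousOn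
        (h (k + 1) (by omega))
      refine this.congr fun p hp ↦ ?_
      simp only [Function.comp_apply]
      rw [iteratedFDerivWithin_succ_eq_comp_right hT hp.2]
      exact ((continuousMultilinearCurryRightEquiv' ℝ k E V).apply_symm_apply _).symm
    refine ⟨hc, fun q ↦ (hF q).differentiableOn_infty,
      ih (fun q ↦ (hF q).contDiffOn_fderivWithin hT) hk ?_⟩
    have := (continuousMultilinearCurryFin0 ℝ E (E →L[ℝ] V)).continuous.comp_continuousOn
      (hk 0 n.zero_le)
    exact this.congr fun p hp ↦ by simp

theorem contDiffOn (hT : UniqueDiffOn ℝ T) (h : ∀ n, FamOn n F T) (q : Q) :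
    ContDiffOn ℝ ∞ (F q) T := by
  rw [contDiffOn_infty]
  intro n
  have hn := h n
  clear h
  induction n generalizing V with
  | zero =>
    refine contDiffOn_zero.2 ?_
    exact hn.continuousOn.comp (f := fun y ↦ (q, y)) (by fun_prop) fun y hy ↦ ⟨mem_univ _, hy⟩
  | succ n ih =>
    push_cast
    exact (contDiffOn_succ_iff_fderivWithin hT).2
      ⟨hn.2.1 q, by simp, ih hn.2.2⟩

-- The width `ε` may depend on `q` without any uniformity. At height zero the family is jointly
-- continuous from above with value `0`, and the extension is `0` below, so the two sides agree in
-- the limit.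
omit [NormedSpace ℝ E] [NormedSpace ℝ V] in
theorem extend_zero_continuousOn {S : Set E} {F : Q → E × ℝ → V}
    (h : ContinuousOn (fun z : Q × E × ℝ ↦ F z.1 z.2) (univ ×ˢ (S ×ˢ Ico (0 : ℝ) 1)))
    (hF : ∀ q, ∃ ε > 0, ∀ p ∈ S ×ˢ Ico (0 : ℝ) 1, p.2 < ε → F q p = 0) :
    ContinuousOn (fun z : Q × E × ℝ ↦ if 0 ≤ z.2.2 then F z.1 z.2 else 0)
      (univ ×ˢ (S ×ˢ Iio (1 : ℝ))) := by
  rintro ⟨q, y, s⟩ ⟨-, hy, hs⟩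
  rcases lt_or_ge s 0 with h0 | h0
  · refine (continuousWithinAt_const (b := (0 : V))).congr_of_eventuallyEq ?_ (if_neg h0.not_ge)
    have : ∀ᶠ z : Q × E × ℝ in 𝓝 (q, y, s), z.2.2 < 0 :=
      (continuous_snd.comp continuous_snd).continuousAt.eventually (Iio_mem_nhds h0)
    filter_upwards [mem_nhdsWithin_of_mem_nhds this] with z hz
    exact if_neg (not_le.2 hz)
  · have h1 := h (q, y, s) ⟨mem_univ _, hy, h0, hs⟩
    change Tendsto _ _ _
    simp only [h0, if_true]
    rw [tendsto_iff_forall_eventually_mem]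
    intro U hU
    have h2 : ∀ᶠ z : Q × E × ℝ in 𝓝[univ ×ˢ (S ×ˢ Iio (1 : ℝ))] (q, y, s),
        0 ≤ z.2.2 → F z.1 z.2 ∈ U := by
      have := eventually_nhdsWithin_iff.1 (h1 hU)
      filter_upwards [mem_nhdsWithin_of_mem_nhds this, self_mem_nhdsWithin] with z hz hz' hz0
      exact hz ⟨mem_univ _, hz'.2.1, hz0, hz'.2.2⟩
    rcases h0.eq_or_lt with rfl | h0
    · obtain ⟨ε, hε, hz⟩ := hF q
      have hU0 : (0 : V) ∈ U := by
        rw [hz (y, 0) ⟨hy, le_rfl, hs⟩ hε] at hU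
        exact mem_of_mem_nhds hU
      filter_upwards [h2] with z hz
      split_ifs with h3
      · exact hz h3
      · exact hU0
    · have : ∀ᶠ z : Q × E × ℝ in 𝓝 (q, y, s), 0 < z.2.2 :=
        (continuous_snd.comp continuous_snd).continuousAt.eventually (Ioi_mem_nhds h0)
      filter_upwards [h2, mem_nhdsWithin_of_mem_nhds this] with z hz hz'
      rw [if_pos (le_of_lt hz')]
      exact hz (le_of_lt hz')

/-- Extension by zero of a family that vanishes near the boundary of a half-space. -/
theorem extend_zero {S : Set E} {F : Q → E × ℝ → V} (hS : UniqueDiffOn ℝ S)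
    (h : FamOn n F (S ×ˢ Ico (0 : ℝ) 1))
    (hF : ∀ q, ∃ ε > 0, ∀ p ∈ S ×ˢ Ico (0 : ℝ) 1, p.2 < ε → F q p = 0) :
    FamOn n (fun q p ↦ if 0 ≤ p.2 then F q p else 0) (S ×ˢ Iio (1 : ℝ)) := by
  have hT : UniqueDiffOn ℝ (S ×ˢ Iio (1 : ℝ)) := hS.prod isOpen_Iio.uniqueDiffOn
  induction n generalizing V with
  | zero => exact extend_zero_continuousOn h.continuousOn hF
  | succ n ih =>
    -- The family of derivatives again vanishes near height zero, as the induction requires.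
    have hvan : ∀ q, ∃ ε > 0, ∀ p ∈ S ×ˢ Ico (0 : ℝ) 1, p.2 < ε →
        fderivWithin ℝ (F q) (S ×ˢ Ico (0 : ℝ) 1) p = 0 := fun q ↦ by
      obtain ⟨ε, hε, hz⟩ := hF q
      refine ⟨ε, hε, fun p hp hpε ↦ ?_⟩
      have : F q =ᶠ[𝓝[S ×ˢ Ico (0 : ℝ) 1] p] fun _ ↦ 0 := by
        have := continuous_snd.continuousAt.eventually (Iio_mem_nhds hpε)
        filter_upwards [self_mem_nhdsWithin, mem_nhdsWithin_of_mem_nhds this] with z hz1 hz2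
        exact hz z hz1 hz2
      rw [this.fderivWithin_eq (hz p hp hpε), fderivWithin_const_apply]
    have hderiv : ∀ q, ∀ p ∈ S ×ˢ Iio (1 : ℝ), HasFDerivWithinAt
        (fun p : E × ℝ ↦ if 0 ≤ p.2 then F q p else 0)
        (if 0 ≤ p.2 then fderivWithin ℝ (F q) (S ×ˢ Ico (0 : ℝ) 1) p else 0)
        (S ×ˢ Iio (1 : ℝ)) p := by
      rintro q ⟨y, s⟩ ⟨hy, hs⟩
      rcases lt_or_ge 0 s with h0 | h0
      · have h1 : HasFDerivWithinAt (F q) _ (S ×ˢ Ico (0 : ℝ) 1) (y, s) :=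
          h.hasFDerivWithinAt q ⟨hy, h0.le, hs⟩
        have hpos : ∀ᶠ z : E × ℝ in 𝓝 (y, s), 0 < z.2 :=
          continuous_snd.continuousAt.eventually (Ioi_mem_nhds h0)
        have hset : (S ×ˢ Ico (0 : ℝ) 1 : Set (E × ℝ)) =ᶠ[𝓝 (y, s)] S ×ˢ Iio (1 : ℝ) := by
          filter_upwards [hpos] with z hz
          exact propext ⟨fun hz' ↦ ⟨hz'.1, hz'.2.2⟩, fun hz' ↦ ⟨hz'.1, le_of_lt hz, hz'.2⟩⟩
        rw [if_pos h0.le]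
        refine ((hasFDerivWithinAt_congr_set hset).1 h1).congr_of_eventuallyEq ?_ (if_pos h0.le)
        filter_upwards [mem_nhdsWithin_of_mem_nhds hpos] with z hz
        exact if_pos (le_of_lt hz)
      · obtain ⟨ε, hε, hz⟩ := hF q
        have hzero : (if 0 ≤ s then fderivWithin ℝ (F q) (S ×ˢ Ico (0 : ℝ) 1) (y, s) else 0) = 0 := by
          split_ifs with h1
          · obtain ⟨δ, hδ, hz'⟩ := hvan q
            exact hz' _ ⟨hy, h1, hs⟩ (h0.trans_lt hδ)
          · rfl
        have hval : ∀ z ∈ S ×ˢ Iio (1 : ℝ), z.2 < ε → (if 0 ≤ z.2 then F q z else 0) = 0 :=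
          fun z hz1 hz2 ↦ by
            split_ifs with h1
            · exact hz z ⟨hz1.1, h1, hz1.2⟩ hz2
            · rfl
        rw [hzero]
        refine (hasFDerivWithinAt_const (0 : V) _ _).congr_of_eventuallyEq ?_
          (hval (y, s) ⟨hy, hs⟩ (h0.trans_lt hε))
        have : ∀ᶠ z : E × ℝ in 𝓝 (y, s), z.2 < ε :=
          continuous_snd.continuousAt.eventually (Iio_mem_nhds (h0.trans_lt hε))
        filter_upwards [self_mem_nhdsWithin, mem_nhdsWithin_of_mem_nhds this] with z hz1 hz2
        exact hval z hz1 hz2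
    exact of_hasFDerivWithinAt hT (extend_zero_continuousOn h.1 hF) hderiv (ih h.2.2 hvan)

end FamOn

/-! ### Derivatives of maps in charts. -/

section Manifold

variable {E : Type} [NormedAddCommGroup E] [NormedSpace ℝ E]
  {H : Type} [TopologicalSpace H] {I : ModelWithCorners ℝ E H}
  {M : Type*} [TopologicalSpace M] [ChartedSpace H M]
  {E' : Type} [NormedAddCommGroup E'] [NormedSpace ℝ E']
  {H' : Type} [TopologicalSpace H'] {I' : ModelWithCorners ℝ E' H'}
  {M' : Type*} [TopologicalSpace M'] [ChartedSpace H' M']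

/-- The value of a field of bilinear forms, as a form on the model space. -/
def BilinField.val (g : BilinField I M) (x : M) : Bil E := g x

/-- The derivative of a map, as a linear map of the model spaces. -/
def derivAt (I : ModelWithCorners ℝ E H) (I' : ModelWithCorners ℝ E' H') (f : M → M') (X : Set M)
    (x : M) : E →L[ℝ] E' := mfderivWithin I I' f X x

/-- The derivative of the inverse of the preferred chart at `x₀`. -/
def chartSymmDeriv (I : ModelWithCorners ℝ E H) (x₀ : M) (y : E) : E →L[ℝ] E :=
  mfderivWithin 𝓘(ℝ, E) I (extChartAt I x₀).symm (range I) y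

theorem coordForm_apply (g : BilinField I M) (x₀ : M) (y u v : E) :
    coordForm g x₀ y u v = g.val ((extChartAt I x₀).symm y) (chartSymmDeriv I x₀ y u)
      (chartSymmDeriv I x₀ y v) := rfl

/-- The domain of the expression of a map defined on `X` in the preferred chart at `x₀`. -/
def chartDom (I : ModelWithCorners ℝ E H) (x₀ : M) (X : Set M) : Set E :=
  (extChartAt I x₀).target ∩ (extChartAt I x₀).symm ⁻¹' X

theorem chartDom_subset_range (x₀ : M) (X : Set M) : chartDom I x₀ X ⊆ range I :=
  inter_subset_left.trans (extChartAt_target_subset_range x₀)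

theorem chartDom_univ (x₀ : M) : chartDom I x₀ univ = (extChartAt I x₀).target := by
  simp [chartDom]

theorem extChartAt_mem_chartDom {x₀ x : M} {X : Set M} (hx : x ∈ (extChartAt I x₀).source)
    (hX : x ∈ X) : extChartAt I x₀ x ∈ chartDom I x₀ X :=
  ⟨(extChartAt I x₀).map_source hx, by rwa [mem_preimage, (extChartAt I x₀).left_inv hx]⟩

/-- The expression of a map in preferred charts. -/
def coordMap (I : ModelWithCorners ℝ E H) (I' : ModelWithCorners ℝ E' H') (f : M → M') (x₀ : M)
    (x₀' : M') (y : E) : E' := extChartAt I' x₀' (f ((extChartAt I x₀).symm y))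

variable [IsManifold I ∞ M] [IsManifold I' ∞ M']

theorem UniqueMDiffOn.chartDom {X : Set M} (hX : UniqueMDiffOn I X) (x₀ : M) :
    UniqueDiffOn ℝ (chartDom I x₀ X) := by
  have : IsManifold I 1 M := IsManifold.of_le (n := ∞) (by simp)
  exact hX.uniqueDiffOn_target_inter x₀

theorem hasMFDerivWithinAt_extChartAt_symm {x₀ : M} {y : E} (hy : y ∈ (extChartAt I x₀).target) :
    HasMFDerivWithinAt 𝓘(ℝ, E) I (extChartAt I x₀).symm (range I) y (chartSymmDeriv (E := E) I x₀ y) := by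
  have : IsManifold I 1 M := IsManifold.of_le (n := ∞) (by simp)
  exact (mdifferentiableWithinAt_extChartAt_symm hy).hasMFDerivWithinAt

/-- The chain rule for the square formed by `f` and the inverse charts. It translates between
manifold derivatives, in which `coordForm` and pullbacks are expressed, and derivatives of
coordinate maps. -/
theorem chartSymmDeriv_comp {f : M → M'} {X : Set M} (hX : UniqueMDiffOn I X) {x₀ : M} {x₀' : M'}
    {y : E} (hy : y ∈ chartDom I x₀ X)
    (hf : MDifferentiableWithinAt I I' f X ((extChartAt I x₀).symm y))
    (hs : f ((extChartAt I x₀).symm y) ∈ (extChartAt I' x₀').source) :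
    (chartSymmDeriv I' x₀' (coordMap I I' f x₀ x₀' y)).comp
        (fderivWithin ℝ (coordMap I I' f x₀ x₀') (chartDom I x₀ X) y) =
      (derivAt I I' f X ((extChartAt I x₀).symm y)).comp (chartSymmDeriv (E := E) I x₀ y) := by
  have : IsManifold I 1 M := IsManifold.of_le (n := ∞) (by simp)
  have : IsManifold I' 1 M' := IsManifold.of_le (n := ∞) (by simp)
  have hU : UniqueMDiffWithinAt 𝓘(ℝ, E) (chartDom I x₀ X) y :=
    (hX.chartDom x₀ y hy).uniqueMDiffWithinAt
  have h1 : HasMFDerivWithinAt 𝓘(ℝ, E) I (extChartAt I x₀).symm (chartDom I x₀ X) y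
      (chartSymmDeriv (E := E) I x₀ y) :=
    (hasMFDerivWithinAt_extChartAt_symm hy.1).mono (chartDom_subset_range x₀ X)
  have h2 : HasMFDerivWithinAt 𝓘(ℝ, E) I' (f ∘ (extChartAt I x₀).symm) (chartDom I x₀ X) y
      ((derivAt I I' f X ((extChartAt I x₀).symm y)).comp (chartSymmDeriv (E := E) I x₀ y)) :=
    hf.hasMFDerivWithinAt.comp y h1 fun z hz ↦ hz.2
  have h3 : MDifferentiableWithinAt 𝓘(ℝ, E) 𝓘(ℝ, E') (coordMap I I' f x₀ x₀') (chartDom I x₀ X) y :=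
    (mdifferentiableAt_extChartAt (by simpa using hs)).comp_mdifferentiableWithinAt y
      h2.mdifferentiableWithinAt
  have h4 : HasMFDerivWithinAt 𝓘(ℝ, E) 𝓘(ℝ, E') (coordMap I I' f x₀ x₀') (chartDom I x₀ X) y
      (fderivWithin (E := E) (F := E') ℝ (coordMap I I' f x₀ x₀') (chartDom I x₀ X) y) := by
    have := h3.hasMFDerivWithinAt
    rwa [mfderivWithin_eq_fderivWithin] at this
  have hr : chartDom I x₀ X ⊆ coordMap I I' f x₀ x₀' ⁻¹' range I' :=
    fun z _ ↦ mem_range_self _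
  have h5 := (hasMFDerivWithinAt_extChartAt_symm (I := I') (x₀ := x₀')
    ((extChartAt I' x₀').map_source hs)).comp y h4 hr
  have h6 : (extChartAt I' x₀').symm ∘ coordMap I I' f x₀ x₀' =ᶠ[𝓝[chartDom I x₀ X] y]
      f ∘ (extChartAt I x₀).symm := by
    have hc : ContinuousWithinAt (f ∘ (extChartAt I x₀).symm) (chartDom I x₀ X) y :=
        h2.continuousWithinAt
    filter_upwards [hc.preimage_mem_nhdsWithin
      ((isOpen_extChartAt_source x₀').mem_nhds hs)] with z hz
    exact (extChartAt I' x₀').left_inv hz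
  exact hU.eq h5 (h2.congr_of_eventuallyEq h6 ((extChartAt I' x₀').left_inv hs))

end Manifold

/-! ### Regular domains, pullbacks, and smooth families of bilinear forms. -/

section Manifold

variable {E : Type} [NormedAddCommGroup E] [NormedSpace ℝ E]
  {H : Type} [TopologicalSpace H] {I : ModelWithCorners ℝ E H}
  {M : Type*} [TopologicalSpace M] [ChartedSpace H M]
  {E' : Type} [NormedAddCommGroup E'] [NormedSpace ℝ E']
  {H' : Type} [TopologicalSpace H'] {I' : ModelWithCorners ℝ E' H'}
  {M' : Type*} [TopologicalSpace M'] [ChartedSpace H' M']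

theorem exists_isOpen_target_eq (x₀ : M) :
    ∃ W : Set E, IsOpen W ∧ (extChartAt I x₀).target = range I ∩ W :=
  ⟨I.symm ⁻¹' (chartAt H x₀).target, (chartAt H x₀).open_target.preimage I.continuous_symm, by
    rw [extChartAt_target, inter_comm]⟩

theorem exists_isOpen_chartDom_inter (x₀ : M) (X : Set M) {O : Set M} (hO : IsOpen O) :
    ∃ W : Set E, IsOpen W ∧ chartDom I x₀ (X ∩ O) = chartDom I x₀ X ∩ W := by
  obtain ⟨W, hW, h⟩ := continuousOn_iff'.1 (continuousOn_extChartAt_symm (I := I) x₀) O hO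
  refine ⟨W, hW, ?_⟩
  ext y
  have := Set.ext_iff.1 h y
  simp only [chartDom, mem_inter_iff, mem_preimage] at this ⊢
  tauto

/-- A subset of a manifold with unique derivatives which, in charts, is contained in the closure
of its interior. -/
structure RegularOn (I : ModelWithCorners ℝ E H) (X : Set M) : Prop where
  uniqueMDiffOn : UniqueMDiffOn I X
  subset_closure : ∀ x₀ : M, chartDom I x₀ X ⊆ closure (interior (chartDom I x₀ X))

omit [NormedSpace ℝ E] in
theorem subset_closure_interior_inter {S W : Set E} (hS : S ⊆ closure (interior S))
    (hW : IsOpen W) : S ∩ W ⊆ closure (interior (S ∩ W)) := by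
  rw [interior_inter, hW.interior_eq]
  exact (inter_subset_inter_left W hS).trans hW.closure_inter

theorem RegularOn.inter {X O : Set M} (hX : RegularOn I X) (hO : IsOpen O) :
    RegularOn I (X ∩ O) := by
  refine ⟨hX.1.inter hO, fun x₀ ↦ ?_⟩
  obtain ⟨W, hW, h⟩ := exists_isOpen_chartDom_inter (I := I) x₀ X hO
  rw [h]
  exact subset_closure_interior_inter (hX.2 x₀) hW

theorem IsOpen.regularOn {O : Set M} (hO : IsOpen O) : RegularOn I O := by
  have : RegularOn I (univ : Set M) := by
    refine ⟨isOpen_univ.uniqueMDiffOn, fun x₀ ↦ ?_⟩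
    obtain ⟨W, hW, h⟩ := exists_isOpen_target_eq (I := I) x₀
    rw [chartDom_univ, h]
    exact subset_closure_interior_inter I.range_subset_closure_interior hW
  simpa using this.inter hO

/-- The pullback of a field of bilinear forms along a map defined on `X`. -/
def pull (I : ModelWithCorners ℝ E H) (f : M → M') (X : Set M) (g : BilinField I' M') :
    BilinField I M := fun x ↦
  ((g.val (f x)).bilinearComp (derivAt I I' f X x) (derivAt I I' f X x) : Bil E)

theorem pull_apply (f : M → M') (X : Set M) (g : BilinField I' M') (x : M) (u v : E) :
    (pull I f X g).val x u v = g.val (f x) (derivAt I I' f X x u) (derivAt I I' f X x v) := rfl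

theorem coordForm_congr {g g' : BilinField I M} {X : Set M} (h : ∀ x ∈ X, g.val x = g'.val x)
    (x₀ : M) : EqOn (coordForm g x₀) (coordForm g' x₀) (chartDom I x₀ X) := fun y hy ↦ by
  ext u v
  rw [coordForm_apply, coordForm_apply, h _ hy.2]

/-- A family of fields of bilinear forms on `X` that is smooth, with jointly continuous
derivatives. -/
def SmoothFam {Q : Type*} [TopologicalSpace Q] (g : Q → BilinField I M) (X : Set M) : Prop :=
  ∀ (x₀ : M) (n : ℕ), FamOn n (fun q ↦ coordForm (g q) x₀) (chartDom I x₀ X)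

section Fam

variable {Q : Type*} [TopologicalSpace Q] {g : Q → BilinField I M} {X : Set M}

theorem SmoothFam.congr {g' : Q → BilinField I M} (h : SmoothFam g X)
    (hg : ∀ q, ∀ x ∈ X, (g' q).val x = (g q).val x) : SmoothFam g' X := fun x₀ n ↦
  (h x₀ n).congr fun q _ hy ↦ coordForm_congr (hg q) x₀ hy

theorem SmoothFam.reparam {Q' : Type*} [TopologicalSpace Q'] {α : Q' → Q} (h : SmoothFam g X)
    (hα : Continuous α) : SmoothFam (fun q ↦ g (α q)) X := fun x₀ n ↦ (h x₀ n).reparam hα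

theorem SmoothFam.of_locally
    (h : ∀ x ∈ X, ∃ O, IsOpen O ∧ x ∈ O ∧ SmoothFam g (X ∩ O)) : SmoothFam g X := by
  intro x₀ n
  refine FamOn.of_locally fun y hy ↦ ?_
  obtain ⟨O, hO, hyO, hs⟩ := h _ hy.2
  obtain ⟨W, hW, hWO⟩ := exists_isOpen_chartDom_inter (I := I) x₀ X hO
  have : y ∈ chartDom I x₀ (X ∩ O) := ⟨hy.1, hy.2, hyO⟩
  rw [hWO] at this
  exact ⟨W, hW, this.2, hWO ▸ hs x₀ n⟩

end Fam

theorem exists_isOpen_chartDom_preimage {f : M → M'} {X : Set M} (hf : ContinuousOn f X)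
    (x₀ : M) (x₀' : M') : ∃ W : Set E, IsOpen W ∧
      chartDom I x₀ (X ∩ f ⁻¹' (extChartAt I' x₀').source) = chartDom I x₀ X ∩ W := by
  obtain ⟨O, hO, h⟩ := continuousOn_iff'.1 hf _ (isOpen_extChartAt_source (I := I') x₀')
  rw [inter_comm, h, inter_comm]
  exact exists_isOpen_chartDom_inter x₀ X hO

theorem mapsTo_coordMap {f : M → M'} {X : Set M} {X' : Set M'} (hm : MapsTo f X X') (x₀ : M)
    (x₀' : M') : MapsTo (coordMap I I' f x₀ x₀')
      (chartDom I x₀ (X ∩ f ⁻¹' (extChartAt I' x₀').source)) (chartDom I' x₀' X') :=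
  fun _ hy ↦ extChartAt_mem_chartDom hy.2.2 (hm hy.2.1)

variable [IsManifold I ∞ M] [IsManifold I' ∞ M']

theorem ContMDiffOn.contDiffOn_coordMap {f : M → M'} {X : Set M} (hf : ContMDiffOn I I' ∞ f X)
    (x₀ : M) (x₀' : M') : ContDiffOn ℝ ∞ (coordMap I I' f x₀ x₀')
      (chartDom I x₀ (X ∩ f ⁻¹' (extChartAt I' x₀').source)) :=
  (contMDiffOn_iff.1 hf).2 x₀ x₀'

theorem coordForm_pull {f : M → M'} {X : Set M} (hX : UniqueMDiffOn I X)
    (hf : ContMDiffOn I I' ∞ f X) (g : BilinField I' M') {x₀ : M} {x₀' : M'} {y : E}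
    (hy : y ∈ chartDom I x₀ (X ∩ f ⁻¹' (extChartAt I' x₀').source)) :
    coordForm (pull I f X g) x₀ y = (coordForm g x₀' (coordMap I I' f x₀ x₀' y)).bilinearComp
      (fderivWithin ℝ (coordMap I I' f x₀ x₀')
        (chartDom I x₀ (X ∩ f ⁻¹' (extChartAt I' x₀').source)) y)
      (fderivWithin ℝ (coordMap I I' f x₀ x₀')
        (chartDom I x₀ (X ∩ f ⁻¹' (extChartAt I' x₀').source)) y) := by
  obtain ⟨W, hW, h⟩ := exists_isOpen_chartDom_preimage (I := I) (I' := I') hf.continuousOn x₀ x₀'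
  have hyW : y ∈ W := (h ▸ hy).2
  have h1 : fderivWithin ℝ (coordMap I I' f x₀ x₀')
      (chartDom I x₀ (X ∩ f ⁻¹' (extChartAt I' x₀').source)) y =
      fderivWithin ℝ (coordMap I I' f x₀ x₀') (chartDom I x₀ X) y := by
    rw [h, fderivWithin_inter (hW.mem_nhds hyW)]
  have h2 := chartSymmDeriv_comp (x₀' := x₀') hX ⟨hy.1, hy.2.1⟩
    ((hf _ hy.2.1).mdifferentiableWithinAt (by simp)) hy.2.2
  have h3 : (extChartAt I' x₀').symm (coordMap I I' f x₀ x₀' y) = f ((extChartAt I x₀).symm y) :=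
    (extChartAt I' x₀').left_inv hy.2.2
  rw [h1]
  ext u v
  rw [ContinuousLinearMap.bilinearComp_apply, coordForm_apply, coordForm_apply, pull_apply, h3]
  have h4 : ∀ w, derivAt I I' f X ((extChartAt I x₀).symm y) (chartSymmDeriv I x₀ y w) =
    chartSymmDeriv I' x₀' (coordMap I I' f x₀ x₀' y)
      (fderivWithin ℝ (coordMap I I' f x₀ x₀') (chartDom I x₀ X) y w) :=
    fun w ↦ (DFunLike.congr_fun h2 w).symm
  rw [h4, h4]

theorem FamOn.bilinearComp {Q : Type*} [TopologicalSpace Q] {n : ℕ} {T : Set E}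
    (hT : UniqueDiffOn ℝ T) {B : Q → E → Bil E'} {L : Q → E → E →L[ℝ] E'} (hB : FamOn n B T)
    (hL : FamOn n L T) :
    FamOn n (fun q y ↦ ((B q y).bilinearComp (L q y) (L q y) : Bil E)) T := by
  have h1 := FamOn.bilinear hT (ContinuousLinearMap.compL ℝ E E' (E' →L[ℝ] ℝ)) hB hL
  have h2 := h1.clm hT (ContinuousLinearMap.flipₗᵢ ℝ E E' ℝ).toContinuousLinearEquiv.toContinuousLinearMap
  have h3 := FamOn.bilinear hT (ContinuousLinearMap.compL ℝ E E' (E →L[ℝ] ℝ)) h2 hL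
  have h4 := h3.clm hT (ContinuousLinearMap.flipₗᵢ ℝ E E ℝ).toContinuousLinearEquiv.toContinuousLinearMap
  exact h4.congr fun q y _ ↦ rfl

theorem SmoothFam.pull {Q : Type*} [TopologicalSpace Q] {f : M → M'} {X : Set M} {X' : Set M'}
    {g : Q → BilinField I' M'} (hX : UniqueMDiffOn I X) (hf : ContMDiffOn I I' ∞ f X)
    (hm : MapsTo f X X') (hg : SmoothFam g X') : SmoothFam (fun q ↦ pull I f X (g q)) X := by
  intro x₀ n
  refine FamOn.of_locally fun y hy ↦ ?_
  set x₀' := f ((extChartAt I x₀).symm y)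
  obtain ⟨W, hW, h⟩ := exists_isOpen_chartDom_preimage (I := I) (I' := I') hf.continuousOn x₀ x₀'
  have hyW : y ∈ chartDom I x₀ (X ∩ f ⁻¹' (extChartAt I' x₀').source) :=
    ⟨hy.1, hy.2, mem_extChartAt_source x₀'⟩
  refine ⟨W, hW, (h ▸ hyW).2, ?_⟩
  have hT : UniqueDiffOn ℝ (chartDom I x₀ (X ∩ f ⁻¹' (extChartAt I' x₀').source)) := by
    rw [h]
    exact (hX.chartDom x₀).inter hW
  have hφ := hf.contDiffOn_coordMap x₀ x₀'
  have h1 : FamOn n (fun q y ↦ coordForm (g q) x₀' (coordMap I I' f x₀ x₀' y))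
      (chartDom I x₀ (X ∩ f ⁻¹' (extChartAt I' x₀').source)) :=
    FamOn.comp hT (hg x₀' n) (.const hT hφ) fun _ ↦ mapsTo_coordMap hm x₀ x₀'
  have h2 := h1.bilinearComp hT (.const hT (hφ.contDiffOn_fderivWithin hT))
  rw [← h]
  exact h2.congr fun q y hy ↦ coordForm_pull hX hf (g q) hy

end Manifold

/-! ### Smooth metrics in terms of coordinate expressions. -/

section Manifold

variable {E : Type} [NormedAddCommGroup E] [NormedSpace ℝ E]
  {H : Type} [TopologicalSpace H] {I : ModelWithCorners ℝ E H}
  {M : Type*} [TopologicalSpace M] [ChartedSpace H M] [IsManifold I ∞ M]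

/-- A section of the bundle of bilinear forms, as a field of bilinear forms. -/
def BilinField.mk (s : ∀ x : M, TangentSpace I x →L[ℝ] TangentSpace I x →L[ℝ] ℝ) :
    BilinField I M := s

/-- The trivialization of the tangent bundle at `x₀` is inverse to the derivative of the inverse
chart, so `coordForm` is the local expression of a section of the bundle of bilinear forms. -/
theorem trivializationAt_bilinField
    (s : ∀ x : M, TangentSpace I x →L[ℝ] TangentSpace I x →L[ℝ] ℝ) {x₀ x : M}
    (hx : x ∈ (chartAt H x₀).source) :
    (trivializationAt (E →L[ℝ] E →L[ℝ] ℝ)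
      (fun x : M ↦ TangentSpace I x →L[ℝ] TangentSpace I x →L[ℝ] ℝ) x₀ ⟨x, s x⟩).2 =
      coordForm (BilinField.mk s) x₀ (extChartAt I x₀ x) := by
  ext u v
  rw [hom_trivializationAt_apply]
  have h1 : x ∈ (trivializationAt E (fun x : M ↦ TangentSpace I x) x₀).baseSet := by simpa using hx
  have h2 := TangentBundle.symmL_trivializationAt (I := I) hx
  refine (inCoordinates_apply_eq₂ h1 h1 (mem_univ _)).trans ?_
  have h3 : (extChartAt I x₀).symm (extChartAt I x₀ x) = x :=
    (extChartAt I x₀).left_inv (by simpa using hx)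
  have h4 : ∀ w : E, (trivializationAt E (fun x : M ↦ TangentSpace I x) x₀).symm x w =
      chartSymmDeriv I x₀ (extChartAt I x₀ x) w := fun w ↦ by
    have := DFunLike.congr_fun h2 w
    rwa [Bundle.Trivialization.symmL_apply _ h1] at this
  have h5 : ∀ c : ℝ, (trivializationAt ℝ (fun _ : M ↦ ℝ) x₀).linearMapAt ℝ x c = c :=
    fun c ↦ by simp
  rw [h4, h4, coordForm_apply, h3]
  exact h5 _

theorem contMDiff_bilinField_iff
    (s : ∀ x : M, TangentSpace I x →L[ℝ] TangentSpace I x →L[ℝ] ℝ) :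
    ContMDiff I (I.prod 𝓘(ℝ, E →L[ℝ] E →L[ℝ] ℝ)) ∞
      (fun x : M ↦ Bundle.TotalSpace.mk' (E →L[ℝ] E →L[ℝ] ℝ)
        (E := fun x : M ↦ TangentSpace I x →L[ℝ] TangentSpace I x →L[ℝ] ℝ) x (s x)) ↔
      ∀ x₀ : M, ContDiffOn ℝ ∞ (coordForm (BilinField.mk s) x₀) (extChartAt I x₀).target := by
  have h1 : ∀ x₀ : M, ContMDiffOn I (I.prod 𝓘(ℝ, E →L[ℝ] E →L[ℝ] ℝ)) ∞
      (fun x : M ↦ Bundle.TotalSpace.mk' (E →L[ℝ] E →L[ℝ] ℝ)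
        (E := fun x : M ↦ TangentSpace I x →L[ℝ] TangentSpace I x →L[ℝ] ℝ) x (s x))
        (chartAt H x₀).source ↔
      ContDiffOn ℝ ∞ (coordForm (BilinField.mk s) x₀) (extChartAt I x₀).target := by
    intro x₀
    rw [Bundle.Trivialization.contMDiffOn_section_iff (trivializationAt (E →L[ℝ] E →L[ℝ] ℝ)
      (fun x : M ↦ TangentSpace I x →L[ℝ] TangentSpace I x →L[ℝ] ℝ) x₀)
      (chartAt H x₀).open_source (by simp [hom_trivializationAt_baseSet])]
    rw [contMDiffOn_congr (fun x hx ↦ trivializationAt_bilinField s hx)]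
    constructor
    · intro h
      have := h.comp (contMDiffOn_extChartAt_symm (I := I) (n := ∞) x₀) (fun y hy ↦ by
        simpa using (extChartAt I x₀).map_target hy)
      refine (contMDiffOn_iff_contDiffOn.1 this).congr fun y hy ↦ ?_
      rw [Function.comp_apply, (extChartAt I x₀).right_inv hy]
    · intro h
      exact (contMDiffOn_iff_contDiffOn.2 h).comp (contMDiffOn_extChartAt (I := I) (n := ∞))
        fun x hx ↦ (extChartAt I x₀).map_source (by simpa using hx)
  simp_rw [← h1]
  refine ⟨fun h x₀ ↦ h.contMDiffOn, fun h x ↦ (h x).contMDiffAt ?_⟩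
  exact (chartAt H x).open_source.mem_nhds (mem_chart_source H x)

variable [FiniteDimensional ℝ E]

theorem isVonNBounded_of_posDef {B : Bil E} (hB : B.PosDef) :
    Bornology.IsVonNBounded ℝ {v : E | B v v < 1} := by
  obtain ⟨c, hc, h⟩ := hB.exists_bound
  rw [NormedSpace.isVonNBounded_iff]
  refine (Metric.isBounded_closedBall (x := (0 : E)) (r := (1 + c⁻¹))).subset fun v hv ↦ ?_
  have h1 := h.self_of_nhds v
  have h2 : B v v < 1 := hv
  rw [mem_closedBall_zero_iff]
  by_contra! h3
  have h4 : c * (1 + c⁻¹) = c + 1 := by field_simp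
  have h5 : 0 < c⁻¹ := inv_pos.2 hc
  nlinarith [norm_nonneg v]

/-- This replaces the bundle formulation by conditions that can be checked in charts; boundedness of
the unit balls is automatic in finite dimension. -/
theorem isSmoothMetric_iff (g : BilinField I M) : IsSmoothMetric g ↔
    (∀ x, (g.val x).Symm) ∧ (∀ x, (g.val x).PosDef) ∧
      ∀ x₀ : M, ContDiffOn ℝ ∞ (coordForm g x₀) (extChartAt I x₀).target := by
  constructor
  · rintro ⟨G, hG⟩
    obtain rfl : BilinField.mk G.inner = g := funext hG
    exact ⟨fun x u v ↦ G.symm x u v, fun x v hv ↦ G.pos x v hv,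
      (contMDiff_bilinField_iff G.inner).1 G.contMDiff⟩
  · rintro ⟨h1, h2, h3⟩
    exact ⟨⟨g, fun x u v ↦ h1 x u v, fun x v hv ↦ h2 x v hv,
      fun x ↦ isVonNBounded_of_posDef (E := E) (h2 x), (contMDiff_bilinField_iff g).2 h3⟩, fun _ ↦ rfl⟩

end Manifold

/-! ### The `C^∞`-topology and smooth families. -/

section Manifold

variable {E : Type} [NormedAddCommGroup E] [NormedSpace ℝ E]
  {H : Type} [TopologicalSpace H] {I : ModelWithCorners ℝ E H}
  {M : Type*} [TopologicalSpace M] [ChartedSpace H M]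

theorem target_eventuallyEq_range {x₀ : M} {y : E} (hy : y ∈ (extChartAt I x₀).target) :
    (extChartAt I x₀).target =ᶠ[𝓝 y] range I := by
  obtain ⟨W, hW, h⟩ := exists_isOpen_target_eq (I := I) x₀
  rw [h] at hy ⊢
  filter_upwards [hW.mem_nhds hy.2] with z hz
  exact propext ⟨fun h ↦ h.1, fun h ↦ ⟨h, hz⟩⟩

theorem iteratedFDerivWithin_target {V : Type*} [NormedAddCommGroup V] [NormedSpace ℝ V]
    (f : E → V) (k : ℕ) {x₀ : M} {y : E} (hy : y ∈ (extChartAt I x₀).target) :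
    iteratedFDerivWithin ℝ k f (range I) y =
      iteratedFDerivWithin ℝ k f (extChartAt I x₀).target y :=
  (iteratedFDerivWithin_congr_set (target_eventuallyEq_range hy) k).symm

theorem exists_isCompact_nhdsWithin_target [FiniteDimensional ℝ E] {x₀ : M} {y : E}
    (hy : y ∈ (extChartAt I x₀).target) :
    ∃ K, IsCompact K ∧ K ⊆ (extChartAt I x₀).target ∧ K ∈ 𝓝[(extChartAt I x₀).target] y := by
  have : ProperSpace E := FiniteDimensional.proper_real E
  obtain ⟨W, hW, h⟩ := exists_isOpen_target_eq (I := I) x₀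
  have hyW : y ∈ W := (h ▸ hy).2
  obtain ⟨K, hK, hKW, hKc⟩ := local_compact_nhds (hW.mem_nhds hyW)
  refine ⟨range I ∩ K, hKc.inter_left I.isClosed_range, ?_, ?_⟩
  · rw [h]
    exact inter_subset_inter_right _ hKW
  · rw [h]
    filter_upwards [self_mem_nhdsWithin, mem_nhdsWithin_of_mem_nhds hK] with z hz hz'
    exact ⟨hz.1, hz'⟩

variable {Q : Type*} [TopologicalSpace Q] {g : Q → BilinField I M}

theorem continuous_bilinField_iff : Continuous g ↔ ∀ (x₀ : M) (k : ℕ) (K : Set E), IsCompact K →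
    K ⊆ (extChartAt I x₀).target → ∀ q₀, TendstoUniformlyOn
      (fun q ↦ iteratedFDerivWithin ℝ k (coordForm (g q) x₀) (range I))
      (iteratedFDerivWithin ℝ k (coordForm (g q₀) x₀) (range I)) (𝓝 q₀) K := by
  rw [continuous_iInf_rng]
  refine forall_congr' fun x₀ ↦ ?_
  rw [continuous_iInf_rng]
  refine forall_congr' fun k ↦ ?_
  rw [continuous_induced_rng, continuous_iff_continuousAt]
  simp only [ContinuousAt, UniformOnFun.tendsto_iff_tendstoUniformlyOn]
  exact ⟨fun h K hK hK' q₀ ↦ h q₀ K ⟨hK, hK'⟩, fun h q₀ K hK ↦ h K hK.1 hK.2 q₀⟩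

theorem SmoothFam.continuous [IsManifold I ∞ M] (h : SmoothFam g univ) : Continuous g := by
  refine continuous_bilinField_iff.2 fun x₀ k K hK hKt q₀ ↦ ?_
  have hT : UniqueDiffOn ℝ (chartDom I x₀ univ) := isOpen_univ.regularOn.1.chartDom x₀
  have hc := (h x₀ k).continuousOn_iteratedFDerivWithin hT
  rw [chartDom_univ] at hc
  refine TendstoUniformlyOn.congr (F := fun q ↦ iteratedFDerivWithin ℝ k (coordForm (g q) x₀)
      (extChartAt I x₀).target) ?_
    (.of_forall fun q y hy ↦ (iteratedFDerivWithin_target _ k (hKt hy)).symm)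
  refine TendstoUniformlyOn.congr_right (f := iteratedFDerivWithin ℝ k (coordForm (g q₀) x₀)
      (extChartAt I x₀).target) ?_ fun y hy ↦ (iteratedFDerivWithin_target _ k (hKt hy)).symm
  rw [Metric.tendstoUniformlyOn_iff]
  intro ε hε
  -- The repeated membership makes the claim at a nearby point conditional on that point lying in
  -- `K`, so continuity within the chart target is enough.
  suffices h' : ∀ᶠ q in 𝓝 q₀, ∀ y ∈ K, y ∈ K → dist (iteratedFDerivWithin ℝ k (coordForm (g q₀) x₀)
      (extChartAt I x₀).target y) (iteratedFDerivWithin ℝ k (coordForm (g q) x₀)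
      (extChartAt I x₀).target y) < ε from h'.mono fun q hq y hy ↦ hq y hy hy
  refine hK.eventually_forall_of_forall_eventually fun y hy ↦ ?_
  have h1 := hc (q₀, y) ⟨mem_univ _, hKt hy⟩
  have h2 : ContinuousWithinAt (fun p : Q × E ↦ iteratedFDerivWithin ℝ k (coordForm (g q₀) x₀)
      (extChartAt I x₀).target p.2) (univ ×ˢ (extChartAt I x₀).target) (q₀, y) :=
    (hc.comp (f := fun p : Q × E ↦ (q₀, p.2)) (by fun_prop) fun p hp ↦ ⟨mem_univ _, hp.2⟩)
      (q₀, y) ⟨mem_univ _, hKt hy⟩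
  have h3 := (h2.dist h1).eventually_lt_const (u := ε) (by simpa using hε)
  filter_upwards [eventually_nhdsWithin_iff.1 h3] with z hz hzK
  exact hz ⟨mem_univ _, hKt hzK⟩

/-- Uniform convergence on a compact neighbourhood in the chart target, combined with continuity of
the derivatives of the single form at `q₀`, gives joint continuity. With `SmoothFam.continuous`,
continuous families of smooth forms are exactly smooth families in the sense above. -/
theorem SmoothFam.of_continuous [IsManifold I ∞ M] [FiniteDimensional ℝ E] (h : Continuous g)
    (hg : ∀ q, ∀ x₀ : M, ContDiffOn ℝ ∞ (coordForm (g q) x₀) (extChartAt I x₀).target) :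
    SmoothFam g univ := by
  intro x₀ n
  rw [chartDom_univ]
  have hT : UniqueDiffOn ℝ (extChartAt I x₀).target := by
    rw [← chartDom_univ]
    exact isOpen_univ.regularOn.1.chartDom x₀
  refine .of_continuousOn_iteratedFDerivWithin hT (hg · x₀) fun k _ ↦ ?_
  rintro ⟨q₀, y₀⟩ ⟨-, hy₀⟩
  obtain ⟨K, hK, hKt, hKy⟩ := exists_isCompact_nhdsWithin_target hy₀
  have h1 := continuous_bilinField_iff.1 h x₀ k K hK hKt q₀
  have h2 : ContinuousOn (iteratedFDerivWithin ℝ k (coordForm (g q₀) x₀)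
      (extChartAt I x₀).target) (extChartAt I x₀).target :=
    (hg q₀ x₀).continuousOn_iteratedFDerivWithin (by exact_mod_cast le_top) hT
  rw [Metric.continuousWithinAt_iff']
  intro ε hε
  have h3 := Metric.continuousWithinAt_iff'.1 (h2 y₀ hy₀) (ε / 2) (half_pos hε)
  have h4 := Metric.tendstoUniformlyOn_iff.1 h1 (ε / 2) (half_pos hε)
  rw [nhdsWithin_prod_eq, nhdsWithin_univ]
  filter_upwards [h4.prod_mk (h3.and (Filter.Eventually.and hKy self_mem_nhdsWithin))]
    with ⟨q, y⟩ ⟨h5, h6, h7, h8⟩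
  have h9 := h5 y h7
  rw [iteratedFDerivWithin_target _ k h8, iteratedFDerivWithin_target _ k h8, dist_comm] at h9
  exact (dist_triangle _ _ _).trans_lt (by simpa using add_lt_add h9 h6)

end Manifold

/-! ### The curvature condition at a point of a manifold, and its naturality. -/

section Manifold

variable {E : Type} [NormedAddCommGroup E] [NormedSpace ℝ E]
  {H : Type} [TopologicalSpace H] {I : ModelWithCorners ℝ E H}
  {M : Type*} [TopologicalSpace M] [ChartedSpace H M]
  {E' : Type} [NormedAddCommGroup E'] [NormedSpace ℝ E']
  {H' : Type} [TopologicalSpace H'] {I' : ModelWithCorners ℝ E' H'}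
  {M' : Type*} [TopologicalSpace M'] [ChartedSpace H' M']

/-- A smooth field of symmetric bilinear forms on `X`. -/
structure SmoothOn (g : BilinField I M) (X : Set M) : Prop where
  contDiffOn : ∀ x₀ : M, ContDiffOn ℝ ∞ (coordForm g x₀) (chartDom I x₀ X)
  symm : ∀ x ∈ X, (g.val x).Symm

variable [IsManifold I ∞ M] [IsManifold I' ∞ M']

theorem SmoothFam.contDiffOn {Q : Type*} [TopologicalSpace Q] {g : Q → BilinField I M} {X : Set M}
    (h : SmoothFam g X) (hX : UniqueMDiffOn I X) (q : Q) (x₀ : M) :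
    ContDiffOn ℝ ∞ (coordForm (g q) x₀) (chartDom I x₀ X) :=
  FamOn.contDiffOn (hX.chartDom x₀) (h x₀) q

theorem SmoothOn.smoothFam (Q : Type*) [TopologicalSpace Q] {g : BilinField I M} {X : Set M}
    (hg : SmoothOn g X) (hX : UniqueMDiffOn I X) : SmoothFam (fun _ : Q ↦ g) X := fun x₀ _ ↦
  .const (hX.chartDom x₀) (hg.1 x₀)

theorem SmoothOn.pull {f : M → M'} {X : Set M} {X' : Set M'} {g : BilinField I' M'}
    (hX : UniqueMDiffOn I X) (hX' : UniqueMDiffOn I' X') (hf : ContMDiffOn I I' ∞ f X)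
    (hm : MapsTo f X X') (hg : SmoothOn g X') : SmoothOn (pull I f X g) X :=
  ⟨((hg.smoothFam Unit hX').pull hX hf hm).contDiffOn hX (),
    fun _ hx _ _ ↦ hg.2 _ (hm hx) _ _⟩

theorem chartSymmDeriv_bijective {x₀ : M} {y : E} (hy : y ∈ (extChartAt I x₀).target) :
    Function.Bijective (chartSymmDeriv I x₀ y) := by
  have : IsManifold I 1 M := IsManifold.of_le (n := ∞) (by simp)
  obtain ⟨e, he⟩ := isInvertible_mfderivWithin_extChartAt_symm (I := I) hy
  have : ∀ u, chartSymmDeriv I x₀ y u = e u := fun u ↦ (DFunLike.congr_fun he u).symm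
  exact ⟨fun u v h ↦ e.injective (by rw [← this, ← this, h]),
    fun w ↦ ⟨e.symm w, (this _).trans (e.apply_symm_apply w)⟩⟩

omit [IsManifold I ∞ M] in
theorem coordForm_symm {g : BilinField I M} {x₀ : M} {y : E}
    (hg : (g.val ((extChartAt I x₀).symm y)).Symm) : Bil.Symm (coordForm g x₀ y) :=
  fun _ _ ↦ hg _ _

theorem coordForm_posDef_iff {g : BilinField I M} {x₀ : M} {y : E}
    (hy : y ∈ (extChartAt I x₀).target) :
    Bil.PosDef (coordForm g x₀ y) ↔ (g.val ((extChartAt I x₀).symm y)).PosDef := by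
  have hb := chartSymmDeriv_bijective (I := I) hy
  constructor
  · intro h v hv
    obtain ⟨u, rfl⟩ := hb.2 v
    exact h u fun h0 ↦ hv (by rw [h0, map_zero])
  · intro h u hu
    exact h _ fun h0 ↦ hu (hb.1 (h0.trans (map_zero _).symm))

theorem fderivWithin_coordMap_bijective {f : M → M'} {X : Set M} (hX : UniqueMDiffOn I X)
    (hf : ContMDiffOn I I' ∞ f X) {x₀ : M} {x₀' : M'} {y : E}
    (hy : y ∈ chartDom I x₀ (X ∩ f ⁻¹' (extChartAt I' x₀').source))
    (hb : Function.Bijective (derivAt I I' f X ((extChartAt I x₀).symm y))) :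
    Function.Bijective (fderivWithin ℝ (coordMap I I' f x₀ x₀') (chartDom I x₀ X) y) := by
  have h2 := chartSymmDeriv_comp (x₀' := x₀') hX ⟨hy.1, hy.2.1⟩
    ((hf _ hy.2.1).mdifferentiableWithinAt (by simp)) hy.2.2
  have h3 : Function.Bijective (chartSymmDeriv I' x₀' (coordMap I I' f x₀ x₀' y)) :=
    chartSymmDeriv_bijective ((extChartAt I' x₀').map_source hy.2.2)
  have h4 := congrArg DFunLike.coe h2
  rw [ContinuousLinearMap.coe_comp, ContinuousLinearMap.coe_comp] at h4
  exact (Function.Bijective.of_comp_iff' h3 _).1 (h4 ▸ hb.comp (chartSymmDeriv_bijective hy.1))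

/-- The curvature condition `C` for `g` on `X` at the point `x`, in the chart at `x₀`. -/
def PosIn (C : CurvCond) (g : BilinField I M) (X : Set M) (x₀ x : M) : Prop :=
  C.At (coordForm g x₀) (chartDom I x₀ X) (extChartAt I x₀ x)

/-- The curvature condition `C` for `g` on `X` at the point `x`. -/
def PosAt (C : CurvCond) (g : BilinField I M) (X : Set M) (x : M) : Prop := PosIn C g X x x

variable {C : CurvCond} {g g' : BilinField I M} {X : Set M} {x₀ x : M}

omit [IsManifold I ∞ M] in
theorem posIn_congr (hx : x ∈ (extChartAt I x₀).source) (hX : x ∈ X)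
    (h : ∀ x ∈ X, g.val x = g'.val x) : PosIn C g X x₀ x ↔ PosIn C g' X x₀ x :=
  C.at_congr (extChartAt_mem_chartDom hx hX) (coordForm_congr h x₀)

omit [IsManifold I ∞ M] in
theorem posIn_inter {O : Set M} (hO : IsOpen O) (hx : x ∈ (extChartAt I x₀).source)
    (hxO : x ∈ O) (hX : x ∈ X) : PosIn C g (X ∩ O) x₀ x ↔ PosIn C g X x₀ x := by
  obtain ⟨W, hW, hWO⟩ := exists_isOpen_chartDom_inter (I := I) x₀ X hO
  refine C.at_congr_set ?_
  have h1 : extChartAt I x₀ x ∈ W := by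
    have : extChartAt I x₀ x ∈ chartDom I x₀ (X ∩ O) := extChartAt_mem_chartDom hx ⟨hX, hxO⟩
    exact (hWO ▸ this).2
  rw [hWO]
  filter_upwards [hW.mem_nhds h1] with z hz
  exact propext ⟨fun h ↦ h.1, fun h ↦ ⟨h, hz⟩⟩

theorem PosIn.posDef (hx : x ∈ (extChartAt I x₀).source) (h : PosIn C g X x₀ x) :
    (g.val x).PosDef := by
  have := (coordForm_posDef_iff ((extChartAt I x₀).map_source hx)).1 h.1
  rwa [(extChartAt I x₀).left_inv hx] at this

variable [FiniteDimensional ℝ E] [FiniteDimensional ℝ E']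

/-- Curvature is natural, by `CurvCond.at_pullback`, which needs positive definiteness on whole
domains. Each side of the equivalence contains it at the point in question, and it then holds on
neighbourhoods, to which both domains are shrunk. -/
theorem posIn_pull {f : M → M'} {X' : Set M'} {g : BilinField I' M'} (hX : RegularOn I X)
    (hX' : UniqueMDiffOn I' X') (hf : ContMDiffOn I I' ∞ f X) (hm : MapsTo f X X')
    (hg : SmoothOn g X') (hb : ∀ z ∈ X, Function.Bijective (derivAt I I' f X z)) (hxX : x ∈ X)
    (hx : x ∈ (extChartAt I x₀).source) {x₀' : M'} (hx' : f x ∈ (extChartAt I' x₀').source) :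
    PosIn C (pull I f X g) X x₀ x ↔ PosIn C g X' x₀' (f x) := by
  set φ := coordMap I I' f x₀ x₀' with hφ
  set S₀ := chartDom I x₀ (X ∩ f ⁻¹' (extChartAt I' x₀').source) with hS₀
  set y := extChartAt I x₀ x with hy
  have hyx : (extChartAt I x₀).symm y = x := (extChartAt I x₀).left_inv hx
  have hyS₀ : y ∈ S₀ := extChartAt_mem_chartDom hx ⟨hxX, hx'⟩
  have hφy : φ y = extChartAt I' x₀' (f x) := by rw [hφ, coordMap, hyx]
  obtain ⟨W, hW, hWS⟩ := exists_isOpen_chartDom_preimage (I := I) (I' := I') hf.continuousOn x₀ x₀'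
  have hS₀W : S₀ = chartDom I x₀ X ∩ W := hWS
  have hc : ContDiffOn ℝ ∞ φ S₀ := hf.contDiffOn_coordMap x₀ x₀'
  have hmaps : MapsTo φ S₀ (chartDom I' x₀' X') := mapsTo_coordMap hm x₀ x₀'
  have hpull : ∀ z ∈ S₀, ∀ u v, coordForm (pull I f X g) x₀ z u v =
      coordForm g x₀' (φ z) (fderivWithin ℝ φ S₀ z u) (fderivWithin ℝ φ S₀ z v) :=
    fun z hz u v ↦ by rw [coordForm_pull hX.1 hf g hz]; rfl
  have hbij : ∀ z ∈ S₀, Function.Bijective (fderivWithin ℝ φ S₀ z) := fun z hz ↦ by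
    have := fderivWithin_coordMap_bijective hX.1 hf hz (hb _ hz.2.1)
    rwa [hS₀W, fderivWithin_inter (hW.mem_nhds (hS₀W ▸ hz).2)]
  have hpd : ∀ z ∈ S₀, Bil.PosDef (coordForm (pull I f X g) x₀ z) ↔
      Bil.PosDef (coordForm g x₀' (φ z)) := by
    intro z hz
    constructor
    · intro h v hv
      obtain ⟨u, rfl⟩ := (hbij z hz).2 v
      rw [← hpull z hz]
      exact h u fun h0 ↦ hv (by rw [h0, map_zero])
    · intro h u hu
      rw [hpull z hz]
      exact h _ fun h0 ↦ hu ((hbij z hz).1 (h0.trans (map_zero _).symm))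
  suffices key : Bil.PosDef (coordForm g x₀' (φ y)) →
      (PosIn C (pull I f X g) X x₀ x ↔ PosIn C g X' x₀' (f x)) from
    ⟨fun h ↦ (key ((hpd y hyS₀).1 h.1)).1 h, fun h ↦ (key (hφy ▸ h.1)).2 h⟩
  intro hpos
  have hT' := hX'.chartDom x₀'
  have hev := ((hg.1 x₀').continuousOn _ (hmaps hyS₀)).eventually hpos.eventually
  obtain ⟨O', hO', hyO', hO'S⟩ := mem_nhdsWithin.1 hev
  obtain ⟨W₂, hW₂, hW₂S⟩ := continuousOn_iff'.1 hc.continuousOn O' hO'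
  have hyW₂ : y ∈ S₀ ∩ W₂ := by
    rw [inter_comm, ← hW₂S]
    exact ⟨hyO', hyS₀⟩
  have hmO : ∀ z ∈ S₀ ∩ W₂, φ z ∈ O' := fun z hz ↦ by
    rw [inter_comm, ← hW₂S] at hz
    exact hz.1
  have hSW : S₀ ∩ W₂ = chartDom I x₀ X ∩ (W ∩ W₂) := by rw [hS₀W, inter_assoc]
  have hfd : ∀ z ∈ S₀ ∩ W₂, fderivWithin ℝ φ (S₀ ∩ W₂) z = fderivWithin ℝ φ S₀ z :=
    fun z hz ↦ fderivWithin_inter (hW₂.mem_nhds hz.2)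
  have h : IsCoordPullback φ (coordForm (pull I f X g) x₀) (S₀ ∩ W₂) (coordForm g x₀')
      (chartDom I' x₀' X' ∩ O') :=
    { uniqueDiffOn := by
        rw [hSW]
        exact (hX.1.chartDom x₀).inter (hW.inter hW₂)
      subset_closure := by
        rw [hSW]
        exact subset_closure_interior_inter (hX.2 x₀) (hW.inter hW₂)
      uniqueDiffOn' := hT'.inter hO'
      contDiffOn := hc.mono inter_subset_left
      mapsTo := fun z hz ↦ ⟨hmaps hz.1, hmO z hz⟩
      contDiffOn_form := ((hg.pull hX.1 hX' hf hm).1 x₀).mono (by rw [hSW]; exact inter_subset_left)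
      contDiffOn_form' := (hg.1 x₀').mono inter_subset_left
      symm' := fun z hz ↦ coordForm_symm (hg.2 _ hz.1.2)
      posDef := fun z hz ↦ (hpd z hz.1).2 (hO'S ⟨hmO z hz, hmaps hz.1⟩)
      posDef' := fun z hz ↦ hO'S hz.symm
      surjective := fun z hz ↦ by
        rw [hfd z hz]
        exact (hbij z hz.1).2
      eq_pullback := fun z hz u v ↦ by
        rw [hfd z hz]
        exact hpull z hz.1 u v }
  have h1 := C.at_pullback h hyW₂
  have h2 : chartDom I x₀ X =ᶠ[𝓝 y] (S₀ ∩ W₂ : Set E) := by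
    have : y ∈ W ∩ W₂ := (hSW ▸ hyW₂).2
    rw [hSW]
    filter_upwards [(hW.inter hW₂).mem_nhds this] with z hz
    exact propext ⟨fun h ↦ ⟨h, hz⟩, fun h ↦ h.1⟩
  have h3 : (chartDom I' x₀' X' ∩ O' : Set E') =ᶠ[𝓝 (φ y)] chartDom I' x₀' X' := by
    filter_upwards [hO'.mem_nhds hyO'] with z hz
    exact propext ⟨fun h ↦ h.1, fun h ↦ ⟨h, hz⟩⟩
  rw [PosIn, PosIn, C.at_congr_set h2, h1, C.at_congr_set h3, hφy]

end Manifold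

/-! ### Independence of the chart, locality and openness. -/

section Manifold

variable {E : Type} [NormedAddCommGroup E] [NormedSpace ℝ E]
  {H : Type} [TopologicalSpace H] {I : ModelWithCorners ℝ E H}
  {M : Type*} [TopologicalSpace M] [ChartedSpace H M]
  {E' : Type} [NormedAddCommGroup E'] [NormedSpace ℝ E']
  {H' : Type} [TopologicalSpace H'] {I' : ModelWithCorners ℝ E' H'}
  {M' : Type*} [TopologicalSpace M'] [ChartedSpace H' M']

theorem derivAt_id {X : Set M} (hX : UniqueMDiffOn I X) {x : M} (hx : x ∈ X) :
    derivAt I I id X x = ContinuousLinearMap.id ℝ E := mfderivWithin_id (hX x hx)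

theorem pull_id_val (g : BilinField I M) {X : Set M} (hX : UniqueMDiffOn I X) {x : M}
    (hx : x ∈ X) : (pull I id X g).val x = g.val x := by
  ext u v
  rw [pull_apply, derivAt_id hX hx]
  rfl

/-- `f` is a smooth map from `X` to `X'` with invertible derivatives. -/
structure LocalDiffeoOn (I : ModelWithCorners ℝ E H) (I' : ModelWithCorners ℝ E' H') (f : M → M')
    (X : Set M) (X' : Set M') : Prop where
  contMDiffOn : ContMDiffOn I I' ∞ f X
  mapsTo : MapsTo f X X'
  bijective : ∀ z ∈ X, Function.Bijective (derivAt I I' f X z)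

variable [IsManifold I ∞ M] [IsManifold I' ∞ M'] [FiniteDimensional ℝ E] [FiniteDimensional ℝ E']
  {C : CurvCond} {X : Set M} {x₀ x : M}

/-- A change of charts is a pullback along the identity, read in two different charts of the source.
-/
theorem posIn_iff_posAt {g : BilinField I M} (hX : RegularOn I X) (hg : SmoothOn g X) (hxX : x ∈ X)
    (hx : x ∈ (extChartAt I x₀).source) : PosIn C g X x₀ x ↔ PosAt C g X x := by
  have hs := mem_extChartAt_source (I := I) x
  have h1 : ∀ x₁ : M, x ∈ (extChartAt I x₁).source →
      (PosIn C (pull I id X g) X x₁ x ↔ PosIn C g X x x) := fun x₁ h ↦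
    posIn_pull (f := id) hX hX.1 contMDiffOn_id (fun _ h ↦ h) hg
      (fun z hz ↦ by rw [derivAt_id hX.1 hz]; exact Function.bijective_id) hxX h hs
  rw [PosAt, ← h1 x₀ hx]
  exact posIn_congr hx hxX fun z hz ↦ (pull_id_val g hX.1 hz).symm

theorem LocalDiffeoOn.posAt_iff {f : M → M'} {X' : Set M'} (hf : LocalDiffeoOn I I' f X X')
    {g : BilinField I M} {g' : BilinField I' M'} (hX : RegularOn I X) (hX' : UniqueMDiffOn I' X')
    (hg' : SmoothOn g' X') (h : ∀ z ∈ X, g.val z = (pull I f X g').val z) (hx : x ∈ X) :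
    PosAt C g X x ↔ PosAt C g' X' (f x) :=
  (posIn_congr (mem_extChartAt_source x) hx h).trans
    (posIn_pull hX hX' hf.1 hf.2 hg' hf.3 hx (mem_extChartAt_source x) (mem_extChartAt_source _))

theorem posAt_inter {g : BilinField I M} {O : Set M} (hO : IsOpen O) (hxO : x ∈ O) (hX : x ∈ X) :
    PosAt C g (X ∩ O) x ↔ PosAt C g X x :=
  posIn_inter hO (mem_extChartAt_source x) hxO hX

theorem posAt_congr {g g' : BilinField I M} (hX : x ∈ X)
    (h : ∀ x ∈ X, g.val x = g'.val x) : PosAt C g X x ↔ PosAt C g' X x :=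
  posIn_congr (mem_extChartAt_source x) hX h

/-- Locality of the curvature condition. -/
theorem posAt_congr_of_isOpen {g g' : BilinField I M} {O : Set M} (hO : IsOpen O) (hxO : x ∈ O)
    (hX : x ∈ X) (h : ∀ x ∈ X ∩ O, g.val x = g'.val x) : PosAt C g X x ↔ PosAt C g' X x := by
  exact (posAt_inter hO hxO hX).symm.trans
    ((posAt_congr (X := X ∩ O) ⟨hX, hxO⟩ h).trans (posAt_inter hO hxO hX))

variable {Q : Type*} [TopologicalSpace Q] {g : Q → BilinField I M}

theorem SmoothFam.smoothOn (h : SmoothFam g X) (hX : UniqueMDiffOn I X)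
    (hs : ∀ q, ∀ x ∈ X, ((g q).val x).Symm) (q : Q) : SmoothOn (g q) X :=
  ⟨h.contDiffOn hX q, hs q⟩

theorem FamOn.continuousOn_jetAt {T : Set E} {F : Q → E → Bil E} (h : FamOn 2 F T) :
    ContinuousOn (fun p : Q × E ↦ jetAt (F p.1) T p.2) (univ ×ˢ T) :=
  h.1.prodMk (h.2.2.1.prodMk h.2.2.2.2)

/-- The curvature condition is open. -/
theorem SmoothFam.eventually_posAt (h : SmoothFam g X) (hX : RegularOn I X)
    (hs : ∀ q, ∀ x ∈ X, ((g q).val x).Symm) {q₀ : Q} (hx : x ∈ X) (hpos : PosAt C (g q₀) X x) :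
    ∀ᶠ p : Q × M in 𝓝 (q₀, x), p.2 ∈ X → PosAt C (g p.1) X p.2 := by
  have hxs := mem_extChartAt_source (I := I) x
  -- All nearby points are treated in the one chart at `x`, where the 2-jets depend continuously on
  -- parameter and point; independence of the chart is used only at the end.
  have hc := (h x 2).continuousOn_jetAt (q₀, extChartAt I x x)
    ⟨mem_univ _, extChartAt_mem_chartDom hxs hx⟩
  have hev : ∀ᶠ J in 𝓝 (jetAt (coordForm (g q₀) x) (chartDom I x X) (extChartAt I x x)),
      J.1.PosDef ∧ C.Holds E J.1 J.riem :=
    (continuousAt_fst.eventually hpos.1.eventually).and (C.eventually hpos.1 hpos.2)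
  have h1 := eventually_nhdsWithin_iff.1 (hc.eventually hev)
  have h2 : ContinuousAt (fun p : Q × M ↦ (p.1, extChartAt I x p.2)) (q₀, x) :=
    continuousAt_fst.prodMk ((continuousAt_extChartAt (I := I) x).comp continuousAt_snd)
  have h3 : ∀ᶠ p : Q × M in 𝓝 (q₀, x), p.2 ∈ (extChartAt I x).source :=
    continuousAt_snd.eventually ((isOpen_extChartAt_source x).mem_nhds hxs)
  filter_upwards [h2.eventually h1, h3] with p hp hps hpX
  exact (posIn_iff_posAt hX (h.smoothOn hX.1 hs p.1) hpX hps).1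
    (hp ⟨mem_univ _, extChartAt_mem_chartDom hps hpX⟩)

theorem SmoothFam.eventually_forall_posAt (h : SmoothFam g X) (hX : RegularOn I X)
    (hs : ∀ q, ∀ x ∈ X, ((g q).val x).Symm) {q₀ : Q} {K : Set M} (hK : IsCompact K) (hKX : K ⊆ X)
    (hpos : ∀ x ∈ K, PosAt C (g q₀) X x) : ∀ᶠ q in 𝓝 q₀, ∀ x ∈ K, PosAt C (g q) X x := by
  have := hK.eventually_forall_of_forall_eventually (x₀ := q₀)
    (P := fun q x ↦ x ∈ X → PosAt C (g q) X x)
    fun x hx ↦ h.eventually_posAt hX hs (hKX hx) (hpos x hx)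
  exact this.mono fun q hq x hx ↦ hq x hx (hKX hx)

end Manifold

/-! ### Comparison with positive `p`-curvature and `(d - k)`-positive Ricci curvature as defined in
the statement. -/

theorem Orthon.finrank_perp {E : Type*} [NormedAddCommGroup E] [NormedSpace ℝ E]
    [FiniteDimensional ℝ E] {B : Bil E} {n p : ℕ} {e : Fin n → E} (he : Orthon B e)
    (hn : n + p = finrank ℝ E) :
    ∃ P : Submodule ℝ E, finrank ℝ P = p ∧ ∀ v ∈ P, ∀ i, B v (e i) = 0 := by
  -- The plane is the kernel of `L`; orthonormality makes `L` onto, so rank-nullity gives the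
  -- dimension.
  let L : E →ₗ[ℝ] (Fin n → ℝ) := LinearMap.pi fun i ↦ (B.flip (e i) : E →ₗ[ℝ] ℝ)
  have hL : ∀ v i, L v i = B v (e i) := fun _ _ ↦ rfl
  have hsurj : Function.Surjective L := by
    intro c
    refine ⟨∑ j, c j • e j, ?_⟩
    ext i
    simp [hL, he _ i]
  refine ⟨LinearMap.ker L, ?_, fun v hv i ↦ by rw [← hL, LinearMap.mem_ker.1 hv, Pi.zero_apply]⟩
  have h1 := L.finrank_range_add_finrank_ker
  rw [LinearMap.range_eq_top.2 hsurj, finrank_top, finrank_fin_fun] at h1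
  omega

section Manifold

variable {E : Type} [NormedAddCommGroup E] [NormedSpace ℝ E] [FiniteDimensional ℝ E]
  {H : Type} [TopologicalSpace H] {I : ModelWithCorners ℝ E H}
  {M : Type*} [TopologicalSpace M] [ChartedSpace H M] [IsManifold I ∞ M]

theorem chartSymmDeriv_self (x : M) :
    chartSymmDeriv I x (extChartAt I x x) = ContinuousLinearMap.id ℝ E := by
  have : IsManifold I 1 M := IsManifold.of_le (n := ∞) (by simp)
  exact mfderivWithin_range_extChartAt_symm

theorem coordForm_self (g : BilinField I M) (x : M) :
    coordForm g x (extChartAt I x x) = g.val x := by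
  ext u v
  rw [coordForm_apply, chartSymmDeriv_self, extChartAt_to_inv]
  rfl

/-- The curvature condition `C` at all points. -/
def PosOn (C : CurvCond) (g : BilinField I M) : Prop := ∀ x, PosAt C g univ x

theorem IsSmoothMetric.smoothOn {g : BilinField I M} (hg : IsSmoothMetric g) :
    SmoothOn g univ := by
  obtain ⟨h1, -, h3⟩ := (isSmoothMetric_iff g).1 hg
  exact ⟨fun x₀ ↦ by rw [chartDom_univ]; exact h3 x₀, fun x _ ↦ h1 x⟩

theorem SmoothOn.isSmoothMetric {g : BilinField I M} (hg : SmoothOn g univ)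
    (h : ∀ x, (g.val x).PosDef) : IsSmoothMetric g :=
  (isSmoothMetric_iff g).2 ⟨fun x ↦ hg.2 x (mem_univ x), h, fun x₀ ↦ chartDom_univ (I := I) x₀ ▸ hg.1 x₀⟩

theorem IsSmoothMetric.posDef {g : BilinField I M} (hg : IsSmoothMetric g) (x : M) :
    (g.val x).PosDef := ((isSmoothMetric_iff g).1 hg).2.1 x

theorem IsSmoothMetric.coordRiemann_eq {g : BilinField I M} (hg : IsSmoothMetric g) (x : M)
    (u v w : E) : coordRiemann (coordForm g x) (range I) (extChartAt I x x) u v w =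
      (jetAt (coordForm g x) (chartDom I x univ) (extChartAt I x x)).riem u v w := by
  have h1 := target_eventuallyEq_range (I := I) (mem_extChartAt_target (I := I) x)
  rw [← chartDom_univ] at h1
  rw [← coordRiemann_congr_set h1]
  exact coordRiemann_eq_riem (isOpen_univ.regularOn.1.chartDom x) (hg.smoothOn.1 x)
    (fun y hy ↦ (coordForm_posDef_iff hy.1).2 (hg.posDef _))
    (extChartAt_mem_chartDom (mem_extChartAt_source x) (mem_univ x)) u v w

/-- The `p`-planes can be dropped because every orthonormal frame of `d - p` vectors has an
orthogonal `p`-plane, and the diagonal convention is automatic since `R u u = 0`. A point is needed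
because the dimension bound is global on the left and pointwise on the right. -/
theorem posPCurv_iff [Nonempty M] {p : ℕ} {g : BilinField I M} (hg : IsSmoothMetric g) :
    PosPCurv p g ↔ PosOn (CurvCond.posSec p) g := by
  have key : ∀ x : M, ∀ n, ∀ e : Fin n → E,
      (∑ i, ∑ j, if i = j then 0 else sectional g x (e i) (e j)) =
      secSum (g.val x) (jetAt (coordForm g x) (chartDom I x univ) (extChartAt I x x)).riem e := by
    intro x n e
    refine Finset.sum_congr rfl fun i _ ↦ Finset.sum_congr rfl fun j _ ↦ ?_
    rw [← hg.coordRiemann_eq]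
    split_ifs with hij
    · have h0 : coordRiemann (coordForm g x) (range I) (extChartAt I x x) (e i) (e i) (e i) = 0 := by
        simp [coordRiemann]
      rw [← hij, h0, map_zero]
      rfl
    · rfl
  constructor
  · rintro ⟨h1, h2⟩ x
    refine ⟨(coordForm_self g x).symm ▸ hg.posDef x, h1, fun n hn e he ↦ ?_⟩
    rw [coordForm_self] at he ⊢
    obtain ⟨P, hP, hPe⟩ := he.finrank_perp hn
    obtain rfl : n = finrank ℝ E - p := by omega
    rw [← key]
    exact h2 x P hP e he hPe
  · intro h
    obtain ⟨x₀⟩ := ‹Nonempty M›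
    refine ⟨(h x₀).2.1, fun x P _ e he _ ↦ ?_⟩
    have h3 : p + 2 ≤ finrank ℝ E := (h x).2.1
    have h4 := (h x).2.2 (finrank ℝ E - p) (by omega) e
    rw [coordForm_self] at h4
    exact (h4 he).trans_eq (key x _ e).symm

theorem posCoRic_iff [Nonempty M] {k : ℕ} {g : BilinField I M} (hg : IsSmoothMetric g) :
    PosCoRic k g ↔ PosOn (CurvCond.posRicci k) g := by
  have key : ∀ x : M, ∀ n, ∀ e : Fin n → E, (∑ i, ricci g x (e i) (e i)) =
      ricSum (jetAt (coordForm g x) (chartDom I x univ) (extChartAt I x x)).riem e := by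
    intro x n e
    refine Finset.sum_congr rfl fun i _ ↦ ?_
    change LinearMap.trace ℝ E _ = LinearMap.trace ℝ E _
    congr 1
    ext z
    exact hg.coordRiemann_eq x _ _ _
  constructor
  · rintro ⟨h1, h2⟩ x
    refine ⟨(coordForm_self g x).symm ▸ hg.posDef x, h1, fun n hn e he ↦ ?_⟩
    rw [coordForm_self] at he
    obtain rfl : n = finrank ℝ E - k := by omega
    rw [← key]
    exact h2 x e he
  · intro h
    obtain ⟨x₀⟩ := ‹Nonempty M›
    refine ⟨(h x₀).2.1, fun x e he ↦ ?_⟩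
    have h3 : max 2 (k + 1) ≤ finrank ℝ E := (h x).2.1
    have h4 := (h x).2.2 (finrank ℝ E - k) (by omega) e
    rw [coordForm_self] at h4
    exact (h4 he).trans_eq (key x _ e).symm

end Manifold

/-! ### Algebra and products of smooth families. -/

section Manifold

variable {E : Type} [NormedAddCommGroup E] [NormedSpace ℝ E]
  {H : Type} [TopologicalSpace H] {I : ModelWithCorners ℝ E H}
  {M : Type*} [TopologicalSpace M] [ChartedSpace H M]

/-- The field of bilinear forms with given values. -/
def BilinField.ofVal (I : ModelWithCorners ℝ E H) (b : M → Bil E) : BilinField I M := b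

@[simp]
theorem BilinField.val_ofVal (b : M → Bil E) : (BilinField.ofVal I b).val = b := rfl

section Algebra

variable [IsManifold I ∞ M] {Q : Type*} [TopologicalSpace Q] {g g' : Q → BilinField I M} {X : Set M}

theorem SmoothFam.add (hX : UniqueMDiffOn I X) (hg : SmoothFam g X) (hg' : SmoothFam g' X) :
    SmoothFam (fun q ↦ .ofVal I fun x ↦ (g q).val x + (g' q).val x) X := fun x₀ n ↦
  ((hg x₀ n).add (hX.chartDom x₀) (hg' x₀ n)).congr fun _ _ _ ↦ rfl

theorem SmoothFam.const_smul (hX : UniqueMDiffOn I X) (hg : SmoothFam g X) {c : Q → ℝ}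
    (hc : Continuous c) : SmoothFam (fun q ↦ .ofVal I fun x ↦ c q • (g q).val x) X := fun x₀ n ↦
  (FamOn.bilinear (hX.chartDom x₀) (ContinuousLinearMap.lsmul ℝ ℝ) (.param (hX.chartDom x₀) hc)
    (hg x₀ n)).congr fun _ _ _ ↦ rfl

theorem SmoothFam.sub (hX : UniqueMDiffOn I X) (hg : SmoothFam g X) (hg' : SmoothFam g' X) :
    SmoothFam (fun q ↦ .ofVal I fun x ↦ (g q).val x - (g' q).val x) X :=
  (hg.add hX (hg'.const_smul hX (continuous_const (y := (-1 : ℝ))))).congr fun q x _ ↦ by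
    simp [sub_eq_add_neg]

theorem SmoothFam.zero (hX : UniqueMDiffOn I X) :
    SmoothFam (fun _ : Q ↦ .ofVal I fun _ : M ↦ 0) X := fun x₀ _ ↦
  (FamOn.zero (hX.chartDom x₀)).congr fun _ _ _ ↦ rfl

end Algebra

variable {F : Type} [NormedAddCommGroup F] [NormedSpace ℝ F]
  {K : Type} [TopologicalSpace K] {J : ModelWithCorners ℝ F K}
  {L : Type*} [TopologicalSpace L] [ChartedSpace K L]

theorem chartDom_prod (x₀ : M) (s₀ : L) (X : Set M) (Y : Set L) :
    chartDom (I.prod J) (x₀, s₀) (X ×ˢ Y) = chartDom I x₀ X ×ˢ chartDom J s₀ Y := by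
  ext z
  simp only [chartDom, extChartAt_prod, PartialEquiv.prod_target, PartialEquiv.prod_symm,
    PartialEquiv.prod_coe, mem_inter_iff, mem_prod, mem_preimage]
  tauto

variable [IsManifold I ∞ M] [IsManifold J ∞ L]

theorem chartSymmDeriv_prod {x₀ : M} {s₀ : L} {z : E × F}
    (hz : z ∈ (extChartAt (I.prod J) (x₀, s₀)).target) (u : E × F) :
    chartSymmDeriv (I.prod J) (x₀, s₀) z u =
      (chartSymmDeriv I x₀ z.1 u.1, chartSymmDeriv J s₀ z.2 u.2) := by
  have hU : UniqueMDiffOn (I.prod J) (univ : Set (M × L)) := uniqueMDiffOn_univ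
  have hT := hU.chartDom (x₀, s₀)
  have hz' : z ∈ chartDom (I.prod J) (x₀, s₀) univ := by rwa [chartDom_univ]
  have hzp : z ∈ (extChartAt I x₀).target ×ˢ (extChartAt J s₀).target := by
    rwa [extChartAt_prod, PartialEquiv.prod_target] at hz
  have hsub : ∀ y ∈ chartDom (I.prod J) (x₀, s₀) univ,
      y ∈ (extChartAt I x₀).target ×ˢ (extChartAt J s₀).target := by
    intro y hy
    rwa [chartDom_univ, extChartAt_prod, PartialEquiv.prod_target] at hy
  have hsymm : (extChartAt (I.prod J) (x₀, s₀)).symm z =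
      ((extChartAt I x₀).symm z.1, (extChartAt J s₀).symm z.2) := by
    rw [extChartAt_prod, PartialEquiv.prod_symm, PartialEquiv.prod_coe]
  have h1 := chartSymmDeriv_comp (I := I.prod J) (I' := I) (f := Prod.fst) (X := univ) (x₀' := x₀)
    hU hz' mdifferentiableWithinAt_fst (by
      rw [hsymm]; exact (extChartAt I x₀).map_target hzp.1)
  have h2 := chartSymmDeriv_comp (I := I.prod J) (I' := J) (f := Prod.snd) (X := univ) (x₀' := s₀)
    hU hz' mdifferentiableWithinAt_snd (by
      rw [hsymm]; exact (extChartAt J s₀).map_target hzp.2)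
  have e1 : EqOn (coordMap (I.prod J) I Prod.fst (x₀, s₀) x₀) Prod.fst
      (chartDom (I.prod J) (x₀, s₀) univ) := fun y hy ↦ by
    rw [coordMap, extChartAt_prod, PartialEquiv.prod_symm, PartialEquiv.prod_coe]
    exact (extChartAt I x₀).right_inv (hsub y hy).1
  have e2 : EqOn (coordMap (I.prod J) J Prod.snd (x₀, s₀) s₀) Prod.snd
      (chartDom (I.prod J) (x₀, s₀) univ) := fun y hy ↦ by
    rw [coordMap, extChartAt_prod, PartialEquiv.prod_symm, PartialEquiv.prod_coe]
    exact (extChartAt J s₀).right_inv (hsub y hy).2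
  have d1 : derivAt (I.prod J) I Prod.fst univ ((extChartAt (I.prod J) (x₀, s₀)).symm z) =
      ContinuousLinearMap.fst ℝ E F := by
    rw [derivAt, mfderivWithin_univ]
    exact mfderiv_fst
  have d2 : derivAt (I.prod J) J Prod.snd univ ((extChartAt (I.prod J) (x₀, s₀)).symm z) =
      ContinuousLinearMap.snd ℝ E F := by
    rw [derivAt, mfderivWithin_univ]
    exact mfderiv_snd
  rw [fderivWithin_congr e1 (e1 hz'), fderivWithin_fst (hT z hz'), e1 hz', d1] at h1
  rw [fderivWithin_congr e2 (e2 hz'), fderivWithin_snd (hT z hz'), e2 hz', d2] at h2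
  exact Prod.ext (DFunLike.congr_fun h1 u).symm (DFunLike.congr_fun h2 u).symm

/-- The product of two fields of bilinear forms. -/
def prodField (g : BilinField I M) (h : BilinField J L) : BilinField (I.prod J) (M × L) :=
  .ofVal (I.prod J) fun q ↦ (g.val q.1).prod (h.val q.2)

theorem coordForm_prodField (g : BilinField I M) (h : BilinField J L) {x₀ : M} {s₀ : L} {z : E × F}
    (hz : z ∈ (extChartAt (I.prod J) (x₀, s₀)).target) :
    coordForm (prodField g h) (x₀, s₀) z = Bil.prod (coordForm g x₀ z.1) (coordForm h s₀ z.2) := by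
  refine ContinuousLinearMap.ext fun u ↦ ContinuousLinearMap.ext fun v ↦ ?_
  rw [coordForm_apply, chartSymmDeriv_prod hz, chartSymmDeriv_prod hz, Bil.prod_apply,
    coordForm_apply, coordForm_apply, extChartAt_prod]
  rfl

theorem chartDom_subset_target (x₀ : M) (X : Set M) : chartDom I x₀ X ⊆ (extChartAt I x₀).target :=
  inter_subset_left

theorem FamOn.fst {Q : Type*} [TopologicalSpace Q] {V : Type} [NormedAddCommGroup V]
    [NormedSpace ℝ V] {n : ℕ} {G : Q → E → V} {S : Set E} {T : Set F} (hS : UniqueDiffOn ℝ S)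
    (hT : UniqueDiffOn ℝ T) (hG : FamOn n G S) : FamOn n (fun q z ↦ G q z.1) (S ×ˢ T) :=
  FamOn.comp (φ := fun _ : Q ↦ Prod.fst) (hS.prod hT) hG
    (.const (hS.prod hT) contDiff_fst.contDiffOn) fun _ _ hz ↦ hz.1

theorem FamOn.snd {Q : Type*} [TopologicalSpace Q] {V : Type} [NormedAddCommGroup V]
    [NormedSpace ℝ V] {n : ℕ} {G : Q → F → V} {S : Set E} {T : Set F} (hS : UniqueDiffOn ℝ S)
    (hT : UniqueDiffOn ℝ T) (hG : FamOn n G T) : FamOn n (fun q z ↦ G q z.2) (S ×ˢ T) :=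
  FamOn.comp (φ := fun _ : Q ↦ Prod.snd) (hS.prod hT) hG
    (.const (hS.prod hT) contDiff_snd.contDiffOn) fun _ _ hz ↦ hz.2

theorem SmoothFam.prod {Q : Type*} [TopologicalSpace Q] {g : Q → BilinField I M}
    {h : Q → BilinField J L} {X : Set M} {Y : Set L} (hX : UniqueMDiffOn I X)
    (hY : UniqueMDiffOn J Y) (hg : SmoothFam g X) (hh : SmoothFam h Y) :
    SmoothFam (fun q ↦ prodField (g q) (h q)) (X ×ˢ Y) := by
  rintro ⟨x₀, s₀⟩ n
  have hS := hX.chartDom x₀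
  have hT := hY.chartDom s₀
  have h1 := ((hg x₀ n).fst hS hT).bilinearComp (hS.prod hT)
    (.const (hS.prod hT) (contDiff_const (c := ContinuousLinearMap.fst ℝ E F)).contDiffOn)
  have h2 := ((hh s₀ n).snd hS hT).bilinearComp (hS.prod hT)
    (.const (hS.prod hT) (contDiff_const (c := ContinuousLinearMap.snd ℝ E F)).contDiffOn)
  have h3 := h1.add (hS.prod hT) h2
  rw [← chartDom_prod] at h3
  exact h3.congr fun q z hz ↦ coordForm_prodField _ _ (chartDom_subset_target _ _ hz)

theorem RegularOn.prod {X : Set M} {Y : Set L} (hX : RegularOn I X) (hY : RegularOn J Y) :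
    RegularOn (I.prod J) (X ×ˢ Y) := by
  refine ⟨hX.1.prod hY.1, ?_⟩
  rintro ⟨x₀, s₀⟩
  rw [chartDom_prod, interior_prod_eq, closure_prod_eq]
  exact prod_mono (hX.2 x₀) (hY.2 s₀)

theorem SmoothOn.prod {g : BilinField I M} {h : BilinField J L} {X : Set M} {Y : Set L}
    (hX : UniqueMDiffOn I X) (hY : UniqueMDiffOn J Y) (hg : SmoothOn g X) (hh : SmoothOn h Y) :
    SmoothOn (prodField g h) (X ×ˢ Y) :=
  ⟨((hg.smoothFam Unit hX).prod hX hY (hh.smoothFam Unit hY)).contDiffOn (hX.prod hY) (),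
    fun _ hq _ _ ↦ congrArg₂ (· + ·) (hg.2 _ hq.1 _ _) (hh.2 _ hq.2 _ _)⟩

theorem posAt_prodField [FiniteDimensional ℝ E] [FiniteDimensional ℝ F] (hF : finrank ℝ F = 1)
    {C : CurvCond} {g : BilinField I M} {h : BilinField J L} {X : Set M} {Y : Set L}
    (hX : UniqueMDiffOn I X) (hY : UniqueMDiffOn J Y) (hg : SmoothOn g X) (hh : SmoothOn h Y)
    (hpg : ∀ x ∈ X, (g.val x).PosDef) (hph : ∀ x ∈ Y, (h.val x).PosDef) {q : M × L}
    (hq : q ∈ X ×ˢ Y) : PosAt C (prodField g h) (X ×ˢ Y) q ↔ PosAt C g X q.1 := by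
  obtain ⟨x, s⟩ := q
  have h1 : EqOn (coordForm (prodField g h) (x, s))
      (fun z ↦ Bil.prod (coordForm g x z.1) (coordForm h s z.2))
      (chartDom I x X ×ˢ chartDom J s Y) := by
    rw [← chartDom_prod]
    exact fun z hz ↦ coordForm_prodField _ _ (chartDom_subset_target _ _ hz)
  have h2 : extChartAt (I.prod J) (x, s) (x, s) = (extChartAt I x x, extChartAt J s s) := by
    rw [extChartAt_prod]
    rfl
  have h3 : (extChartAt I x x, extChartAt J s s) ∈ chartDom I x X ×ˢ chartDom J s Y :=
    ⟨extChartAt_mem_chartDom (mem_extChartAt_source x) hq.1,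
      extChartAt_mem_chartDom (mem_extChartAt_source s) hq.2⟩
  rw [PosAt, PosIn, chartDom_prod, h2, C.at_congr h3 h1]
  exact C.at_prod hF (hX.chartDom x) (hY.chartDom s) (hg.1 x) (hh.1 s)
    (fun y hy ↦ (coordForm_posDef_iff hy.1).2 (hpg _ hy.2))
    (fun y hy ↦ (coordForm_posDef_iff hy.1).2 (hph _ hy.2)) h3

end Manifold

/-! ### The cylindrical metric on the product with the unit interval. -/

/-- Multiplication, as a bilinear form on `ℝ`. -/
def mulBil : Bil ℝ := ContinuousLinearMap.mul ℝ ℝ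

@[simp]
theorem mulBil_apply (a b : ℝ) : mulBil a b = a * b := rfl

theorem mulBil_posDef {c : ℝ} (hc : 0 < c) : (c • mulBil : Bil ℝ).PosDef := fun v hv ↦ by
  have : 0 < v * v := mul_self_pos.2 hv
  simpa using mul_pos hc this

theorem derivAt_comp_apply {E : Type} [NormedAddCommGroup E] [NormedSpace ℝ E]
  {H : Type} [TopologicalSpace H] {I : ModelWithCorners ℝ E H}
  {M : Type*} [TopologicalSpace M] [ChartedSpace H M]
  {E' : Type} [NormedAddCommGroup E'] [NormedSpace ℝ E']
  {H' : Type} [TopologicalSpace H'] {I' : ModelWithCorners ℝ E' H'}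
  {M' : Type*} [TopologicalSpace M'] [ChartedSpace H' M']
  {E'' : Type} [NormedAddCommGroup E''] [NormedSpace ℝ E'']
  {H'' : Type} [TopologicalSpace H''] {I'' : ModelWithCorners ℝ E'' H''}
  {M'' : Type*} [TopologicalSpace M''] [ChartedSpace H'' M''] {f : M → M'} {f' : M' → M''}
  {X : Set M} {X' : Set M'} {x : M} (hX : UniqueMDiffWithinAt I X x)
  (hf' : MDifferentiableWithinAt I' I'' f' X' (f x)) (hf : MDifferentiableWithinAt I I' f X x)
  (hm : MapsTo f X X') (u : E) :
    derivAt I I'' (f' ∘ f) X x u = derivAt I' I'' f' X' (f x) (derivAt I I' f X x u) := by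
  have := mfderivWithin_comp x hf' hf hm hX
  exact DFunLike.congr_fun this u

/-- The metric `dt²` on the unit interval. -/
def iccMetric : BilinField (𝓡∂ 1) (Icc (0 : ℝ) 1) :=
  pull (𝓡∂ 1) (Subtype.val : Icc (0 : ℝ) 1 → ℝ) univ (.ofVal 𝓘(ℝ, ℝ) fun _ ↦ mulBil)

theorem chartDom_modelSpace {E : Type} [NormedAddCommGroup E] [NormedSpace ℝ E] (x₀ : E)
    (S : Set E) : chartDom 𝓘(ℝ, E) x₀ S = S := by
  rw [chartDom, extChartAt_model_space_eq_id]
  simp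

theorem coe_extChartAt_symm_modelSpace {E : Type} [NormedAddCommGroup E] [NormedSpace ℝ E]
    (x₀ : E) : ((extChartAt 𝓘(ℝ, E) x₀).symm : E → E) = id := by
  rw [extChartAt_model_space_eq_id]
  rfl

theorem chartSymmDeriv_modelSpace {E : Type} [NormedAddCommGroup E] [NormedSpace ℝ E] (x₀ y : E) :
    chartSymmDeriv 𝓘(ℝ, E) x₀ y = ContinuousLinearMap.id ℝ E := by
  rw [chartSymmDeriv, coe_extChartAt_symm_modelSpace]
  exact mfderivWithin_id (by
    rw [modelWithCornersSelf_coe, range_id]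
    exact uniqueMDiffWithinAt_univ 𝓘(ℝ, E))

theorem coordForm_modelSpace {E : Type} [NormedAddCommGroup E] [NormedSpace ℝ E] (b : E → Bil E)
    (x₀ y : E) : coordForm (.ofVal 𝓘(ℝ, E) b) x₀ y = b y := by
  refine ContinuousLinearMap.ext fun u ↦ ContinuousLinearMap.ext fun v ↦ ?_
  rw [coordForm_apply, chartSymmDeriv_modelSpace, coe_extChartAt_symm_modelSpace]
  rfl

theorem smoothOn_const {E : Type} [NormedAddCommGroup E] [NormedSpace ℝ E] {b : E → Bil E}
    {S : Set E} (hb : ContDiffOn ℝ ∞ b S) (hs : ∀ x ∈ S, (b x).Symm) :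
    SmoothOn (.ofVal 𝓘(ℝ, E) b) S := by
  refine ⟨fun x₀ ↦ ?_, hs⟩
  rw [chartDom_modelSpace]
  exact hb.congr fun y _ ↦ coordForm_modelSpace b x₀ y

theorem smoothOn_iccMetric : SmoothOn iccMetric univ :=
  SmoothOn.pull uniqueMDiffOn_univ uniqueMDiffOn_univ contMDiff_subtypeVal_Icc.contMDiffOn
    (fun _ _ ↦ mem_univ _)
    (smoothOn_const contDiff_const.contDiffOn fun _ _ u v ↦ mul_comm u v)

/-- The projection `projIcc` is smooth on the interval and is a left inverse of the inclusion. -/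
theorem derivAt_val_injective (s : Icc (0 : ℝ) 1) :
    Function.Injective (derivAt (𝓡∂ 1) 𝓘(ℝ, ℝ) (Subtype.val : Icc (0 : ℝ) 1 → ℝ) univ s) := by
  have h1 : ContMDiffOn 𝓘(ℝ, ℝ) (𝓡∂ 1) ∞ (projIcc (0 : ℝ) 1 zero_le_one) (Icc 0 1) :=
    contMDiffOn_projIcc
  have h2 : (projIcc (0 : ℝ) 1 zero_le_one) ∘ (Subtype.val : Icc (0 : ℝ) 1 → ℝ) = id :=
    funext fun s ↦ projIcc_val _ s
  intro u v huv
  have h3 := derivAt_comp_apply (I := 𝓡∂ 1) (I' := 𝓘(ℝ, ℝ)) (I'' := 𝓡∂ 1) (X := univ)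
    (X' := Icc (0 : ℝ) 1) (x := s) (uniqueMDiffOn_univ s (mem_univ s))
    ((h1 s s.2).mdifferentiableWithinAt (by simp))
    ((contMDiff_subtypeVal_Icc (n := ∞)).contMDiffOn.mdifferentiableOn (by simp) s (mem_univ s))
    (fun s _ ↦ s.2)
  rw [h2, derivAt_id uniqueMDiffOn_univ (mem_univ s)] at h3
  have h4 := h3 u
  rw [huv, ← h3 v] at h4
  exact h4

theorem iccMetric_posDef (s : Icc (0 : ℝ) 1) : (iccMetric.val s).PosDef := fun v hv ↦ by
  have h1 : derivAt (𝓡∂ 1) 𝓘(ℝ, ℝ) (Subtype.val : Icc (0 : ℝ) 1 → ℝ) univ s v ≠ 0 :=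
    fun h ↦ hv (derivAt_val_injective s (h.trans (map_zero _).symm))
  exact mul_self_pos.2 h1

section Stab

variable {E : Type} [NormedAddCommGroup E] [NormedSpace ℝ E] [FiniteDimensional ℝ E]
  {H : Type} [TopologicalSpace H] {I : ModelWithCorners ℝ E H}
  {M : Type*} [TopologicalSpace M] [ChartedSpace H M] [IsManifold I ∞ M]

theorem stab_val (g : BilinField I M) (q : M × Icc (0 : ℝ) 1) :
    (stab g).val q = (prodField g iccMetric).val q := by
  have h1 : derivAt (I.prod (𝓡∂ 1)) I Prod.fst univ q =
      ContinuousLinearMap.fst ℝ E (EuclideanSpace ℝ (Fin 1)) := by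
    rw [derivAt, mfderivWithin_univ]
    exact mfderiv_fst
  have h2 : derivAt (I.prod (𝓡∂ 1)) (𝓡∂ 1) Prod.snd univ q =
      ContinuousLinearMap.snd ℝ E (EuclideanSpace ℝ (Fin 1)) := by
    rw [derivAt, mfderivWithin_univ]
    exact mfderiv_snd
  have h3 : ∀ u, derivAt (I.prod (𝓡∂ 1)) 𝓘(ℝ, ℝ) (fun r : M × Icc (0 : ℝ) 1 ↦ (r.2 : ℝ)) univ q u =
      derivAt (𝓡∂ 1) 𝓘(ℝ, ℝ) (Subtype.val : Icc (0 : ℝ) 1 → ℝ) univ q.2 u.2 := by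
    intro u
    have := derivAt_comp_apply (I := I.prod (𝓡∂ 1)) (I' := 𝓡∂ 1) (I'' := 𝓘(ℝ, ℝ)) (X := univ)
      (X' := univ) (f := Prod.snd) (f' := (Subtype.val : Icc (0 : ℝ) 1 → ℝ)) (x := q)
      (uniqueMDiffOn_univ q (mem_univ q))
      ((contMDiff_subtypeVal_Icc (n := ∞)).contMDiffOn.mdifferentiableOn (by simp) q.2 (mem_univ _))
      mdifferentiableWithinAt_snd (fun _ _ ↦ mem_univ _) u
    rwa [h2] at this
  have h4 : ∀ u v, (stab g).val q u v =
      g.val q.1 (derivAt (I.prod (𝓡∂ 1)) I Prod.fst univ q u)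
        (derivAt (I.prod (𝓡∂ 1)) I Prod.fst univ q v) +
      derivAt (I.prod (𝓡∂ 1)) 𝓘(ℝ, ℝ) (fun r : M × Icc (0 : ℝ) 1 ↦ (r.2 : ℝ)) univ q u *
      derivAt (I.prod (𝓡∂ 1)) 𝓘(ℝ, ℝ) (fun r : M × Icc (0 : ℝ) 1 ↦ (r.2 : ℝ)) univ q v := by
    intro u v
    rw [derivAt, derivAt, mfderivWithin_univ, mfderivWithin_univ]
    rfl
  refine ContinuousLinearMap.ext fun u ↦ ContinuousLinearMap.ext fun v ↦ ?_
  rw [h4, h3, h3, h1]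
  rfl

theorem stab_eq (g : BilinField I M) : stab g = prodField g iccMetric := funext (stab_val g)

theorem IsSmoothMetric.stab {g : BilinField I M} (hg : IsSmoothMetric g) :
    IsSmoothMetric (stab g) := by
  rw [stab_eq]
  refine SmoothOn.isSmoothMetric ?_ fun q ↦ (hg.posDef q.1).prod (iccMetric_posDef q.2)
  rw [← univ_prod_univ]
  exact hg.smoothOn.prod uniqueMDiffOn_univ uniqueMDiffOn_univ smoothOn_iccMetric

theorem posOn_stab_iff {C : CurvCond} {g : BilinField I M} (hg : IsSmoothMetric g) :
    PosOn C (_root_.stab g) ↔ PosOn C g := by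
  have h : ∀ q : M × Icc (0 : ℝ) 1, PosAt C (prodField g iccMetric) univ q ↔ PosAt C g univ q.1 := by
    intro q
    rw [← univ_prod_univ]
    exact posAt_prodField (by simp) uniqueMDiffOn_univ uniqueMDiffOn_univ hg.smoothOn
      smoothOn_iccMetric (fun x _ ↦ hg.posDef x) (fun s _ ↦ iccMetric_posDef s) ⟨mem_univ _, mem_univ _⟩
  rw [stab_eq, PosOn]
  exact ⟨fun h' x ↦ (h (x, 0)).1 (h' (x, 0)), fun h' q ↦ (h q).2 (h' q.1)⟩

end Stab

theorem stab_equivalence (p k : ℕ) (N : Mfd.{u}) (hN : Nonempty N.carrier) {g : N.Form}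
    (hg : g ∈ N.metrics) :
    (PosPCurv p g ↔ PosPCurv p (stab g)) ∧ (PosCoRic k g ↔ PosCoRic k (stab g)) := by
  have h := hg.1
  rw [posPCurv_iff h, posPCurv_iff h.stab, posCoRic_iff h, posCoRic_iff h.stab, posOn_stab_iff h,
    posOn_stab_iff h]
  exact ⟨Iff.rfl, Iff.rfl⟩

/-! ### Operations on families of forms on a cylinder. -/

namespace FamOn

variable {Q : Type*} [TopologicalSpace Q] {E V W : Type} [NormedAddCommGroup E]
  [NormedSpace ℝ E] [NormedAddCommGroup V] [NormedSpace ℝ V] [NormedAddCommGroup W]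
  [NormedSpace ℝ W] {n : ℕ} {T : Set E}

theorem prodMk (hT : UniqueDiffOn ℝ T) {F : Q → E → V} {G : Q → E → W} (hF : FamOn n F T)
    (hG : FamOn n G T) : FamOn n (fun q y ↦ (F q y, G q y)) T :=
  ((hF.clm hT (ContinuousLinearMap.inl ℝ V W)).add hT
    (hG.clm hT (ContinuousLinearMap.inr ℝ V W))).congr fun q y _ ↦ by simp

end FamOn

section Cylinder

variable {E : Type} [NormedAddCommGroup E] [NormedSpace ℝ E]
  {H : Type} [TopologicalSpace H] {I : ModelWithCorners ℝ E H}
  {N : Type*} [TopologicalSpace N] [ChartedSpace H N] [IsManifold I ∞ N]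

theorem extChartAt_cylinder_symm (x₀ : N) (s₀ : ℝ) (z : E × ℝ) :
    (extChartAt (I.prod 𝓘(ℝ, ℝ)) (x₀, s₀)).symm z = ((extChartAt I x₀).symm z.1, z.2) := by
  rw [extChartAt_prod, PartialEquiv.prod_symm, PartialEquiv.prod_coe,
    coe_extChartAt_symm_modelSpace]
  rfl

/-- The chart of the line is the identity, so operations that involve only the height commute with
passing to coordinates. -/
theorem coordForm_cylinder (g : BilinField (I.prod 𝓘(ℝ, ℝ)) (N × ℝ)) {x₀ : N} {s₀ : ℝ} {z : E × ℝ}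
    (hz : z ∈ (extChartAt (I.prod 𝓘(ℝ, ℝ)) (x₀, s₀)).target) :
    coordForm g (x₀, s₀) z = ((g.val ((extChartAt I x₀).symm z.1, z.2)).bilinearComp
      ((chartSymmDeriv I x₀ z.1).prodMap (ContinuousLinearMap.id ℝ ℝ))
      ((chartSymmDeriv I x₀ z.1).prodMap (ContinuousLinearMap.id ℝ ℝ)) : Bil (E × ℝ)) := by
  refine ContinuousLinearMap.ext fun u ↦ ContinuousLinearMap.ext fun v ↦ ?_
  rw [coordForm_apply, chartSymmDeriv_prod hz, chartSymmDeriv_prod hz, extChartAt_cylinder_symm,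
    chartSymmDeriv_modelSpace]
  rfl

theorem chartDom_cylinder (x₀ : N) (s₀ : ℝ) (X : Set N) (J : Set ℝ) :
    chartDom (I.prod 𝓘(ℝ, ℝ)) (x₀, s₀) (X ×ˢ J) = chartDom I x₀ X ×ˢ J := by
  rw [chartDom_prod, chartDom_modelSpace]

variable {Q : Type*} [TopologicalSpace Q] {X : Set N} {J J' : Set ℝ}
  {g : Q → BilinField (I.prod 𝓘(ℝ, ℝ)) (N × ℝ)}

theorem SmoothFam.smul_height (hX : UniqueMDiffOn I X) (hJ : UniqueDiffOn ℝ J)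
    (hg : SmoothFam g (X ×ˢ J)) {χ : Q → ℝ → ℝ} (hχ : ∀ n, FamOn n χ J) :
    SmoothFam (fun q ↦ .ofVal (I.prod 𝓘(ℝ, ℝ)) fun p ↦ χ q p.2 • (g q).val p) (X ×ˢ J) := by
  rintro ⟨x₀, s₀⟩ n
  have h1 := hg (x₀, s₀) n
  have hS := hX.chartDom x₀
  rw [chartDom_cylinder] at h1 ⊢
  refine (FamOn.bilinear (hS.prod hJ) (ContinuousLinearMap.lsmul ℝ ℝ) ((hχ n).snd hS hJ)
    h1).congr fun q z hz ↦ ?_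
  rw [← chartDom_cylinder x₀ s₀] at hz
  rw [coordForm_cylinder _ hz.1, coordForm_cylinder _ hz.1]
  rfl

/-- The height at which the field is evaluated changes, while its values are not transformed by the
derivative of `φ`. In the applications `φ` is a translation, for which this is the pullback. -/
theorem SmoothFam.comp_height (hX : UniqueMDiffOn I X) (hJ : UniqueDiffOn ℝ J)
    (hg : SmoothFam g (X ×ˢ J')) {φ : Q → ℝ → ℝ} (hφ : ∀ n, FamOn n φ J)
    (hm : ∀ q, MapsTo (φ q) J J') :
    SmoothFam (fun q ↦ .ofVal (I.prod 𝓘(ℝ, ℝ)) fun p ↦ (g q).val (p.1, φ q p.2)) (X ×ˢ J) := by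
  rintro ⟨x₀, s₀⟩ n
  have h1 := hg (x₀, s₀) n
  have hS := hX.chartDom x₀
  rw [chartDom_cylinder] at h1 ⊢
  have h2 : FamOn n (fun (_ : Q) (z : E × ℝ) ↦ z.1) (chartDom I x₀ X ×ˢ J) :=
    .const (hS.prod hJ) contDiff_fst.contDiffOn
  refine (FamOn.comp (hS.prod hJ) h1 (h2.prodMk (hS.prod hJ) ((hφ n).snd hS hJ))
    fun q z hz ↦ ⟨hz.1, hm q hz.2⟩).congr fun q z hz ↦ ?_
  have hz' : (z.1, φ q z.2) ∈ chartDom (I.prod 𝓘(ℝ, ℝ)) (x₀, s₀) (X ×ˢ J') := by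
    rw [chartDom_cylinder]
    exact ⟨hz.1, hm q hz.2⟩
  rw [← chartDom_cylinder x₀ s₀] at hz
  rw [coordForm_cylinder _ hz.1, coordForm_cylinder _ hz'.1]
  rfl

open scoped Classical in
theorem SmoothFam.extend_zero (hX : UniqueMDiffOn I X) (hg : SmoothFam g (X ×ˢ Ico (0 : ℝ) 1))
    (h : ∀ q, ∃ ε > 0, ∀ p ∈ X ×ˢ Ico (0 : ℝ) 1, p.2 < ε → (g q).val p = 0) :
    SmoothFam (fun q ↦ .ofVal (I.prod 𝓘(ℝ, ℝ)) fun p ↦ if 0 ≤ p.2 then (g q).val p else 0)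
      (X ×ˢ Iio (1 : ℝ)) := by
  rintro ⟨x₀, s₀⟩ n
  have h1 := hg (x₀, s₀) n
  have hS := hX.chartDom x₀
  rw [chartDom_cylinder] at h1 ⊢
  refine (h1.extend_zero hS fun q ↦ ?_).congr fun q z hz ↦ ?_
  · obtain ⟨ε, hε, hv⟩ := h q
    refine ⟨ε, hε, fun z hz hzε ↦ ?_⟩
    have hz2 := hz
    rw [← chartDom_cylinder x₀ s₀] at hz
    rw [coordForm_cylinder _ hz.1, hv ((extChartAt I x₀).symm z.1, z.2) ⟨hz2.1.2, hz2.2⟩ hzε]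
    rfl
  · have hz' : z ∈ (extChartAt (I.prod 𝓘(ℝ, ℝ)) (x₀, s₀)).target := by
      have : z ∈ chartDom (I.prod 𝓘(ℝ, ℝ)) (x₀, s₀) (X ×ˢ Iio (1 : ℝ)) := by
        rwa [chartDom_cylinder]
      exact this.1
    rw [coordForm_cylinder _ hz', coordForm_cylinder _ hz', BilinField.val_ofVal]
    split_ifs <;> rfl

/-- The horizontal field on the cylinder defined by a field on the base. -/
def horField (g : BilinField I N) : BilinField (I.prod 𝓘(ℝ, ℝ)) (N × ℝ) :=
  prodField g (.ofVal 𝓘(ℝ, ℝ) fun _ ↦ 0)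

/-- The field `f(s) ds²` on the real line. -/
def lineField (f : ℝ → ℝ) : BilinField 𝓘(ℝ, ℝ) ℝ := .ofVal 𝓘(ℝ, ℝ) fun s ↦ f s • mulBil

theorem smoothFam_lineField {f : Q → ℝ → ℝ} (hJ : UniqueDiffOn ℝ J) (hf : ∀ n, FamOn n f J) :
    SmoothFam (fun q ↦ lineField (f q)) J := by
  intro s₀ n
  rw [chartDom_modelSpace]
  exact ((hf n).clm hJ ((ContinuousLinearMap.lsmul ℝ ℝ).flip mulBil)).congr fun q s _ ↦
    coordForm_modelSpace _ s₀ s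

theorem smoothFam_horField {β : Q → BilinField I N} (hX : UniqueMDiffOn I X)
    (hJ : UniqueDiffOn ℝ J) (hβ : SmoothFam β X) : SmoothFam (fun q ↦ horField (β q)) (X ×ˢ J) := by
  refine hβ.prod hX hJ.uniqueMDiffOn fun s₀ n ↦ ?_
  rw [chartDom_modelSpace]
  exact (FamOn.zero hJ).congr fun q s _ ↦ coordForm_modelSpace _ s₀ s

theorem smoothFam_prod_lineField {β : Q → BilinField I N} {f : Q → ℝ → ℝ} (hX : UniqueMDiffOn I X)
    (hJ : UniqueDiffOn ℝ J) (hβ : SmoothFam β X) (hf : ∀ n, FamOn n f J) :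
    SmoothFam (fun q ↦ prodField (β q) (lineField (f q))) (X ×ˢ J) :=
  hβ.prod hX hJ.uniqueMDiffOn (smoothFam_lineField hJ hf)

end Cylinder

/-! ### Pullbacks along mutually inverse maps. -/

section Inverse

variable {E : Type} [NormedAddCommGroup E] [NormedSpace ℝ E]
  {H : Type} [TopologicalSpace H] {I : ModelWithCorners ℝ E H}
  {M : Type*} [TopologicalSpace M] [ChartedSpace H M]
  {E' : Type} [NormedAddCommGroup E'] [NormedSpace ℝ E']
  {H' : Type} [TopologicalSpace H'] {I' : ModelWithCorners ℝ E' H'}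
  {M' : Type*} [TopologicalSpace M'] [ChartedSpace H' M']
  {f : M → M'} {f' : M' → M} {X : Set M} {X' : Set M'}

theorem derivAt_leftInv (hX : UniqueMDiffOn I X) (hf : ContMDiffOn I I' ∞ f X)
    (hf' : ContMDiffOn I' I ∞ f' X') (hm : MapsTo f X X') (h : LeftInvOn f' f X) {x : M}
    (hx : x ∈ X) (u : E) : derivAt I' I f' X' (f x) (derivAt I I' f X x u) = u := by
  rw [← derivAt_comp_apply (hX x hx) ((hf' _ (hm hx)).mdifferentiableWithinAt (by simp))
    ((hf x hx).mdifferentiableWithinAt (by simp)) hm]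
  have h1 : derivAt I I (f' ∘ f) X x = derivAt I I id X x :=
    mfderivWithin_congr (fun z hz ↦ h hz) (h hx)
  rw [h1, derivAt_id hX hx]
  rfl

theorem pull_pull (hX : UniqueMDiffOn I X) (hf : ContMDiffOn I I' ∞ f X)
    (hf' : ContMDiffOn I' I ∞ f' X') (hm : MapsTo f X X') (h : LeftInvOn f' f X) {x : M}
    (hx : x ∈ X) (g : BilinField I M) : (pull I f X (pull I' f' X' g)).val x = g.val x := by
  refine ContinuousLinearMap.ext fun u ↦ ContinuousLinearMap.ext fun v ↦ ?_
  rw [pull_apply, pull_apply, derivAt_leftInv hX hf hf' hm h hx,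
    derivAt_leftInv hX hf hf' hm h hx, h hx]

theorem LocalDiffeoOn.of_inverse (hX : UniqueMDiffOn I X) (hX' : UniqueMDiffOn I' X')
    (hf : ContMDiffOn I I' ∞ f X) (hf' : ContMDiffOn I' I ∞ f' X') (hm : MapsTo f X X')
    (hm' : MapsTo f' X' X) (h : LeftInvOn f' f X) (h' : LeftInvOn f f' X') :
    LocalDiffeoOn I I' f X X' := by
  refine ⟨hf, hm, fun z hz ↦ ⟨fun u v huv ↦ ?_, fun w ↦ ⟨derivAt I' I f' X' (f z) w, ?_⟩⟩⟩
  · rw [← derivAt_leftInv hX hf hf' hm h hz u, huv, derivAt_leftInv hX hf hf' hm h hz]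
  · have := derivAt_leftInv hX' hf' hf hm' h' (hm hz) w
    rwa [h hz] at this

theorem LocalDiffeoOn.mono_codomain {X'' : Set M'} (hf : LocalDiffeoOn I I' f X X')
    (h : X' ⊆ X'') : LocalDiffeoOn I I' f X X'' :=
  ⟨hf.1, fun _ hx ↦ h (hf.2 hx), hf.3⟩

end Inverse

theorem regularOn_of_uniqueDiffOn {J : Set ℝ} (hJ : UniqueDiffOn ℝ J)
    (hc : J ⊆ closure (interior J)) : RegularOn 𝓘(ℝ, ℝ) J :=
  ⟨hJ.uniqueMDiffOn, fun s₀ ↦ by rwa [chartDom_modelSpace]⟩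

/-! ### The collar, and extension by zero of fields on it. -/

namespace Mfd

variable (M : Mfd.{u})

/-- The model with corners of the cylinder over the boundary. -/
abbrev IC : ModelWithCorners ℝ (M.EB × ℝ) (ModelProd M.HB ℝ) := M.IB.prod 𝓘(ℝ, ℝ)

/-- Fields of bilinear forms on the cylinder over the boundary. -/
abbrev CylForm := BilinField M.IC (M.bd × ℝ)

theorem uniqueDiffOn_Ico : UniqueDiffOn ℝ (Ico (0 : ℝ) 1) := _root_.uniqueDiffOn_Ico 0 1

theorem regularOn_cyl : RegularOn M.IC (cyl M.bd) :=
  isOpen_univ.regularOn.prod (regularOn_of_uniqueDiffOn uniqueDiffOn_Ico (by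
    rw [interior_Ico, closure_Ioo zero_ne_one]
    exact Ico_subset_Icc_self))

/-- The image of the collar. -/
def collarImage : Set M.carrier := M.collar '' cyl M.bd

theorem isOpen_collarImage : IsOpen M.collarImage := M.isOpen_collar

theorem mapsTo_collar : MapsTo M.collar (cyl M.bd) M.collarImage := mapsTo_image _ _

variable [hbd : Nonempty M.bd]

/-- An inverse of the collar. -/
def retr : M.carrier → M.bd × ℝ := (M.exists_smooth_inverse hbd).choose

theorem contMDiffOn_retr : ContMDiffOn M.I M.IC ∞ M.retr M.collarImage :=
  (M.exists_smooth_inverse hbd).choose_spec.1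

theorem leftInvOn_retr : LeftInvOn M.retr M.collar (cyl M.bd) :=
  (M.exists_smooth_inverse hbd).choose_spec.2

theorem leftInvOn_collar : LeftInvOn M.collar M.retr M.collarImage := by
  rintro _ ⟨q, hq, rfl⟩
  rw [M.leftInvOn_retr hq]

theorem mapsTo_retr : MapsTo M.retr M.collarImage (cyl M.bd) := by
  rintro _ ⟨q, hq, rfl⟩
  rwa [M.leftInvOn_retr hq]

theorem localDiffeoOn_collar : LocalDiffeoOn M.IC M.I M.collar (cyl M.bd) univ :=
  (LocalDiffeoOn.of_inverse M.regularOn_cyl.1 M.isOpen_collarImage.uniqueMDiffOn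
    M.contMDiffOn_collar M.contMDiffOn_retr M.mapsTo_collar M.mapsTo_retr M.leftInvOn_retr
    M.leftInvOn_collar).mono_codomain (subset_univ _)

/-- The pullback of a field along the collar, as a field on the cylinder. -/
def cpull (g : M.Form) : M.CylForm := pull M.IC M.collar (cyl M.bd) g

omit hbd in
theorem cpull_val (g : M.Form) (q : M.bd × ℝ) : (M.cpull g).val q = M.collarPullback g q := rfl

open scoped Classical in
/-- The extension by zero of a field on the cylinder, pushed forward along the collar. -/
def extZero (w : M.CylForm) : M.Form :=
  .ofVal M.I fun z ↦ if z ∈ M.collarImage then (pull M.I M.retr M.collarImage w).val z else 0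

theorem extZero_val_of_mem (w : M.CylForm) {z : M.carrier} (hz : z ∈ M.collarImage) :
    (M.extZero w).val z = (pull M.I M.retr M.collarImage w).val z := if_pos hz

theorem extZero_val_of_notMem (w : M.CylForm) {z : M.carrier} (hz : z ∉ M.collarImage) :
    (M.extZero w).val z = 0 := if_neg hz

theorem cpull_extZero (w : M.CylForm) {q : M.bd × ℝ} (hq : q ∈ cyl M.bd) :
    (M.cpull (M.extZero w)).val q = w.val q := by
  rw [← pull_pull M.regularOn_cyl.1 M.contMDiffOn_collar M.contMDiffOn_retr M.mapsTo_collar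
    M.leftInvOn_retr hq w]
  refine ContinuousLinearMap.ext fun u ↦ ContinuousLinearMap.ext fun v ↦ ?_
  rw [cpull, pull_apply, pull_apply, M.extZero_val_of_mem w (M.mapsTo_collar hq)]

omit hbd in
/-- The part of the collar up to height `c`. -/
def collarPart (c : ℝ) : Set M.carrier := M.collar '' (univ ×ˢ Icc 0 c)

omit hbd in
theorem isCompact_part (c : ℝ) : IsCompact (univ ×ˢ Icc 0 c : Set (M.bd × ℝ)) :=
  isCompact_univ.prod isCompact_Icc

omit hbd in
theorem part_subset_cyl {c : ℝ} (hc : c < 1) : (univ ×ˢ Icc 0 c : Set (M.bd × ℝ)) ⊆ cyl M.bd :=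
  fun _ hq ↦ ⟨hq.1, hq.2.1, hq.2.2.trans_lt hc⟩

omit hbd in
theorem isClosed_collarPart {c : ℝ} (hc : c < 1) : IsClosed (M.collarPart c) :=
  ((M.isCompact_part c).image_of_continuousOn
    (M.contMDiffOn_collar.continuousOn.mono (M.part_subset_cyl hc))).isClosed

theorem extZero_val_eq_zero {w : M.CylForm} {c : ℝ}
    (hw : ∀ q ∈ cyl M.bd, c ≤ q.2 → w.val q = 0) {z : M.carrier}
    (hz : z ∈ (M.collarPart c)ᶜ) : (M.extZero w).val z = 0 := by
  by_cases h : z ∈ M.collarImage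
  · rw [M.extZero_val_of_mem w h]
    obtain ⟨q, hq, rfl⟩ := h
    have hcq : c ≤ q.2 := by
      by_contra! h
      exact hz ⟨q, ⟨mem_univ _, hq.2.1, h.le⟩, rfl⟩
    refine ContinuousLinearMap.ext fun u ↦ ContinuousLinearMap.ext fun v ↦ ?_
    rw [pull_apply, M.leftInvOn_retr hq, hw q hq hcq]
    rfl
  · exact M.extZero_val_of_notMem w h

/-- The part of the collar up to height `c < 1` is compact, hence closed in the manifold. The
extended field vanishes on its complement, which is an open set containing all points outside the
collar. -/
theorem smoothFam_extZero {Q : Type*} [TopologicalSpace Q] {w : Q → M.CylForm} {c : ℝ} (hc : c < 1)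
    (hw : SmoothFam w (cyl M.bd)) (h0 : ∀ a, ∀ q ∈ cyl M.bd, c ≤ q.2 → (w a).val q = 0) :
    SmoothFam (fun a ↦ M.extZero (w a)) univ := by
  refine .of_locally fun z _ ↦ ?_
  by_cases hz : z ∈ M.collarImage
  · refine ⟨M.collarImage, M.isOpen_collarImage, hz, ?_⟩
    rw [univ_inter]
    exact (hw.pull M.isOpen_collarImage.uniqueMDiffOn M.contMDiffOn_retr M.mapsTo_retr).congr
      fun a z hz ↦ M.extZero_val_of_mem (w a) hz
  · have hzc : z ∈ (M.collarPart c)ᶜ := fun h ↦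
      hz (image_mono (M.part_subset_cyl hc) h)
    refine ⟨_, (M.isClosed_collarPart hc).isOpen_compl, hzc, ?_⟩
    have hU := (M.isClosed_collarPart hc).isOpen_compl.uniqueMDiffOn (I := M.I)
    rw [univ_inter]
    exact (SmoothFam.zero hU).congr fun a z hz ↦ M.extZero_val_eq_zero (h0 a) hz

end Mfd

/-! ### Restriction to the boundary, and replacement of metrics on the collar. -/

namespace Mfd

variable (M : Mfd.{u})

/-- The fields of bilinear forms on the boundary. -/
abbrev BdForm := BilinField M.IB M.bd

/-- The restriction to the boundary. -/
def resB (g : M.Form) : M.BdForm := M.res g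

theorem contMDiff_inclZero : ContMDiff M.IB M.IC ∞ fun x : M.bd ↦ (x, (0 : ℝ)) :=
  contMDiff_id.prodMk contMDiff_const

variable {M} in
theorem zero_mem_cyl (x : M.bd) : (x, (0 : ℝ)) ∈ cyl M.bd := ⟨mem_univ _, le_rfl, zero_lt_one⟩

theorem derivAt_inclZero (x : M.bd) (u : M.EB) :
    derivAt M.IB M.IC (fun x : M.bd ↦ (x, (0 : ℝ))) univ x u = (u, 0) := by
  have h1 : HasMFDerivAt M.IB M.IC (fun x : M.bd ↦ (x, (0 : ℝ))) x
      ((ContinuousLinearMap.id ℝ M.EB).prod (0 : M.EB →L[ℝ] ℝ)) :=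
    (hasMFDerivAt_id x).prodMk (hasMFDerivAt_const (0 : ℝ) x)
  rw [derivAt, mfderivWithin_univ, h1.mfderiv]
  rfl

theorem resB_val_apply (g : M.Form) (x : M.bd) (u v : M.EB) :
    (M.resB g).val x u v = (M.cpull g).val (x, 0) (u, 0) (v, 0) := by
  have h : ∀ u, derivAt M.IB M.I (fun x : M.bd ↦ M.collar (x, 0)) univ x u =
      derivAt M.IC M.I M.collar (cyl M.bd) (x, 0) (u, 0) := fun u ↦ by
    rw [← M.derivAt_inclZero x u]
    exact derivAt_comp_apply (f := fun x : M.bd ↦ (x, (0 : ℝ))) (X := univ)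
      (uniqueMDiffOn_univ x (mem_univ x))
      ((M.contMDiffOn_collar _ (zero_mem_cyl x)).mdifferentiableWithinAt (by simp))
      ((M.contMDiff_inclZero.mdifferentiable (by simp)).mdifferentiableOn x (mem_univ x))
      (fun x _ ↦ zero_mem_cyl x) u
  rw [cpull, pull_apply, ← h, ← h, derivAt, mfderivWithin_univ]
  rfl

theorem resB_val (g : M.Form) (x : M.bd) : (M.resB g).val x =
    (pull M.IB (fun x : M.bd ↦ (x, (0 : ℝ))) univ (M.cpull g)).val x := by
  refine ContinuousLinearMap.ext fun u ↦ ContinuousLinearMap.ext fun v ↦ ?_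
  rw [resB_val_apply, pull_apply, derivAt_inclZero, derivAt_inclZero]

theorem smoothFam_cpull {Q : Type*} [TopologicalSpace Q] {h : Q → M.Form} (hh : SmoothFam h univ) :
    SmoothFam (fun q ↦ M.cpull (h q)) (cyl M.bd) :=
  hh.pull M.regularOn_cyl.1 M.contMDiffOn_collar fun _ _ ↦ mem_univ _

theorem smoothFam_resB {Q : Type*} [TopologicalSpace Q] {h : Q → M.Form} (hh : SmoothFam h univ) :
    SmoothFam (fun q ↦ M.resB (h q)) univ :=
  ((M.smoothFam_cpull hh).pull uniqueMDiffOn_univ M.contMDiff_inclZero.contMDiffOn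
    fun x _ ↦ zero_mem_cyl x).congr fun q x _ ↦ M.resB_val (h q) x

variable {M}

/-- The field `w` on the cylinder is the product `β + ds²` up to height `ε`. -/
def EqProd (w : M.CylForm) (β : M.BdForm) (ε : ℝ) : Prop :=
  ∀ (x : M.bd) (t : ℝ), 0 ≤ t → t < ε → w.val (x, t) = Bil.prod (β.val x) mulBil

theorem mem_metrics_iff {g : M.Form} : g ∈ M.metrics ↔
    IsSmoothMetric g ∧ ∃ ε : ℝ, 0 < ε ∧ ε ≤ 1 ∧ EqProd (M.cpull g) (M.resB g) ε := by
  refine and_congr_right fun _ ↦ exists_congr fun ε ↦ and_congr_right fun _ ↦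
    and_congr_right fun _ ↦ ⟨fun h x t h0 ht ↦ ?_, fun h x t h0 ht u v a b ↦ ?_⟩
  · refine ContinuousLinearMap.ext fun u ↦ ContinuousLinearMap.ext fun v ↦ ?_
    exact h x t h0 ht u.1 v.1 u.2 v.2
  · have := h x t h0 ht
    rw [cpull_val] at this
    rw [this]
    rfl

variable (M) in
/-- The metrics on `M` that satisfy the curvature condition `C`. -/
def curvMetrics (C : CurvCond) : Set M.Form := {g | g ∈ M.metrics ∧ PosOn C g}

theorem smoothFam_of_mem {Q : Type*} [TopologicalSpace Q] {h : Q → M.Form} (hc : Continuous h)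
    (hh : ∀ q, IsSmoothMetric (h q)) : SmoothFam h univ :=
  .of_continuous hc fun q ↦ ((isSmoothMetric_iff (h q)).1 (hh q)).2.2

theorem smoothFam_boundary_of_mem {Q : Type*} [TopologicalSpace Q] {h : Q → M.BdForm}
    (hc : Continuous h) (hh : ∀ q, IsSmoothMetric (h q)) : SmoothFam h univ :=
  .of_continuous hc fun q ↦ ((isSmoothMetric_iff (h q)).1 (hh q)).2.2

theorem symm_extZero [Nonempty M.bd] {w : M.CylForm} (hw : ∀ p ∈ cyl M.bd, (w.val p).Symm)
    (z : M.carrier) : ((M.extZero w).val z).Symm := by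
  by_cases hz : z ∈ M.collarImage
  · rw [M.extZero_val_of_mem w hz]
    exact fun u v ↦ hw _ (M.mapsTo_retr hz) _ _
  · rw [M.extZero_val_of_notMem w hz]
    exact fun _ _ ↦ rfl

/-- Replacing a family of metrics on the collar. -/
theorem exists_replace [Nonempty M.bd] {C : CurvCond} {Q : Type*} [TopologicalSpace Q]
    {h : Q → M.Form} (hc : Continuous h) (hh : ∀ q, h q ∈ M.curvMetrics C) {w : Q → M.CylForm}
    (hw : SmoothFam w (cyl M.bd)) (hs : ∀ q, ∀ p ∈ cyl M.bd, ((w q).val p).Symm) {c : ℝ}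
    (hc1 : c < 1) (hwc : ∀ q, ∀ p ∈ cyl M.bd, c ≤ p.2 → (w q).val p = (M.cpull (h q)).val p)
    (hpos : ∀ q, ∀ p ∈ (univ ×ˢ Icc 0 c : Set (M.bd × ℝ)), PosAt C (w q) (cyl M.bd) p)
    {b : Q → M.BdForm} (hb : ∀ q, ∃ ε : ℝ, 0 < ε ∧ ε ≤ 1 ∧ EqProd (w q) (b q) ε) :
    ∃ L : Q → M.Form, Continuous L ∧ (∀ q, L q ∈ M.curvMetrics C) ∧ (∀ q, M.resB (L q) = b q) ∧
      (∀ q, ∀ p ∈ cyl M.bd, (M.cpull (L q)).val p = (w q).val p) ∧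
      ∀ q, (∀ p ∈ cyl M.bd, (w q).val p = (M.cpull (h q)).val p) → L q = h q := by
  have hhs := smoothFam_of_mem hc fun q ↦ (mem_metrics_iff.1 (hh q).1).1
  have hcs := M.smoothFam_cpull hhs
  let d : Q → M.CylForm := fun q ↦ .ofVal M.IC fun p ↦ (w q).val p - (M.cpull (h q)).val p
  have hd : SmoothFam d (cyl M.bd) := hw.sub M.regularOn_cyl.1 hcs
  have hd0 : ∀ q, ∀ p ∈ cyl M.bd, c ≤ p.2 → (d q).val p = 0 := fun q p hp hcp ↦
    sub_eq_zero.2 (hwc q p hp hcp)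
  -- The difference `d` vanishes from height `c` on and is extended by zero; on the collar the sum
  -- is `w`.
  let L : Q → M.Form := fun q ↦ .ofVal M.I fun z ↦ (h q).val z + (M.extZero (d q)).val z
  have hL : SmoothFam L univ := hhs.add uniqueMDiffOn_univ (M.smoothFam_extZero hc1 hd hd0)
  have hcL : ∀ q, ∀ p ∈ cyl M.bd, (M.cpull (L q)).val p = (w q).val p := fun q p hp ↦ by
    have h1 : (M.cpull (L q)).val p =
        (M.cpull (h q)).val p + (M.cpull (M.extZero (d q))).val p := rfl
    rw [h1, M.cpull_extZero _ hp]
    exact add_sub_cancel _ _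
  have hsymm : ∀ q, ∀ z ∈ univ, ((L q).val z).Symm := fun q z _ u v ↦ by
    have h1 := symm_extZero (w := d q) (fun p hp u v ↦ by
      have h2 := hs q p hp u v
      have h3 : ((M.cpull (h q)).val p).Symm := fun u v ↦
        ((isSmoothMetric_iff (h q)).1 (mem_metrics_iff.1 (hh q).1).1).1 _ _ _
      change (w q).val p u v - (M.cpull (h q)).val p u v =
        (w q).val p v u - (M.cpull (h q)).val p v u
      rw [h2, h3 u v]) z u v
    change (h q).val z u v + (M.extZero (d q)).val z u v =
      (h q).val z v u + (M.extZero (d q)).val z v u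
    rw [h1, ((isSmoothMetric_iff (h q)).1 (mem_metrics_iff.1 (hh q).1).1).1 z u v]
  have hso : ∀ q, SmoothOn (L q) univ := hL.smoothOn uniqueMDiffOn_univ hsymm
  have hp : ∀ q, PosOn C (L q) := fun q z ↦ by
    -- On the closed part of the collar the condition is transported by the collar map; off it, `L
    -- q` agrees with `h q` on an open set.
    by_cases hz : z ∈ M.collarPart c
    · obtain ⟨p, hp, rfl⟩ := hz
      exact (M.localDiffeoOn_collar.posAt_iff M.regularOn_cyl uniqueMDiffOn_univ (hso q)
        (fun p hp ↦ (hcL q p hp).symm) (M.part_subset_cyl hc1 hp)).1 (hpos q p hp)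
    · refine (posAt_congr_of_isOpen (M.isClosed_collarPart hc1).isOpen_compl hz (mem_univ z)
        fun z hz ↦ ?_).2 ((hh q).2 z)
      change (h q).val z + (M.extZero (d q)).val z = (h q).val z
      rw [M.extZero_val_eq_zero (hd0 q) hz.2, add_zero]
  have hres : ∀ q, M.resB (L q) = b q := fun q ↦ funext fun x ↦ by
    obtain ⟨ε, hε, -, he⟩ := hb q
    change (M.resB (L q)).val x = (b q).val x
    refine ContinuousLinearMap.ext fun u ↦ ContinuousLinearMap.ext fun v ↦ ?_
    rw [resB_val_apply, hcL q _ (zero_mem_cyl x), he x 0 le_rfl hε]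
    simp
  -- Positive definiteness comes for free, as it is part of `PosAt`.
  refine ⟨L, hL.continuous, fun q ↦ ⟨mem_metrics_iff.2 ⟨(hso q).isSmoothMetric fun z ↦
    PosIn.posDef (mem_extChartAt_source z) (hp q z), ?_⟩, hp q⟩, hres, hcL, fun q hq ↦ ?_⟩
  · obtain ⟨ε, hε, hε1, he⟩ := hb q
    refine ⟨ε, hε, hε1, fun x t h0 ht ↦ ?_⟩
    rw [hcL q _ ⟨mem_univ _, h0, ht.trans_le hε1⟩, hres]
    exact he x t h0 ht
  · have h0 : ∀ z, (M.extZero (d q)).val z = 0 := fun z ↦ by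
      by_cases hz : z ∈ M.collarImage
      · rw [M.extZero_val_of_mem _ hz]
        refine ContinuousLinearMap.ext fun u ↦ ContinuousLinearMap.ext fun v ↦ ?_
        have : (d q).val (M.retr z) = 0 := sub_eq_zero.2 (hq _ (M.mapsTo_retr hz))
        rw [pull_apply, this]
        rfl
      · exact M.extZero_val_of_notMem _ hz
    funext z
    change (h q).val z + (M.extZero (d q)).val z = (h q).val z
    rw [h0, add_zero]

end Mfd

/-! ### Symmetric forms, products with a line, the tube lemma and cutoff functions. -/

namespace Bil

variable {E F : Type*} [NormedAddCommGroup E] [NormedSpace ℝ E] [NormedAddCommGroup F]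
  [NormedSpace ℝ F] {B B' : Bil E}

theorem Symm.add (h : B.Symm) (h' : B'.Symm) : (B + B').Symm := fun u v ↦ by
  rw [add_apply, add_apply, add_apply, add_apply, h, h']

theorem Symm.sub (h : B.Symm) (h' : B'.Symm) : (B - B').Symm := fun u v ↦ by
  rw [sub_apply, sub_apply, sub_apply, sub_apply, h, h']

theorem Symm.smul (h : B.Symm) (c : ℝ) : (c • B).Symm := fun u v ↦ by
  rw [smul_apply, smul_apply, smul_apply, smul_apply, h]

theorem Symm.prod {β : Bil F} (h : B.Symm) (h' : β.Symm) : (B.prod β).Symm := fun u v ↦ by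
  rw [prod_apply, prod_apply, h, h']

end Bil

theorem mulBil_symm : mulBil.Symm := fun u v ↦ mul_comm u v

/-- Any positive `f` is allowed because all metrics on a line are flat. Hence stretching the height
is harmless wherever the horizontal metric does not depend on it. -/
theorem posAt_prod_lineField {E : Type} [NormedAddCommGroup E] [NormedSpace ℝ E]
    [FiniteDimensional ℝ E] {H : Type} [TopologicalSpace H] {I : ModelWithCorners ℝ E H}
    {N : Type*} [TopologicalSpace N] [ChartedSpace H N] [IsManifold I ∞ N] {C : CurvCond}
    {β : BilinField I N} (hβ : IsSmoothMetric β) {J : Set ℝ} (hJ : UniqueDiffOn ℝ J) {f : ℝ → ℝ}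
    (hf : ContDiffOn ℝ ∞ f J) (hpos : ∀ s ∈ J, 0 < f s) {x : N} {s : ℝ} (hs : s ∈ J) :
    PosAt C (prodField β (lineField f)) (univ ×ˢ J) (x, s) ↔ PosAt C β univ x :=
  posAt_prodField (by simp) uniqueMDiffOn_univ hJ.uniqueMDiffOn hβ.smoothOn
    (smoothOn_const (hf.smul contDiffOn_const) fun s _ u v ↦ by
      simp [mul_comm u v])
    (fun x _ ↦ hβ.posDef x) (fun s hs ↦ mulBil_posDef (hpos s hs)) ⟨mem_univ _, hs⟩

/-- The tube lemma around the slice at time zero; it makes the choices of small parameters uniform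
over a compact space. -/
theorem exists_pos_forall_of_eventually {Q : Type*} [TopologicalSpace Q] [CompactSpace Q]
    {P : Q × ℝ → Prop} (h : ∀ q, ∀ᶠ p in 𝓝 (q, (0 : ℝ)), P p) :
    ∃ t₁ > 0, ∀ q t, |t| ≤ t₁ → P (q, t) := by
  have h1 := isCompact_univ.eventually_forall_of_forall_eventually (x₀ := (0 : ℝ))
    (P := fun t q ↦ P (q, t)) (K := (univ : Set Q)) fun q _ ↦
      (continuous_swap.tendsto ((0 : ℝ), q)).eventually (h q)
  obtain ⟨ε, hε, h2⟩ := Metric.eventually_nhds_iff.1 h1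
  refine ⟨ε / 2, half_pos hε, fun q t ht ↦ h2 ?_ q (mem_univ q)⟩
  rw [Real.dist_eq, sub_zero]
  linarith

/-- The projection of the real line to `[0, T]`. -/
def clamp (T t : ℝ) : ℝ := max 0 (min t T)

theorem continuous_clamp (T : ℝ) : Continuous (clamp T) := by
  unfold clamp
  fun_prop

theorem clamp_nonneg (T t : ℝ) : 0 ≤ clamp T t := le_max_left _ _

theorem clamp_le {T : ℝ} (hT : 0 ≤ T) (t : ℝ) : clamp T t ≤ T := max_le hT (min_le_right _ _)

theorem clamp_of_mem {T t : ℝ} (h0 : 0 ≤ t) (hT : t ≤ T) : clamp T t = t := by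
  rw [clamp, min_eq_left hT, max_eq_right h0]

/-- A smooth function that is `1` up to `a` and `0` from `b` on, for `a < b`. -/
def cutoff (a b s : ℝ) : ℝ := Real.smoothTransition ((b - s) / (b - a))

theorem contDiff_cutoff (a b : ℝ) : ContDiff ℝ ∞ (cutoff a b) :=
  Real.smoothTransition.contDiff.comp (by fun_prop)

theorem cutoff_of_le {a b s : ℝ} (hab : a < b) (hs : s ≤ a) : cutoff a b s = 1 :=
  Real.smoothTransition.one_of_one_le ((one_le_div (sub_pos.2 hab)).2 (by linarith))

theorem cutoff_of_ge {a b s : ℝ} (hab : a < b) (hs : b ≤ s) : cutoff a b s = 0 :=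
  Real.smoothTransition.zero_of_nonpos (div_nonpos_of_nonpos_of_nonneg (by linarith)
    (sub_pos.2 hab).le)

theorem cutoff_mem (a b s : ℝ) : cutoff a b s ∈ Icc (0 : ℝ) 1 :=
  ⟨Real.smoothTransition.nonneg _, Real.smoothTransition.le_one _⟩

/-! ### Curvature of the boundary metric, and creation of a uniform product collar. -/

namespace Mfd

variable {M : Mfd.{u}} [Nonempty M.bd] {C : CurvCond}

theorem posAt_cpull {g : M.Form} (hg : g ∈ M.curvMetrics C) {p : M.bd × ℝ} (hp : p ∈ cyl M.bd) :
    PosAt C (M.cpull g) (cyl M.bd) p :=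
  (M.localDiffeoOn_collar.posAt_iff M.regularOn_cyl uniqueMDiffOn_univ
    (mem_metrics_iff.1 hg.1).1.smoothOn (fun _ _ ↦ rfl) hp).2 (hg.2 _)

theorem symm_cpull {g : M.Form} (hg : g ∈ M.metrics) (p : M.bd × ℝ) : ((M.cpull g).val p).Symm :=
  fun _ _ ↦ ((isSmoothMetric_iff g).1 hg.1).1 _ _ _

theorem val_prod_lineField (β : M.BdForm) (f : ℝ → ℝ) (p : M.bd × ℝ) :
    (prodField β (lineField f)).val p = Bil.prod (β.val p.1) (f p.2 • mulBil) := rfl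

theorem isSmoothMetric_resB {g : M.Form} (hg : g ∈ M.curvMetrics C) :
    IsSmoothMetric (M.resB g) := by
  obtain ⟨hs, ε, hε, -, he⟩ := mem_metrics_iff.1 hg.1
  have h1 := M.smoothFam_resB (Q := Unit) (smoothFam_of_mem continuous_const fun _ ↦ hs)
  refine SmoothOn.isSmoothMetric ⟨h1.contDiffOn uniqueMDiffOn_univ (), fun x _ u v ↦ ?_⟩
    fun x ↦ ?_
  · rw [resB_val_apply, resB_val_apply]
    exact symm_cpull hg.1 _ _ _
  · have h2 : ((M.cpull g).val (x, 0)).PosDef :=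
      PosIn.posDef (mem_extChartAt_source _) (posAt_cpull hg (zero_mem_cyl x))
    rw [he x 0 le_rfl hε] at h2
    exact h2.of_prod_left

/-- Near the boundary the metric is the product of its restriction with `ds²`, so insensitivity to
lines, read from the product to the factor, gives the claim. -/
theorem posOn_resB {g : M.Form} (hg : g ∈ M.curvMetrics C) : PosOn C (M.resB g) := fun x ↦ by
  obtain ⟨hs, ε, hε, -, he⟩ := mem_metrics_iff.1 hg.1
  have h1 := posAt_cpull hg (zero_mem_cyl x)
  have hO : IsOpen (univ ×ˢ Iio ε : Set (M.bd × ℝ)) := isOpen_univ.prod isOpen_Iio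
  have h2 := (posAt_congr_of_isOpen (C := C) (g' := prodField (M.resB g) (lineField fun _ ↦ 1)) hO
    (x := (x, (0 : ℝ))) ⟨mem_univ _, hε⟩ (zero_mem_cyl x) fun p hp ↦ by
      rw [val_prod_lineField, one_smul]
      exact he p.1 p.2 hp.1.2.1 hp.2.2).1 h1
  exact (posAt_prod_lineField (isSmoothMetric_resB hg) uniqueDiffOn_Ico contDiffOn_const
    (fun _ _ ↦ one_pos) (zero_mem_cyl x).2).1 h2

theorem EqProd.congr {w w' : M.CylForm} {β : M.BdForm} {ε : ℝ} (h : EqProd w β ε) (hε : ε ≤ 1)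
    (hw : ∀ p ∈ cyl M.bd, w'.val p = w.val p) : EqProd w' β ε := fun x t h0 ht ↦
  (hw _ ⟨mem_univ _, h0, ht.trans_le hε⟩).trans (h x t h0 ht)

section Short

variable {Q : Type*} [TopologicalSpace Q] {h : Q → M.Form} (hc : Continuous h)
  (hh : ∀ q, h q ∈ M.curvMetrics C) {b : Q × ℝ → M.BdForm} (hbc : Continuous b)
  (hb : ∀ p, IsSmoothMetric (b p)) (hbh : ∀ q, M.resB (h q) = b (q, 0))

include hc hh hbc hb hbh

open scoped Classical in
/-- A smooth family of fields on the cylinder that starts at a given family of metrics, and whose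
boundary values follow a given path. -/
theorem exists_short_family : ∃ W : Q × ℝ → M.CylForm, SmoothFam W (cyl M.bd) ∧
    (∀ p, ∀ z ∈ cyl M.bd, ((W p).val z).Symm) ∧
    (∀ p, ∀ z ∈ cyl M.bd, 3 / 4 ≤ z.2 → (W p).val z = (M.cpull (h p.1)).val z) ∧
    (∀ q, ∀ z ∈ cyl M.bd, (W (q, 0)).val z = (M.cpull (h q)).val z) ∧
    ∀ q t, 0 < t → EqProd (W (q, t)) (b (q, t)) (min t (1 / 2)) := by
  -- The deviation of the given metric from the product metric. It vanishes up to a height depending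
  -- on `q`, and `w` extends it by zero to negative heights.
  let v : Q → M.CylForm := fun q ↦ .ofVal M.IC fun p ↦
    (prodField (b (q, 0)) (lineField fun _ ↦ 1)).val p - (M.cpull (h q)).val p
  let w : Q → M.CylForm := fun q ↦ .ofVal M.IC fun p ↦ if 0 ≤ p.2 then (v q).val p else 0
  let χ : ℝ → ℝ := cutoff (1 / 2) (3 / 4)
  -- Besides the change of the boundary metric, `W` adds `w` minus its translate by `t` into the
  -- interior. Below height `min t (1/2)` the cutoff is `1` and the translate is zero, so adding `w`
  -- corrects the given metric to `b (q, 0) + ds²` and the result is exactly `b (q, t) + ds²`. The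
  -- maximum with `0` defines the family for negative times as well.
  let W : Q × ℝ → M.CylForm := fun p ↦ .ofVal M.IC fun z ↦ (M.cpull (h p.1)).val z +
    χ z.2 • (((w p.1).val (z.1, z.2) - (w p.1).val (z.1, z.2 - max p.2 0)) +
      ((horField (b (p.1, max p.2 0))).val z - (horField (b (p.1, 0))).val z))
  have hX : UniqueMDiffOn M.IB (univ : Set M.bd) := uniqueMDiffOn_univ
  have hJ : UniqueDiffOn ℝ (Ico (0 : ℝ) 1) := uniqueDiffOn_Ico
  have hcyl := M.regularOn_cyl.1
  have hbs : SmoothFam b univ := smoothFam_boundary_of_mem hbc hb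
  have hcs := M.smoothFam_cpull (smoothFam_of_mem hc fun q ↦ (hh q).1.1)
  have hb0 : SmoothFam (fun q ↦ b (q, 0)) univ := hbs.reparam (by fun_prop)
  have hv : SmoothFam v (cyl M.bd) :=
    (smoothFam_prod_lineField (f := fun _ _ ↦ 1) hX hJ hb0
      fun n ↦ .const hJ contDiffOn_const).sub hcyl hcs
  have hv0 : ∀ q, ∃ ε > 0, ∀ p ∈ (univ ×ˢ Ico (0 : ℝ) 1 : Set (M.bd × ℝ)), p.2 < ε →
      (v q).val p = 0 := fun q ↦ by
    obtain ⟨-, ε, hε, -, he⟩ := mem_metrics_iff.1 (hh q).1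
    refine ⟨ε, hε, fun p hp hpε ↦ sub_eq_zero.2 ?_⟩
    rw [val_prod_lineField, one_smul, ← hbh]
    exact (he p.1 p.2 hp.2.1 hpε).symm
  have hw : SmoothFam w (univ ×ˢ Iio 1) := hv.extend_zero hX hv0
  have hw1 : SmoothFam (fun p : Q × ℝ ↦ w p.1) (univ ×ˢ Iio 1) := hw.reparam continuous_fst
  have h1 : SmoothFam (fun p : Q × ℝ ↦ .ofVal M.IC fun z ↦ (w p.1).val (z.1, z.2)) (cyl M.bd) :=
    hw1.comp_height (φ := fun _ s ↦ s) hX hJ (fun n ↦ .const hJ contDiffOn_id) fun _ s hs ↦ hs.2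
  have h2 : SmoothFam (fun p : Q × ℝ ↦ .ofVal M.IC fun z ↦
      (w p.1).val (z.1, z.2 - max p.2 0)) (cyl M.bd) := by
    refine hw1.comp_height (φ := fun p s ↦ s - max p.2 0) hX hJ (fun n ↦ ?_) fun p s hs ↦ ?_
    · exact ((FamOn.const hJ contDiffOn_id).add hJ (.param hJ (c := fun p : Q × ℝ ↦ -max p.2 0)
        (by fun_prop))).congr fun q s _ ↦ by simp [sub_eq_add_neg]
    · have := le_max_right p.2 0
      have := hs.2
      change s - max p.2 0 < 1
      linarith
  have h3 : SmoothFam (fun p : Q × ℝ ↦ horField (b (p.1, max p.2 0))) (cyl M.bd) :=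
    smoothFam_horField hX hJ (hbs.reparam (by fun_prop))
  have h4 : SmoothFam (fun p : Q × ℝ ↦ horField (b (p.1, 0))) (cyl M.bd) :=
    smoothFam_horField hX hJ (hbs.reparam (by fun_prop))
  have hW : SmoothFam W (cyl M.bd) :=
    (hcs.reparam continuous_fst).add hcyl (((h1.sub hcyl h2).add hcyl (h3.sub hcyl h4)).smul_height
      (χ := fun _ ↦ χ) hX hJ fun n ↦ .const hJ (contDiff_cutoff _ _).contDiffOn)
  have hbsymm : ∀ p x, ((b p).val x).Symm := fun p ↦ ((isSmoothMetric_iff (b p)).1 (hb p)).1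
  have hwsymm : ∀ q z, ((w q).val z).Symm := fun q z ↦ by
    change Bil.Symm (if 0 ≤ z.2 then (v q).val z else 0)
    split_ifs
    · exact ((hbsymm _ _).prod (mulBil_symm.smul 1)).sub (symm_cpull (hh q).1 z)
    · exact fun _ _ ↦ rfl
  refine ⟨W, hW, fun p z _ ↦ ?_, fun p z _ hz ↦ ?_, fun q z _ ↦ ?_, fun q t ht x s h0 hs ↦ ?_⟩
  · exact (symm_cpull (hh _).1 z).add ((((hwsymm _ _).sub (hwsymm _ _)).add
      (((hbsymm _ _).prod fun _ _ ↦ rfl).sub ((hbsymm _ _).prod fun _ _ ↦ rfl))).smul _)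
  · have : χ z.2 = 0 := cutoff_of_ge (by norm_num) hz
    simp [W, this]
  · simp [W]
  · have hχ : χ s = 1 := cutoff_of_le (by norm_num) (hs.le.trans (min_le_right _ _))
    have hst : s < t := hs.trans_le (min_le_left _ _)
    have hw0 : (w q).val (x, s - max t 0) = 0 := if_neg (by
      rw [max_eq_left ht.le]
      simpa using hst)
    have hws : (w q).val (x, s) = (v q).val (x, s) := if_pos h0
    change (M.cpull (h q)).val (x, s) + χ s • (((w q).val (x, s) - (w q).val (x, s - max t 0)) +
      ((horField (b (q, max t 0))).val (x, s) - (horField (b (q, 0))).val (x, s))) = _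
    rw [hχ, hw0, hws, max_eq_left ht.le]
    change (M.cpull (h q)).val (x, s) + (1 : ℝ) • ((((b (q, 0)).val x).prod ((1 : ℝ) • mulBil) -
      (M.cpull (h q)).val (x, s) - 0) + (Bil.prod ((b (q, t)).val x) 0 -
        Bil.prod ((b (q, 0)).val x) 0)) = _
    refine ContinuousLinearMap.ext fun u ↦ ContinuousLinearMap.ext fun v ↦ ?_
    simp
    ring

end Short

end Mfd

/-! ### Rescaling the height of a cylinder. -/

section Stretch

variable {E : Type} [NormedAddCommGroup E] [NormedSpace ℝ E]
  {H : Type} [TopologicalSpace H] {I : ModelWithCorners ℝ E H}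
  {N : Type*} [TopologicalSpace N] [ChartedSpace H N] [IsManifold I ∞ N]

theorem derivAt_stretch (K s₀ : ℝ) {X : Set (N × ℝ)} (hX : UniqueMDiffOn (I.prod 𝓘(ℝ, ℝ)) X)
    {z : N × ℝ} (hz : z ∈ X) (u : E × ℝ) :
    derivAt (I.prod 𝓘(ℝ, ℝ)) (I.prod 𝓘(ℝ, ℝ)) (fun z : N × ℝ ↦ (z.1, K * (z.2 - s₀))) X z u =
      (u.1, K * u.2) := by
  have h0 : HasFDerivAt (fun s : ℝ ↦ K * (s - s₀)) (K • ContinuousLinearMap.id ℝ ℝ) z.2 :=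
    ((hasFDerivAt_id z.2).sub_const s₀).const_mul K
  have h2 := ((hasMFDerivAt_fst (I := I) (I' := 𝓘(ℝ, ℝ)) (x := z)).prodMk
    (h0.hasMFDerivAt.comp z (hasMFDerivAt_snd (I := I) (I' := 𝓘(ℝ, ℝ)) (x := z)))
    ).hasMFDerivWithinAt (s := X)
  exact DFunLike.congr_fun (h2.mfderivWithin (hX z hz)) u

variable [FiniteDimensional ℝ E]

/-- A change of the scale of the height of a cylinder. -/
theorem posAt_stretch {C : CurvCond} {g w : BilinField (I.prod 𝓘(ℝ, ℝ)) (N × ℝ)}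
    (hg : SmoothOn g univ) {X : Set (N × ℝ)} (hX : RegularOn (I.prod 𝓘(ℝ, ℝ)) X) {K : ℝ}
    (hK : 0 < K) (s₀ : ℝ) (h : ∀ z ∈ X, ∀ u v : E × ℝ,
      w.val z u v = g.val (z.1, K * (z.2 - s₀)) (u.1, K * u.2) (v.1, K * v.2))
    {z : N × ℝ} (hz : z ∈ X) : PosAt C w X z ↔ PosAt C g univ (z.1, K * (z.2 - s₀)) := by
  have hf : LocalDiffeoOn (I.prod 𝓘(ℝ, ℝ)) (I.prod 𝓘(ℝ, ℝ))
      (fun z : N × ℝ ↦ (z.1, K * (z.2 - s₀))) X univ := by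
    refine ⟨(contMDiff_fst.prodMk ?_).contMDiffOn, fun _ _ ↦ mem_univ _, fun z hz ↦ ⟨?_, ?_⟩⟩
    · have : ContDiff ℝ ∞ fun s : ℝ ↦ K * (s - s₀) := by fun_prop
      exact this.contMDiff.comp contMDiff_snd
    · intro u v huv
      have huv' : ((u.1, K * u.2) : E × ℝ) = (v.1, K * v.2) := by
        rw [← derivAt_stretch K s₀ hX.1 hz, ← derivAt_stretch K s₀ hX.1 hz]
        exact huv
      exact Prod.ext (Prod.ext_iff.1 huv').1 (mul_left_cancel₀ hK.ne' (Prod.ext_iff.1 huv').2)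
    · intro v
      refine ⟨(v.1, K⁻¹ * v.2), ?_⟩
      rw [derivAt_stretch K s₀ hX.1 hz, mul_inv_cancel_left₀ hK.ne']
  refine hf.posAt_iff hX uniqueMDiffOn_univ hg (fun z hz ↦ ?_) hz
  refine ContinuousLinearMap.ext fun u ↦ ContinuousLinearMap.ext fun v ↦ ?_
  rw [pull_apply, derivAt_stretch K s₀ hX.1 hz, derivAt_stretch K s₀ hX.1 hz, h z hz]

end Stretch

/-! ### The short lift, and segments of boundary metrics. -/

namespace Mfd

variable {M : Mfd.{u}} {C : CurvCond} {Q : Type*} [TopologicalSpace Q]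

/-- By openness, the family from `exists_short_family` satisfies the curvature condition for small
times, uniformly over the compact space `Q`. The essential gain is the last clause: a product collar
of the same width `δ` for all `q`. The end time `t₂` is left free so that it can be fitted to a
prescribed interval. -/
theorem exists_short_lift [Nonempty M.bd] [CompactSpace Q] {h : Q → M.Form} (hc : Continuous h)
    (hh : ∀ q, h q ∈ M.curvMetrics C) {b : Q × ℝ → M.BdForm} (hbc : Continuous b)
    (hb : ∀ p, IsSmoothMetric (b p)) (hbh : ∀ q, M.resB (h q) = b (q, 0)) :
    ∃ t₁ > 0, ∀ t₂, 0 < t₂ → t₂ ≤ t₁ → ∃ L : Q × ℝ → M.Form, Continuous L ∧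
      (∀ p, L p ∈ M.curvMetrics C) ∧ (∀ q t, M.resB (L (q, t)) = b (q, clamp t₂ t)) ∧
      (∀ q, L (q, 0) = h q) ∧
      ∃ δ : ℝ, 0 < δ ∧ δ ≤ 1 ∧ ∀ q, EqProd (M.cpull (L (q, t₂))) (b (q, t₂)) δ := by
  obtain ⟨W, hW, hWs, hWc, hW0, hWb⟩ := exists_short_family hc hh hbc hb hbh
  obtain ⟨t₁, ht₁, hpos⟩ := exists_pos_forall_of_eventually (Q := Q)
    (P := fun p ↦ ∀ z ∈ (univ ×ˢ Icc 0 (3 / 4) : Set (M.bd × ℝ)), PosAt C (W p) (cyl M.bd) z)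
    fun q ↦ hW.eventually_forall_posAt M.regularOn_cyl hWs (M.isCompact_part _)
      (M.part_subset_cyl (by norm_num)) fun z hz ↦ by
        have hz' := M.part_subset_cyl (by norm_num) hz
        exact (posAt_congr hz' (hW0 q)).2 (posAt_cpull (hh q) hz')
  refine ⟨t₁, ht₁, fun t₂ h0 h2 ↦ ?_⟩
  have hcl : Continuous fun p : Q × ℝ ↦ (p.1, clamp t₂ p.2) :=
    continuous_fst.prodMk ((continuous_clamp t₂).comp continuous_snd)
  obtain ⟨L, hLc, hLm, hLr, hLp, hLe⟩ := exists_replace (M := M) (C := C) (Q := Q × ℝ)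
    (h := fun p ↦ h p.1) (hc.comp continuous_fst) (fun p ↦ hh p.1)
    (w := fun p ↦ W (p.1, clamp t₂ p.2)) (hW.reparam hcl) (fun p ↦ hWs _) (c := 3 / 4)
    (by norm_num) (fun p ↦ hWc (p.1, clamp t₂ p.2))
    (fun p ↦ hpos p.1 (clamp t₂ p.2) (by
      rw [abs_of_nonneg (clamp_nonneg _ _)]
      exact (clamp_le h0.le _).trans h2))
    (b := fun p ↦ b (p.1, clamp t₂ p.2)) (fun p ↦ by
      -- At time zero the product region is that of the given metric, at positive times it is the
      -- one created by the deformation.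
      rcases (clamp_nonneg t₂ p.2).eq_or_lt with h | h
      · obtain ⟨-, ε, hε, hε1, he⟩ := mem_metrics_iff.1 (hh p.1).1
        refine ⟨ε, hε, hε1, ?_⟩
        rw [← h, ← hbh]
        exact he.congr hε1 (hW0 p.1)
      · exact ⟨_, lt_min h (by norm_num), (min_le_right _ _).trans (by norm_num), hWb p.1 _ h⟩)
  have hc0 : clamp t₂ 0 = 0 := clamp_of_mem le_rfl h0.le
  have hc2 : clamp t₂ t₂ = t₂ := clamp_of_mem h0.le le_rfl
  refine ⟨L, hLc, hLm, fun q t ↦ hLr (q, t), fun q ↦ hLe (q, 0) fun z hz ↦ ?_, min t₂ (1 / 2),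
    lt_min h0 (by norm_num), (min_le_right _ _).trans (by norm_num), fun q ↦ ?_⟩
  · change (W (q, clamp t₂ 0)).val z = _
    rw [hc0]
    exact hW0 q z hz
  · refine EqProd.congr (hWb q t₂ h0) ((min_le_right _ _).trans (by norm_num)) fun z hz ↦ ?_
    rw [hLp (q, t₂) z hz, hc2]

/-- The segment between the fields `β` and `β'`. -/
def seg (β β' : M.BdForm) (ρ : ℝ) : M.BdForm :=
  .ofVal M.IB fun x ↦ β.val x + ρ • (β'.val x - β.val x)

theorem seg_zero (β β' : M.BdForm) : seg β β' 0 = β :=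
  funext fun x ↦ by
    change β.val x + (0 : ℝ) • (β'.val x - β.val x) = β.val x
    simp

theorem seg_one (β β' : M.BdForm) : seg β β' 1 = β' :=
  funext fun x ↦ by
    change β.val x + (1 : ℝ) • (β'.val x - β.val x) = β'.val x
    simp

theorem seg_self (β : M.BdForm) (ρ : ℝ) : seg β β ρ = β :=
  funext fun x ↦ by
    change β.val x + ρ • (β.val x - β.val x) = β.val x
    simp

theorem smoothFam_seg {β β' : Q → M.BdForm} (h : SmoothFam β univ) (h' : SmoothFam β' univ)
    {ρ : Q → ℝ} (hρ : Continuous ρ) : SmoothFam (fun q ↦ seg (β q) (β' q) (ρ q)) univ :=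
  h.add uniqueMDiffOn_univ ((h'.sub uniqueMDiffOn_univ h).const_smul uniqueMDiffOn_univ hρ)

theorem symm_seg {β β' : M.BdForm} (h : ∀ x, (β.val x).Symm) (h' : ∀ x, (β'.val x).Symm) (ρ : ℝ)
    (x : M.bd) : ((seg β β' ρ).val x).Symm := (h x).add (((h' x).sub (h x)).smul ρ)

theorem isSmoothMetric_seg {β β' : M.BdForm} (h : IsSmoothMetric β) (h' : IsSmoothMetric β')
    {ρ : ℝ} (hp : PosOn C (seg β β' ρ)) : IsSmoothMetric (seg β β' ρ) := by
  have h1 := smoothFam_seg (Q := Unit) (ρ := fun _ ↦ ρ)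
    (h.smoothOn.smoothFam Unit uniqueMDiffOn_univ) (h'.smoothOn.smoothFam Unit uniqueMDiffOn_univ)
    continuous_const
  exact SmoothOn.isSmoothMetric ⟨h1.contDiffOn uniqueMDiffOn_univ (), fun x _ ↦
    symm_seg ((isSmoothMetric_iff _).1 h).1 ((isSmoothMetric_iff _).1 h').1 ρ x⟩
    fun x ↦ PosIn.posDef (mem_extChartAt_source x) (hp x)

end Mfd

theorem FamOn.mul {Q : Type*} [TopologicalSpace Q] {E : Type} [NormedAddCommGroup E]
    [NormedSpace ℝ E] {n : ℕ} {T : Set E} (hT : UniqueDiffOn ℝ T) {f g : Q → E → ℝ}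
    (hf : FamOn n f T) (hg : FamOn n g T) : FamOn n (fun q y ↦ f q y * g q y) T :=
  FamOn.bilinear hT (ContinuousLinearMap.mul ℝ ℝ) hf hg

/-! ### Interpolation of boundary metrics along a stretched collar. -/

namespace Mfd

variable {M : Mfd.{u}} {C : CurvCond} {Q : Type*} [TopologicalSpace Q]

/-- The field on the cylinder that is, at height `s`, the sum of the field at time `χ s` on the
segment between `β` and `β'`, and of `f(s) ds²`. -/
def mixField (β β' : M.BdForm) (χ f : ℝ → ℝ) : M.CylForm :=
  .ofVal M.IC fun z ↦ Bil.prod ((seg β β' (χ z.2)).val z.1) (f z.2 • mulBil)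

theorem mixField_val (β β' : M.BdForm) (χ f : ℝ → ℝ) (z : M.bd × ℝ) :
    (mixField β β' χ f).val z = Bil.prod ((seg β β' (χ z.2)).val z.1) (f z.2 • mulBil) := rfl

theorem mixField_val_eq {β β' : M.BdForm} {χ f : ℝ → ℝ} {z : M.bd × ℝ} {ρ : ℝ} (h : χ z.2 = ρ) :
    (mixField β β' χ f).val z = (prodField (seg β β' ρ) (lineField f)).val z := by
  rw [← h]
  rfl

theorem smoothFam_mixField {β β' : Q → M.BdForm} (h : SmoothFam β univ) (h' : SmoothFam β' univ)
    {J : Set ℝ} (hJ : UniqueDiffOn ℝ J) {χ f : Q → ℝ → ℝ} (hχ : ∀ n, FamOn n χ J)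
    (hf : ∀ n, FamOn n f J) :
    SmoothFam (fun q ↦ mixField (β q) (β' q) (χ q) (f q)) (univ ×ˢ J) := by
  have hX : UniqueMDiffOn M.IB (univ : Set M.bd) := uniqueMDiffOn_univ
  have hXJ : UniqueMDiffOn M.IC (univ ×ˢ J : Set (M.bd × ℝ)) := hX.prod hJ.uniqueMDiffOn
  refine ((smoothFam_prod_lineField hX hJ h hf).add hXJ
    (((smoothFam_horField hX hJ h').sub hXJ (smoothFam_horField hX hJ h)).smul_height hX hJ
      hχ)).congr fun q z _ ↦ ?_
  change Bil.prod ((β q).val z.1 + χ q z.2 • ((β' q).val z.1 - (β q).val z.1))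
    (f q z.2 • mulBil) = Bil.prod ((β q).val z.1) (f q z.2 • mulBil) +
      χ q z.2 • (Bil.prod ((β' q).val z.1) 0 - Bil.prod ((β q).val z.1) 0)
  refine ContinuousLinearMap.ext fun u ↦ ContinuousLinearMap.ext fun v ↦ ?_
  simp
  ring

theorem symm_mixField {β β' : M.BdForm} (h : ∀ x, (β.val x).Symm) (h' : ∀ x, (β'.val x).Symm)
    (χ f : ℝ → ℝ) (z : M.bd × ℝ) : ((mixField β β' χ f).val z).Symm :=
  (symm_seg h h' _ _).prod (mulBil_symm.smul _)

/-- Where the profile `χ` is locally constant, the field is a product of a fixed admissible metric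
with a line. -/
theorem posAt_mixField {β β' : M.BdForm} {ρ : ℝ} (hs : IsSmoothMetric (seg β β' ρ))
    (hp : PosOn C (seg β β' ρ)) {J O : Set ℝ} (hJ : UniqueDiffOn ℝ J) (hO : IsOpen O)
    {χ f : ℝ → ℝ} (hχ : ∀ s ∈ J ∩ O, χ s = ρ) (hf : ContDiff ℝ ∞ f) (hf0 : ∀ s, 0 < f s)
    {z : M.bd × ℝ} (hz : z.2 ∈ J ∩ O) : PosAt C (mixField β β' χ f) (univ ×ˢ J) z :=
  (posAt_congr_of_isOpen (isOpen_univ.prod hO) (X := univ ×ˢ J) (x := z)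
    ⟨mem_univ _, hz.2⟩ ⟨mem_univ _, hz.1⟩
    fun _ hz ↦ mixField_val_eq (hχ _ ⟨hz.1.2, hz.2.2⟩)).2
      ((posAt_prod_lineField hs hJ hf.contDiffOn (fun s _ ↦ hf0 s) (x := z.1) (s := z.2) hz.1).2
        (hp z.1))

/-- The new height `σ = K (s' - s)` around `s` turns `K² ds'²` into `dσ²` and slows the profile down
to `ρ (s + K⁻¹ σ)`. As every `s` serves as its own origin, only `σ = 0` needs to be examined. -/
theorem posAt_mixField_of_stretch {β β' : M.BdForm} (hβ : IsSmoothMetric β)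
    (hβ' : IsSmoothMetric β') {ρ f : ℝ → ℝ} (hρ : ContDiff ℝ ∞ ρ) {J O : Set ℝ} (hO : IsOpen O)
    {K : ℝ} (hK : 0 < K) (hOJ : O ⊆ J) (hf : ∀ s ∈ O, f s = K ^ 2) {x : M.bd} {s : ℝ} (hs : s ∈ O)
    (h : PosAt C (mixField β β' (fun σ ↦ ρ (s + K⁻¹ * σ)) fun _ ↦ 1) univ (x, 0)) :
    PosAt C (mixField β β' ρ f) (univ ×ˢ J) (x, s) := by
  have hXO : IsOpen (univ ×ˢ O : Set (M.bd × ℝ)) := isOpen_univ.prod hO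
  have hsub : (univ ×ˢ J ∩ univ ×ˢ O : Set (M.bd × ℝ)) = univ ×ˢ O :=
    inter_eq_right.2 (prod_mono_right hOJ)
  rw [← posAt_inter hXO (X := univ ×ˢ J) (x := (x, s)) ⟨mem_univ _, hs⟩ ⟨mem_univ _, hOJ hs⟩, hsub,
    posAt_stretch (g := mixField β β' (fun σ ↦ ρ (s + K⁻¹ * σ)) fun _ ↦ 1) ?_ hXO.regularOn hK s
      ?_ ⟨mem_univ _, hs⟩, sub_self, mul_zero]
  · exact h
  · have h1 := smoothFam_mixField (Q := Unit) (χ := fun _ σ ↦ ρ (s + K⁻¹ * σ)) (f := fun _ _ ↦ 1)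
      (hβ.smoothOn.smoothFam Unit uniqueMDiffOn_univ)
      (hβ'.smoothOn.smoothFam Unit uniqueMDiffOn_univ) uniqueDiffOn_univ
      (fun n ↦ .const uniqueDiffOn_univ (hρ.comp (by fun_prop)).contDiffOn)
      (fun n ↦ .const uniqueDiffOn_univ contDiffOn_const)
    rw [univ_prod_univ] at h1
    exact h1.smoothOn uniqueMDiffOn_univ (fun _ z _ ↦ symm_mixField ((isSmoothMetric_iff _).1 hβ).1
      ((isSmoothMetric_iff _).1 hβ').1 _ _ z) ()
  · rintro ⟨y, σ⟩ hy u v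
    have hσ : s + K⁻¹ * (K * (σ - s)) = σ := by
      rw [inv_mul_cancel_left₀ hK.ne']
      ring
    rw [mixField_val, mixField_val, Bil.prod_apply, Bil.prod_apply]
    simp only [hσ, hf σ hy.2]
    change _ + K ^ 2 * (u.2 * v.2) = _ + 1 * (K * u.2 * (K * v.2))
    ring

/-- The field depends on `(q, t)`, `s` and `κ = K⁻¹`, and is a product with a line in two cases: for
`t = 0`, when the segment is constant, and for `κ = 0`, when the profile is. By openness every `κ ∈
[0, 1]` is admissible for small `t`, and a small `κ` is admissible for all `t`. So `K` can start at
`1` and become large before it has to be. -/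
theorem exists_stretch_factor [CompactSpace Q] {b : Q × ℝ → M.BdForm} (hbc : Continuous b)
    (hb : ∀ p, IsSmoothMetric (b p))
    (hseg : ∀ q, ∀ t ∈ Icc (0 : ℝ) 1, ∀ ρ ∈ Icc (0 : ℝ) 1, PosOn C (seg (b (q, 0)) (b (q, t)) ρ))
    {ρ : ℝ → ℝ} (hρ : ContDiff ℝ ∞ ρ) (hρ' : ∀ s, ρ s ∈ Icc (0 : ℝ) 1) :
    ∃ K : ℝ → ℝ, Continuous K ∧ K 0 = 1 ∧ (∀ t, 1 ≤ K t) ∧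
      ∀ q, ∀ t ∈ Icc (0 : ℝ) 1, ∀ s ∈ Icc (0 : ℝ) 1, ∀ x,
        PosAt C (mixField (b (q, 0)) (b (q, t)) (fun σ ↦ ρ (s + (K t)⁻¹ * σ)) fun _ ↦ 1) univ
          (x, 0) := by
  have hbs : SmoothFam b univ := smoothFam_boundary_of_mem hbc hb
  have hbsymm : ∀ p x, ((b p).val x).Symm := fun p ↦ ((isSmoothMetric_iff (b p)).1 (hb p)).1
  let V : (Q × ℝ) × (ℝ × ℝ) → M.CylForm := fun p ↦
    mixField (b (p.1.1, 0)) (b p.1) (fun σ ↦ ρ (p.2.1 + p.2.2 * σ)) fun _ ↦ 1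
  have hU := uniqueDiffOn_univ (𝕜 := ℝ) (E := ℝ)
  have hV : SmoothFam V univ := by
    rw [← univ_prod_univ]
    refine smoothFam_mixField (hbs.reparam (by fun_prop)) (hbs.reparam continuous_fst) hU
      (fun n ↦ ?_) fun n ↦ .const hU contDiffOn_const
    refine FamOn.comp (F := fun _ ↦ ρ) (T' := univ) hU (.const hU hρ.contDiffOn) ?_
      fun _ _ _ ↦ mem_univ _
    exact (FamOn.param hU (by fun_prop)).add hU
      ((FamOn.param hU (by fun_prop)).mul hU (.const hU contDiffOn_id))
  have hVs : ∀ p, ∀ z ∈ (univ : Set (M.bd × ℝ)), ((V p).val z).Symm := fun p z _ ↦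
    symm_mixField (hbsymm _) (hbsymm _) _ _ z
  have hK : IsCompact (univ ×ˢ {0} : Set (M.bd × ℝ)) := isCompact_univ.prod isCompact_singleton
  -- Openness around any parameter at which the field is an honest product; both limiting cases
  -- below use it.
  have hmix : ∀ p : (Q × ℝ) × (ℝ × ℝ), (∀ σ, (V p).val σ = (prodField (seg (b (p.1.1, 0)) (b p.1)
      (ρ p.2.1)) (lineField fun _ ↦ 1)).val σ) → p.1.2 ∈ Icc (0 : ℝ) 1 → ∀ᶠ p' in 𝓝 p,
        ∀ z ∈ (univ ×ˢ {0} : Set (M.bd × ℝ)), PosAt C (V p') univ z := fun p hp ht ↦ by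
    refine hV.eventually_forall_posAt isOpen_univ.regularOn hVs hK (subset_univ _) fun z _ ↦ ?_
    have h1 := hseg p.1.1 p.1.2 ht (ρ p.2.1) (hρ' _)
    rw [posAt_congr (mem_univ z) fun z _ ↦ hp z, ← univ_prod_univ]
    exact (posAt_prod_lineField (isSmoothMetric_seg (hb _) (hb _) h1) hU contDiffOn_const
      (fun _ _ ↦ one_pos) (x := z.1) (mem_univ z.2)).2 (h1 z.1)
  obtain ⟨t₂, ht₂, h1⟩ := exists_pos_forall_of_eventually
    (Q := Q × (Icc (0 : ℝ) 1 × Icc (0 : ℝ) 1)) (P := fun p ↦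
      ∀ z ∈ (univ ×ˢ {0} : Set (M.bd × ℝ)), PosAt C (V ((p.1.1, p.2), (p.1.2.1, p.1.2.2))) univ z)
    fun q ↦ by
      have hcont : Continuous fun p : (Q × (Icc (0 : ℝ) 1 × Icc (0 : ℝ) 1)) × ℝ ↦
        (((p.1.1, p.2), ((p.1.2.1 : ℝ), (p.1.2.2 : ℝ))) : (Q × ℝ) × (ℝ × ℝ)) := by fun_prop
      refine (hcont.tendsto (q, 0)).eventually (hmix ((q.1, 0), (q.2.1, q.2.2)) (fun z ↦ ?_)
        ⟨le_rfl, zero_le_one⟩)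
      rw [← mixField_val_eq (χ := fun _ ↦ ρ q.2.1) rfl]
      simp only [V, mixField_val, seg_self]
  obtain ⟨κ, hκ, h2⟩ := exists_pos_forall_of_eventually
    (Q := Q × (Icc (0 : ℝ) 1 × Icc (0 : ℝ) 1)) (P := fun p ↦
      ∀ z ∈ (univ ×ˢ {0} : Set (M.bd × ℝ)), PosAt C (V ((p.1.1, p.1.2.1), (p.1.2.2, p.2))) univ z)
    fun q ↦ by
      have hcont : Continuous fun p : (Q × (Icc (0 : ℝ) 1 × Icc (0 : ℝ) 1)) × ℝ ↦
        (((p.1.1, (p.1.2.1 : ℝ)), ((p.1.2.2 : ℝ), p.2)) : (Q × ℝ) × (ℝ × ℝ)) := by fun_prop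
      refine (hcont.tendsto (q, 0)).eventually (hmix ((q.1, q.2.1), (q.2.2, 0)) (fun z ↦ ?_)
        q.2.1.2)
      refine mixField_val_eq (χ := fun σ ↦ ρ (q.2.2 + 0 * σ)) ?_
      simp
  -- From time `t₂` on, `K = 1 + c ≥ κ⁻¹`.
  let c : ℝ := max 0 (κ⁻¹ - 1)
  have hc0 : 0 ≤ c := le_max_left _ _
  have hτ : ∀ t, 0 ≤ clamp t₂ t / t₂ := fun t ↦ div_nonneg (clamp_nonneg _ _) ht₂.le
  have hK1 : ∀ t, 1 ≤ 1 + clamp t₂ t / t₂ * c := fun t ↦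
    le_add_of_nonneg_right (mul_nonneg (hτ t) hc0)
  refine ⟨fun t ↦ 1 + clamp t₂ t / t₂ * c, ?_, ?_, hK1, fun q t ht s hs x ↦ ?_⟩
  · have := continuous_clamp t₂
    fun_prop
  · simp [clamp_of_mem le_rfl ht₂.le]
  have hKi : (1 + clamp t₂ t / t₂ * c)⁻¹ ∈ Icc (0 : ℝ) 1 :=
    ⟨inv_nonneg.2 (zero_le_one.trans (hK1 t)), inv_le_one_of_one_le₀ (hK1 t)⟩
  rcases le_total t t₂ with h | h
  · exact h1 (q, (⟨s, hs⟩, ⟨_, hKi⟩)) t (by rwa [abs_of_nonneg ht.1]) (x, 0) ⟨mem_univ _, rfl⟩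
  · refine h2 (q, (⟨t, ht⟩, ⟨s, hs⟩)) _ ?_ (x, 0) ⟨mem_univ _, rfl⟩
    have h3 : clamp t₂ t / t₂ = 1 := by
      rw [clamp, min_eq_right h, max_eq_right ht₂.le, div_self ht₂.ne']
    rw [abs_of_nonneg hKi.1, h3, one_mul]
    refine inv_le_of_inv_le₀ hκ ?_
    have := le_max_right 0 (κ⁻¹ - 1)
    change κ⁻¹ ≤ 1 + max 0 (κ⁻¹ - 1)
    linarith

end Mfd

namespace Mfd

variable {M : Mfd.{u}} {C : CurvCond} {Q : Type*} [TopologicalSpace Q]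

/-- Inside the uniform collar, `b (q, 0) + ds²` is replaced by the segment at time `ρ s` plus `f
ds²`. Where `ρ` is constant this is a product with a line; in the transition zone `f` is the
constant `K²`, and the stretching factor takes effect. -/
theorem exists_stretch_lift [Nonempty M.bd] [CompactSpace Q] {h : Q → M.Form} (hc : Continuous h)
    (hh : ∀ q, h q ∈ M.curvMetrics C) {b : Q × ℝ → M.BdForm} (hbc : Continuous b)
    (hb : ∀ p, IsSmoothMetric (b p)) {δ : ℝ} (hδ : 0 < δ) (hδ1 : δ ≤ 1)
    (hbh : ∀ q, EqProd (M.cpull (h q)) (b (q, 0)) δ)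
    (hseg : ∀ q, ∀ t ∈ Icc (0 : ℝ) 1, ∀ ρ ∈ Icc (0 : ℝ) 1, PosOn C (seg (b (q, 0)) (b (q, t)) ρ)) :
    ∃ L : Q × ℝ → M.Form, Continuous L ∧ (∀ p, L p ∈ M.curvMetrics C) ∧
      (∀ q t, M.resB (L (q, t)) = b (q, clamp 1 t)) ∧ ∀ q, L (q, 0) = h q := by
  -- The profile `ρ` descends from `1` to `0` between `δ/4` and `δ/2`. The function `η` below is `1`
  -- from `δ/8` to `5δ/8`, around that zone, and `0` up to `δ/16` and from `3δ/4` on; so the length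
  -- element is `ds²` at the boundary, and nothing changes above `3δ/4`.
  let ρ : ℝ → ℝ := cutoff (δ / 4) (δ / 2)
  have hρs : ContDiff ℝ ∞ ρ := contDiff_cutoff _ _
  obtain ⟨K, hKc, hK0, hK1, hK⟩ := exists_stretch_factor hbc hb hseg hρs fun s ↦ cutoff_mem _ _ s
  let η : ℝ → ℝ := fun s ↦ cutoff (5 * δ / 8) (3 * δ / 4) s * (1 - cutoff (δ / 16) (δ / 8) s)
  have hηs : ContDiff ℝ ∞ η :=
    (contDiff_cutoff _ _).mul (contDiff_const.sub (contDiff_cutoff _ _))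
  have hη0 : ∀ s, 0 ≤ η s := fun s ↦
    mul_nonneg (cutoff_mem _ _ s).1 (sub_nonneg.2 (cutoff_mem _ _ s).2)
  -- At time zero `K 0 = 1` makes `f` constant `1`, so the lift starts at the given metric.
  let f : ℝ → ℝ → ℝ := fun t s ↦ 1 + (K (clamp 1 t) ^ 2 - 1) * η s
  have hfs : ∀ t, ContDiff ℝ ∞ (f t) := fun t ↦ contDiff_const.add (contDiff_const.mul hηs)
  have hf0 : ∀ t s, 0 < f t s := fun t s ↦ by
    have h1 := mul_nonneg (sub_nonneg.2 (one_le_pow₀ (n := 2) (hK1 (clamp 1 t)))) (hη0 s)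
    change 0 < 1 + (K (clamp 1 t) ^ 2 - 1) * η s
    linarith
  have hbs : SmoothFam b univ := smoothFam_boundary_of_mem hbc hb
  have hbsymm : ∀ p x, ((b p).val x).Symm := fun p ↦ ((isSmoothMetric_iff (b p)).1 (hb p)).1
  have hcl := continuous_clamp 1
  have hJ : UniqueDiffOn ℝ (Ico (0 : ℝ) 1) := uniqueDiffOn_Ico
  have hcyl := M.regularOn_cyl.1
  let m : Q × ℝ → M.CylForm := fun p ↦
    mixField (b (p.1, 0)) (b (p.1, clamp 1 p.2)) ρ (f p.2)
  let m₀ : Q × ℝ → M.CylForm := fun p ↦ prodField (b (p.1, 0)) (lineField fun _ ↦ 1)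
  let W : Q × ℝ → M.CylForm := fun p ↦ .ofVal M.IC fun z ↦
    (M.cpull (h p.1)).val z + ((m p).val z - (m₀ p).val z)
  have hm : SmoothFam m (cyl M.bd) := by
    refine smoothFam_mixField (hbs.reparam (by fun_prop)) (hbs.reparam (by fun_prop)) hJ
      (fun n ↦ .const hJ hρs.contDiffOn) fun n ↦ ?_
    exact (FamOn.const hJ contDiffOn_const).add hJ ((FamOn.param hJ (by fun_prop)).mul hJ
      (.const hJ hηs.contDiffOn))
  have hm₀ : SmoothFam m₀ (cyl M.bd) :=
    smoothFam_prod_lineField uniqueMDiffOn_univ hJ (hbs.reparam (by fun_prop))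
      fun n ↦ .const hJ contDiffOn_const
  have hW : SmoothFam W (cyl M.bd) :=
    ((M.smoothFam_cpull (smoothFam_of_mem hc fun q ↦ (hh q).1.1)).reparam continuous_fst).add hcyl
      (hm.sub hcyl hm₀)
  have hWs : ∀ p, ∀ z ∈ cyl M.bd, ((W p).val z).Symm := fun p z _ ↦
    (symm_cpull (hh p.1).1 z).add ((symm_mixField (hbsymm _) (hbsymm _) _ _ z).sub
      ((hbsymm _ z.1).prod (mulBil_symm.smul 1)))
  have hWm : ∀ p, ∀ z : M.bd × ℝ, 0 ≤ z.2 → z.2 < δ → (W p).val z = (m p).val z := by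
    rintro p ⟨x, s⟩ h0 hs
    change (M.cpull (h p.1)).val (x, s) + ((m p).val (x, s) - (m₀ p).val (x, s)) = _
    rw [hbh p.1 x s h0 hs, val_prod_lineField, one_smul, add_sub_cancel]
  have hWb : ∀ p, EqProd (W p) (b (p.1, clamp 1 p.2)) (δ / 16) := fun p x s h0 hs ↦ by
    have h1 : ρ s = 1 := cutoff_of_le (by linarith) (by linarith)
    have h2 : η s = 0 := by
      simp only [η, cutoff_of_le (show δ / 16 < δ / 8 by linarith) hs.le, sub_self, mul_zero]
    rw [hWm p (x, s) h0 (by linarith), mixField_val]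
    simp only [h1, seg_one, f, h2, mul_zero, add_zero, one_smul]
  have hWc : ∀ p, ∀ z ∈ cyl M.bd, 3 * δ / 4 ≤ z.2 →
      (W p).val z = (M.cpull (h p.1)).val z := fun p z _ hz ↦ by
    have h1 : ρ z.2 = 0 := cutoff_of_ge (by linarith) (by linarith)
    have h2 : η z.2 = 0 := by
      simp only [η, cutoff_of_ge (show 5 * δ / 8 < 3 * δ / 4 by linarith) hz, zero_mul]
    change (M.cpull (h p.1)).val z + ((m p).val z - (m₀ p).val z) = _
    rw [mixField_val, val_prod_lineField]
    simp only [h1, seg_zero, f, h2, mul_zero, add_zero, sub_self]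
  have hpos : ∀ p, ∀ z ∈ (univ ×ˢ Icc 0 (3 * δ / 4) : Set (M.bd × ℝ)),
      PosAt C (W p) (cyl M.bd) z := by
    rintro p ⟨x, s⟩ ⟨-, hs0, hs1⟩
    have hsJ : s ∈ Ico (0 : ℝ) 1 := ⟨hs0, by linarith⟩
    have hO : IsOpen (univ ×ˢ Iio δ : Set (M.bd × ℝ)) := isOpen_univ.prod isOpen_Iio
    rw [posAt_congr_of_isOpen (X := cyl M.bd) (x := (x, s)) hO ⟨mem_univ _, by
      change s < δ
      linarith⟩ ⟨mem_univ _, hsJ⟩ fun z hz ↦ hWm p z hz.1.2.1 hz.2.2]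
    have ht : clamp 1 p.2 ∈ Icc (0 : ℝ) 1 := ⟨clamp_nonneg _ _, clamp_le zero_le_one _⟩
    have hp0 := hseg p.1 _ ht 0 ⟨le_rfl, zero_le_one⟩
    have hp1 := hseg p.1 _ ht 1 ⟨zero_le_one, le_rfl⟩
    rcases lt_or_ge s (δ / 4) with h1 | h1
    · exact posAt_mixField (ρ := 1) (isSmoothMetric_seg (hb _) (hb _) hp1) hp1 hJ isOpen_Iio
        (fun s hs ↦ cutoff_of_le (by linarith) (le_of_lt hs.2)) (hfs _) (hf0 _) (z := (x, s))
        ⟨hsJ, h1⟩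
    rcases lt_or_ge (δ / 2) s with h2 | h2
    · exact posAt_mixField (ρ := 0) (isSmoothMetric_seg (hb _) (hb _) hp0) hp0 hJ isOpen_Ioi
        (fun s hs ↦ cutoff_of_ge (by linarith) (le_of_lt hs.2)) (hfs _) (hf0 _) (z := (x, s))
        ⟨hsJ, h2⟩
    · have hsO : s ∈ Ioo (δ / 8) (5 * δ / 8) := ⟨by linarith, by linarith⟩
      have hOJ : Ioo (δ / 8) (5 * δ / 8) ⊆ Ico (0 : ℝ) 1 := fun s hs ↦
        ⟨by linarith [hs.1], by linarith [hs.2]⟩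
      refine posAt_mixField_of_stretch (K := K (clamp 1 p.2)) (hb _) (hb _) hρs isOpen_Ioo
        (zero_lt_one.trans_le (hK1 _)) hOJ (fun s hs ↦ ?_) hsO
        (hK p.1 _ ht s ⟨hs0, by linarith⟩ x)
      simp only [f, η, cutoff_of_le (show 5 * δ / 8 < 3 * δ / 4 by linarith) hs.2.le,
        cutoff_of_ge (show δ / 16 < δ / 8 by linarith) hs.1.le]
      ring
  obtain ⟨L, hLc, hLm, hLr, -, hLe⟩ := exists_replace (M := M) (C := C) (Q := Q × ℝ)
    (h := fun p ↦ h p.1) (hc.comp continuous_fst) (fun p ↦ hh p.1) hW hWs (c := 3 * δ / 4)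
    (by linarith) hWc hpos (b := fun p ↦ b (p.1, clamp 1 p.2))
    fun p ↦ ⟨δ / 16, by linarith, by linarith, hWb p⟩
  refine ⟨L, hLc, hLm, fun q t ↦ hLr (q, t), fun q ↦ hLe (q, 0) fun z _ ↦ ?_⟩
  have h1 : clamp 1 0 = 0 := clamp_of_mem le_rfl zero_le_one
  change (M.cpull (h q)).val z + ((mixField (b (q, 0)) (b (q, clamp 1 0)) ρ (f 0)).val z -
    (m₀ (q, 0)).val z) = (M.cpull (h q)).val z
  rw [mixField_val, val_prod_lineField]
  simp only [h1, seg_self, f, hK0, one_pow, sub_self, zero_mul, add_zero]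

end Mfd

/-! ### Concatenation and lifting of homotopies. -/

namespace Mfd

variable {M : Mfd.{u}} {C : CurvCond} {Q : Type*} [TopologicalSpace Q]

/-- Concatenation of homotopies of metrics. -/
theorem exists_glue {L₁ L₂ : Q × ℝ → M.Form} (hc₁ : Continuous L₁) (hc₂ : Continuous L₂)
    (hm₁ : ∀ p, L₁ p ∈ M.curvMetrics C) (hm₂ : ∀ p, L₂ p ∈ M.curvMetrics C) {a : ℝ}
    (h : ∀ q, L₂ (q, 0) = L₁ (q, a)) {B : Q × ℝ → M.BdForm}
    (hr₁ : ∀ q, ∀ t ≤ a, M.resB (L₁ (q, t)) = B (q, t))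
    (hr₂ : ∀ q, ∀ t > a, M.resB (L₂ (q, t - a)) = B (q, t)) :
    ∃ L : Q × ℝ → M.Form, Continuous L ∧ (∀ p, L p ∈ M.curvMetrics C) ∧
      (∀ p, M.resB (L p) = B p) ∧ ∀ q, ∀ t ≤ a, L (q, t) = L₁ (q, t) := by
  refine ⟨fun p ↦ if p.2 ≤ a then L₁ p else L₂ (p.1, p.2 - a), ?_, fun p ↦ ?_, fun p ↦ ?_,
    fun q t ht ↦ if_pos ht⟩
  · refine Continuous.if_le hc₁ (hc₂.comp (by fun_prop)) continuous_snd continuous_const ?_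
    rintro ⟨q, t⟩ rfl
    change L₁ (q, t) = L₂ (q, t - t)
    rw [sub_self, h]
  · dsimp only
    split_ifs
    exacts [hm₁ p, hm₂ _]
  · dsimp only
    split_ifs with hp
    exacts [hr₁ p.1 p.2 hp, hr₂ p.1 p.2 (not_le.1 hp)]

/-- The short lift runs up to a time `a ≤ T` and provides collars of uniform width; the stretching
lift covers the rest of the interval, since its starting metrics `b (q, a)` are joined to all later
ones by admissible segments. -/
theorem exists_lift_of_seg [Nonempty M.bd] [CompactSpace Q] {h : Q → M.Form} (hc : Continuous h)
    (hh : ∀ q, h q ∈ M.curvMetrics C) {b : Q × ℝ → M.BdForm} (hbc : Continuous b)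
    (hb : ∀ p, IsSmoothMetric (b p)) (hbh : ∀ q, M.resB (h q) = b (q, 0)) {T : ℝ} (hT : 0 < T)
    (hseg : ∀ q, ∀ t ∈ Icc 0 T, ∀ t' ∈ Icc 0 T, ∀ ρ ∈ Icc (0 : ℝ) 1,
      PosOn C (seg (b (q, t)) (b (q, t')) ρ)) :
    ∃ L : Q × ℝ → M.Form, Continuous L ∧ (∀ p, L p ∈ M.curvMetrics C) ∧
      (∀ q t, M.resB (L (q, t)) = b (q, clamp T t)) ∧ ∀ q, L (q, 0) = h q := by
  obtain ⟨t₁, ht₁, h1⟩ := exists_short_lift hc hh hbc hb hbh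
  have ha : 0 < min t₁ T := lt_min ht₁ hT
  obtain ⟨L₁, hc₁, hm₁, hr₁, h₁0, δ, hδ, hδ1, he⟩ := h1 _ ha (min_le_left _ _)
  have haT : min t₁ T ≤ T := min_le_right _ _
  generalize min t₁ T = a at *
  have hcl : ∀ t, clamp T t ∈ Icc 0 T := fun t ↦ ⟨clamp_nonneg _ _, clamp_le hT.le _⟩
  have hcT := continuous_clamp T
  -- The second lift runs through the boundary times `a + T t`, stopped at `T`. Since `a + T ≥ T`,
  -- its unit time interval suffices.
  have h0 : clamp T (a + T * 0) = a := by
    rw [mul_zero, add_zero, clamp_of_mem ha.le haT]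
  obtain ⟨L₂, hc₂, hm₂, hr₂, h₂0⟩ := exists_stretch_lift (h := fun q ↦ L₁ (q, a)) (C := C)
    (b := fun p ↦ b (p.1, clamp T (a + T * p.2))) (hc₁.comp (by fun_prop)) (fun q ↦ hm₁ _)
    (hbc.comp (by fun_prop)) (fun p ↦ hb _) hδ hδ1 (fun q ↦ by simpa only [h0] using he q)
    fun q t _ ρ hρ ↦ hseg q _ (hcl _) _ (hcl _) ρ hρ
  obtain ⟨L, hLc, hLm, hLr, hL0⟩ := exists_glue (a := a) (L₂ := fun p ↦ L₂ (p.1, p.2 / T))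
    (B := fun p ↦ b (p.1, clamp T p.2)) hc₁ (hc₂.comp (by fun_prop)) hm₁ (fun p ↦ hm₂ _)
    (fun q ↦ by simpa only [zero_div] using h₂0 q) (fun q t ht ↦ by
      rw [hr₁, clamp, clamp, min_eq_left ht, min_eq_left (ht.trans haT)]) fun q t ht ↦ by
      dsimp only
      rw [hr₂]
      have h3 : 0 ≤ (t - a) / T := div_nonneg (sub_nonneg.2 (le_of_lt ht)) hT.le
      rcases le_total ((t - a) / T) 1 with h2 | h2
      · rw [clamp_of_mem h3 h2, mul_div_cancel₀ _ hT.ne', add_sub_cancel]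
      · have h4 : T ≤ t := by
          rw [le_div_iff₀ hT] at h2
          linarith
        have h5 : clamp 1 ((t - a) / T) = 1 := by
          rw [clamp, min_eq_right h2, max_eq_right zero_le_one]
        rw [h5, clamp, clamp, min_eq_right h4, min_eq_right (by linarith)]
  exact ⟨L, hLc, hLm, fun q t ↦ hLr (q, t), fun q ↦ (hL0 q 0 ha.le).trans (h₁0 q)⟩

/-- For `t' = t` the segment is constant; openness and compactness in `q`, `t` and `ρ` give a
uniform `η`. -/
theorem exists_pos_forall_seg [CompactSpace Q] {b : Q × ℝ → M.BdForm} (hbc : Continuous b)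
    (hb : ∀ p, IsSmoothMetric (b p)) (hp : ∀ p, PosOn C (b p)) :
    ∃ η > 0, ∀ q, ∀ t ∈ Icc (0 : ℝ) 1, ∀ t', |t' - t| ≤ η → ∀ ρ ∈ Icc (0 : ℝ) 1,
      PosOn C (seg (b (q, t)) (b (q, t')) ρ) := by
  have hbs : SmoothFam b univ := smoothFam_boundary_of_mem hbc hb
  have hbsymm : ∀ p x, ((b p).val x).Symm := fun p ↦ ((isSmoothMetric_iff (b p)).1 (hb p)).1
  obtain ⟨η, hη, h⟩ := exists_pos_forall_of_eventually
    (Q := Q × (Icc (0 : ℝ) 1 × Icc (0 : ℝ) 1)) (P := fun p ↦ ∀ x ∈ (univ : Set M.bd),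
      PosAt C (seg (b (p.1.1, p.1.2.1)) (b (p.1.1, p.1.2.1 + p.2)) p.1.2.2) univ x) fun q ↦
    (smoothFam_seg (hbs.reparam (by fun_prop)) (hbs.reparam (by fun_prop))
      (by fun_prop)).eventually_forall_posAt isOpen_univ.regularOn
        (fun p x _ ↦ symm_seg (hbsymm _) (hbsymm _) _ x) isCompact_univ subset_rfl fun x _ ↦ by
          simp only [add_zero, seg_self]
          exact hp _ x
  refine ⟨η, hη, fun q t ht t' htt ρ hρ x ↦ ?_⟩
  have h1 := h (q, (⟨t, ht⟩, ⟨ρ, hρ⟩)) (t' - t) htt x (mem_univ x)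
  simpa only [add_sub_cancel] using h1

/-- Lifting of homotopies of boundary metrics. -/
theorem exists_lift [Nonempty M.bd] [CompactSpace Q] {h : Q → M.Form} (hc : Continuous h)
    (hh : ∀ q, h q ∈ M.curvMetrics C) {b : Q × ℝ → M.BdForm} (hbc : Continuous b)
    (hb : ∀ p, IsSmoothMetric (b p)) (hp : ∀ p, PosOn C (b p))
    (hbh : ∀ q, M.resB (h q) = b (q, 0)) :
    ∃ L : Q × ℝ → M.Form, Continuous L ∧ (∀ p, L p ∈ M.curvMetrics C) ∧
      (∀ q t, M.resB (L (q, t)) = b (q, clamp 1 t)) ∧ ∀ q, L (q, 0) = h q := by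
  obtain ⟨η, hη, hseg⟩ := exists_pos_forall_seg hbc hb hp
  obtain ⟨n, hn⟩ := exists_nat_one_div_lt hη
  -- The step is shorter than `η`, so any two times within one step are joined by an admissible
  -- segment.
  let T : ℝ := 1 / (n + 1)
  have hT : 0 < T := Nat.one_div_pos_of_nat
  have key : ∀ k ≤ n + 1, ∃ L : Q × ℝ → M.Form, Continuous L ∧ (∀ p, L p ∈ M.curvMetrics C) ∧
      (∀ q t, M.resB (L (q, t)) = b (q, clamp (k * T) t)) ∧ ∀ q, L (q, 0) = h q := by
    intro k
    induction k with
    | zero =>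
      refine fun _ ↦ ⟨fun p ↦ h p.1, hc.comp continuous_fst, fun p ↦ hh _, fun q t ↦ ?_,
        fun q ↦ rfl⟩
      have : clamp ((0 : ℕ) * T) t = 0 := by
        rw [Nat.cast_zero, zero_mul]
        exact max_eq_left (min_le_right _ _)
      rw [this, hbh]
    | succ k ih =>
      intro hk
      obtain ⟨L₁, hc₁, hm₁, hr₁, h₁0⟩ := ih (by omega)
      have hk0 : 0 ≤ k * T := by positivity
      have hk1 : (k + 1) * T ≤ 1 := by
        have h1 : ((k + 1 : ℕ) : ℝ) ≤ ((n + 1 : ℕ) : ℝ) := Nat.cast_le.2 hk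
        push_cast at h1
        change (k + 1) * (1 / ((n : ℝ) + 1)) ≤ 1
        rw [mul_one_div]
        exact (div_le_one (by positivity)).2 h1
      rw [add_mul, one_mul] at hk1
      obtain ⟨L₂, hc₂, hm₂, hr₂, h₂0⟩ := exists_lift_of_seg (h := fun q ↦ L₁ (q, k * T)) (C := C)
        (b := fun p ↦ b (p.1, k * T + p.2)) (hc₁.comp (by fun_prop)) (fun q ↦ hm₁ _)
        (hbc.comp (by fun_prop)) (fun p ↦ hb _)
        (fun q ↦ by rw [hr₁, clamp_of_mem hk0 le_rfl, add_zero]) hT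
        fun q t ht t' ht' ρ hρ ↦ hseg q _ ⟨add_nonneg hk0 ht.1, by linarith [ht.2]⟩ _ (by
          rw [add_sub_add_left_eq_sub]
          exact (abs_sub_le_iff.2 ⟨by linarith [ht.1, ht'.2], by linarith [ht.2, ht'.1]⟩).trans
            (le_of_lt hn)) ρ hρ
      obtain ⟨L, hLc, hLm, hLr, hL0⟩ := exists_glue (a := k * T)
        (B := fun p ↦ b (p.1, clamp ((k + 1 : ℕ) * T) p.2)) hc₁ hc₂ hm₁ hm₂ h₂0
        (fun q t ht ↦ by
          have h1 : t ≤ (k + 1 : ℕ) * T := by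
            push_cast
            linarith
          rw [hr₁, clamp, clamp, min_eq_left ht, min_eq_left h1]) fun q t ht ↦ by
          rw [hr₂]
          dsimp only
          congr 2
          push_cast
          rcases le_total t ((k + 1) * T) with h1 | h1
          · rw [clamp_of_mem (by linarith) (by linarith), clamp_of_mem (by linarith) h1]
            ring
          · rw [clamp, clamp, min_eq_right h1, min_eq_right (by linarith), max_eq_right hT.le,
              max_eq_right (by positivity)]
            ring
      exact ⟨L, hLc, hLm, fun q t ↦ hLr (q, t), fun q ↦ (hL0 q 0 hk0).trans (h₁0 q)⟩
  have h1 : ((n + 1 : ℕ) : ℝ) * T = 1 := by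
    push_cast
    exact mul_one_div_cancel (by positivity)
  simpa only [h1] using key (n + 1) le_rfl

end Mfd

/-! ### The Serre fibration property and conclusion. -/

namespace Mfd

variable {M : Mfd.{u}} {C : CurvCond}

/-- The boundary has no boundary of its own, so the product condition is vacuous. -/
theorem mem_curvMetrics_boundary {g : M.BdForm} :
    Membership.mem (M.boundary.curvMetrics C) g ↔ IsSmoothMetric g ∧ PosOn C g :=
  ⟨fun h ↦ ⟨h.1.1, h.2⟩, fun h ↦ ⟨⟨h.1, 1, one_pos, le_rfl, fun x ↦ PEmpty.elim x⟩, h.2⟩⟩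

-- Cubes enter only through their compactness, which `exists_lift` needs. The boundary homotopy is
-- extended to all real times by projecting to the unit interval.
variable (C) in
theorem isSerreFibration_res (hM : Nonempty M.bd) :
    ∃ h : MapsTo M.res (M.curvMetrics C) (M.boundary.curvMetrics C),
      IsSerreFibration h.restrict := by
  refine ⟨fun g hg ↦ mem_curvMetrics_boundary.2 ⟨isSmoothMetric_resB hg, posOn_resB hg⟩, ?_, ?_⟩
  · exact Continuous.subtype_mk (M.smoothFam_resB (smoothFam_of_mem continuous_subtype_val
      fun g : M.curvMetrics C ↦ g.2.1.1)).continuous _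
  intro m h G hG
  have hbc : Continuous fun p : (Fin m → unitInterval) × ℝ ↦
      (G (p.1, projIcc 0 1 zero_le_one p.2)).1 :=
    continuous_subtype_val.comp (G.continuous.comp
      (continuous_fst.prodMk (continuous_projIcc.comp continuous_snd)))
  have hb := fun p : (Fin m → unitInterval) × ℝ ↦
    mem_curvMetrics_boundary.1 (G (p.1, projIcc 0 1 zero_le_one p.2)).2
  obtain ⟨L, hLc, hLm, hLr, hL0⟩ := exists_lift (h := fun q ↦ (h q).1)
    (continuous_subtype_val.comp h.continuous) (fun q ↦ (h q).2) hbc (fun p ↦ (hb p).1)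
    (fun p ↦ (hb p).2) fun q ↦ by
      have h1 := congrArg Subtype.val (hG q)
      dsimp only
      rw [projIcc_left]
      exact h1.symm
  refine ⟨⟨fun q ↦ ⟨L (q.1, q.2), hLm _⟩, (hLc.comp (by fun_prop)).subtype_mk _⟩,
    fun q ↦ Subtype.ext (hL0 q), fun q ↦ Subtype.ext ?_⟩
  have h1 := hLr q.1 q.2
  rw [clamp_of_mem q.2.2.1 q.2.2.2] at h1
  dsimp only at h1
  rw [projIcc_val] at h1
  exact h1

/-- A manifold with non-empty boundary has a point, and so has its boundary; this makes the
pointwise descriptions of the curvature conditions available for both. -/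
theorem isFibrant_of_forall_eq {F : ∀ M : Mfd.{u}, Set M.Form}
    (hF : ∀ M : Mfd.{u}, Nonempty M.carrier → F M = M.curvMetrics C) : IsFibrant F := by
  intro M hM
  obtain ⟨x⟩ := hM
  rw [hF M ⟨M.collar (x, 0)⟩, hF M.boundary ⟨x⟩]
  exact isSerreFibration_res C ⟨x⟩

theorem isFibrant_posPCurv (p : ℕ) : IsFibrant.{u} (posPCurv p) :=
  isFibrant_of_forall_eq fun _ _ ↦ Set.ext fun _ ↦ and_congr_right fun hg ↦ posPCurv_iff hg.1

theorem isFibrant_posCoRic (k : ℕ) : IsFibrant.{u} (posCoRic k) :=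
  isFibrant_of_forall_eq fun _ _ ↦ Set.ext fun _ ↦ and_congr_right fun hg ↦ posCoRic_iff hg.1

end Mfd
end

theorem mainTheorem8 (p k : ℕ) :
    IsFibrant.{u} (Mfd.posPCurv p) ∧ IsFibrant.{u} (Mfd.posCoRic k) ∧
    ∀ (N : Mfd.{u}), IsEmpty N.bd → Nonempty N.carrier → ∀ g ∈ N.metrics,
      (PosPCurv p g ↔ PosPCurv p (stab g)) ∧ (PosCoRic k g ↔ PosCoRic k (stab g)) :=
  ⟨Mfd.isFibrant_posPCurv p, Mfd.isFibrant_posCoRic k, fun N _ hN _ hg ↦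
    stab_equivalence p k N hN hg⟩
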